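/- Let $G=\mathrm{PSL}_2(\mathbb R)$, and write $n_x=\begin{pmatrix}1&x\\0&1\end{pmatrix}$, $a_y=\begin{pmatrix}\sqrt y&0\\0&1/\sqrt y\end{pmatrix}$ $(y>0)$, $k_\theta=\begin{pmatrix}\cos\theta&\sin\theta\\-\sin\theta&\cos\theta\end{pmatrix}$. Let $\Gamma<G$ be a torsion-free, discrete, finitely generated subgroup whose critical exponent $\delta$ (the abscissa of convergence of $\sum_{\gamma\in\Gamma}e^{-s\,d(i,\gamma i)}$) satisfies $\tfrac12<\delta<1$. Let $V_\delta\subset L^2(\Gamma\backslash G)$ be the irreducible infinite-dimensional subrepresentation (for right translation by $G$) on which the Casimir operator $$\mathcal C=-y^2\Big(\frac{\partial^2}{\partial x^2}+\frac{\partial^2}{\partial y^2}\Big)+y\frac{\partial^2}{\partial x\,\partial\theta}$$ (in the coordinates $g=n_xa_yk_\theta$) acts by the scalar $\delta(1-\delta)$. Let $\nu_i$ be a Patterson measure of $\Gamma$ with respect to $i$, that is, up to a positive scalar, a weak limit (along some sequence $s\to\delta^+$) of the probability measures $$\Big(\sum_{\gamma\in\Gamma}e^{-s\,d(i,\gamma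 i)}\Big)^{-1}\sum_{\gamma\in\Gamma}e^{-s\,d(i,\gamma i)}\,\delta_{\gamma i}$$ on the compactified hyperbolic plane $\mathbb H^2\cup\mathbb R\cup\{\infty\}$, scaled so that $$\phi_0(n_xa_yk_\theta)=\int_{\mathbb R}\Big(\frac{(u^2+1)y}{(x-u)^2+y^2}\Big)^{\delta}d\nu_i(u)$$ has norm $1$ in $L^2(\Gamma\backslash G)$. For every integer $\ell\ge0$ and each choice of sign there is a vector $\phi_{\pm\ell}\in V_\delta\cap C^\infty(\Gamma\backslash G)$ with $\|\phi_{\pm\ell}\|_2=1$ and $\phi_{\pm\ell}(gk_\theta)=e^{\pm2\ell i\theta}\phi_{\pm\ell}(g)$ for all $g$ and $\theta$; and every such vector is given, up to multiplication by a complex number of modulus one, by $$\phi_{\pm\ell}(n_xa_yk_\theta)=e^{\pm2\ell i\theta}\, \frac{\sqrt{\Gamma(\delta+\ell)\Gamma(1-\delta)}}{\sqrt{\Gamma(\delta)\Gamma(1-\delta+\ell)}} \int_{\mathbb R}\Big(\frac{(u^2+1)y}{(x-u)^2+y^2}\Big)^{\delta} \Big(\frac{(x-u)\mp iy}{(x-u)\pm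 iy}\Big)^{\ell}d\nu_i(u)$$ for all $x\in\mathbb R$, $y>0$, $\theta\in\mathbb R$, where $\Gamma(\cdot)$ is the Gamma function. Consequently, for all $x\in\mathbb R$ and $y>0$, $$|\phi_{\pm\ell}(n_xa_y)|\le\frac{\sqrt{\Gamma(\delta+\ell)\Gamma(1-\delta)}}{\sqrt{\Gamma(\delta)\Gamma(1-\delta+\ell)}}\;\phi_0(n_xa_y).$$ -/

import Mathlib

open MeasureTheory Filter Topology
open scoped ENNReal UpperHalfPlane MatrixGroups

noncomputable section

namespace BaseRep

/-- The group `PSL₂(ℝ)`, i.e. `SL₂(ℝ)` modulo its centre `{±1}`, with the quotient topology. -/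
abbrev G : Type := Matrix.ProjectiveSpecialLinearGroup (Fin 2) ℝ

instance : MeasurableSpace G := borel G

instance : BorelSpace G := ⟨rfl⟩

instance : MeasurableSpace (OnePoint ℂ) := borel (OnePoint ℂ)

instance : BorelSpace (OnePoint ℂ) := ⟨rfl⟩

/-! ### Iwasawa coordinates -/

/-- The image in `PSL₂(ℝ)` of a matrix of determinant one. -/
def toG (A : SL(2, ℝ)) : G := QuotientGroup.mk A

/-- The matrix `(1 x; 0 1)`. -/
def nMat (x : ℝ) : SL(2, ℝ) := ⟨!![1, x; 0, 1], by simp [Matrix.det_fin_two_of]⟩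

/-- The matrix `(√y 0; 0 1/√y)` for `y > 0`. -/
def aMat (y : ℝ) (hy : 0 < y) : SL(2, ℝ) :=
  ⟨!![√y, 0; 0, (√y)⁻¹], by
    rw [Matrix.det_fin_two_of, mul_inv_cancel₀ (Real.sqrt_pos.2 hy).ne']; simp⟩

/-- The matrix `(cos θ, sin θ; -sin θ, cos θ)`. -/
def kMat (θ : ℝ) : SL(2, ℝ) :=
  ⟨!![Real.cos θ, Real.sin θ; -Real.sin θ, Real.cos θ], by
    rw [Matrix.det_fin_two_of]; nlinarith [Real.sin_sq_add_cos_sq θ]⟩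

/-- The element `n_x` of `PSL₂(ℝ)`. -/
def nElt (x : ℝ) : G := toG (nMat x)

/-- The element `a_y` of `PSL₂(ℝ)` for `y > 0`; for `y ≤ 0`, where it is never used, the value is
`1` by convention. -/
def aElt (y : ℝ) : G := if hy : 0 < y then toG (aMat y hy) else 1

/-- The element `k_θ` of `PSL₂(ℝ)`. -/
def kElt (θ : ℝ) : G := toG (kMat θ)

/-- The point `n_x a_y k_θ` of `PSL₂(ℝ)`. -/
def iwasawa (x y θ : ℝ) : G := nElt x * aElt y * kElt θ

/-- Smoothness of a function on `PSL₂(ℝ)`. The map `(x, y, θ) ↦ n_x a_y k_θ` is a smooth covering of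
`PSL₂(ℝ)` by `ℝ × (0, ∞) × ℝ`, so smoothness may be tested in these coordinates. -/
def IsSmooth (f : G → ℂ) : Prop :=
  ContDiffOn ℝ ((⊤ : ℕ∞) : WithTop ℕ∞) (fun p : ℝ × ℝ × ℝ => f (iwasawa p.1 p.2.1 p.2.2)) {p | 0 < p.2.1}

/-- The Casimir operator `-y² (∂²/∂x² + ∂²/∂y²) + y ∂²/∂x∂θ`, applied to `f` and evaluated at
`n_x a_y k_θ`. -/
def casimir (f : G → ℂ) (x y θ : ℝ) : ℂ :=
  -(y : ℂ) ^ 2 * (iteratedDeriv 2 (fun x' => f (iwasawa x' y θ)) x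
      + iteratedDeriv 2 (fun y' => f (iwasawa x y' θ)) y)
    + (y : ℂ) * deriv (fun x' => deriv (fun θ' => f (iwasawa x' y θ')) θ) x

/-! ### The action on the hyperbolic plane and the critical exponent -/

/-- The action of `PSL₂(ℝ)` on the hyperbolic plane by Möbius transformations, as a homomorphism to
permutations: the action of `SL₂(ℝ)` factors through the centre. -/
def moebiusHom : G →* Equiv.Perm ℍ :=
  QuotientGroup.lift _ (MulAction.toPermHom SL(2, ℝ) ℍ) (by
    intro A hA
    have h : ∀ z : ℍ, A • z = z := by
      intro z
      obtain ⟨r, hr, hA'⟩ := Matrix.SpecialLinearGroup.mem_center_iff.1 hA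
      have hr0 : r ≠ 0 := by
        rintro rfl
        simp at hr
      apply UpperHalfPlane.ext
      have e := UpperHalfPlane.specialLinearGroup_apply A z
      have h00 : A 0 0 = r := by rw [← hA']; simp [Matrix.scalar]
      have h01 : A 0 1 = 0 := by rw [← hA']; simp [Matrix.scalar]
      have h10 : A 1 0 = 0 := by rw [← hA']; simp [Matrix.scalar]
      have h11 : A 1 1 = r := by rw [← hA']; simp [Matrix.scalar]
      have hrc : (r : ℂ) ≠ 0 := by exact_mod_cast hr0
      rw [e]
      simp [h00, h01, h10, h11, mul_div_cancel_left₀ _ hrc]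
    exact Equiv.ext h)

instance : MulAction G ℍ := MulAction.compHom ℍ moebiusHom

/-- The critical exponent of `Γ`: the abscissa of convergence of `∑_{γ ∈ Γ} exp (-s d(i, γ i))`. -/
def criticalExponent (Γ : Subgroup G) : ℝ :=
  sInf {s : ℝ | 0 ≤ s ∧
    Summable fun γ : Γ => Real.exp (-s * dist UpperHalfPlane.I ((γ : G) • UpperHalfPlane.I))}

/-! ### Patterson measures

The compactification of the hyperbolic plane by its boundary `ℝ ∪ {∞}` is the closed subset
`{Im z ≥ 0} ∪ {∞}` of the Riemann sphere `OnePoint ℂ`; measures on it are regarded as measures on the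
sphere. -/

/-- The weight `exp (-s d(i, γ i))`. -/
def orbitWeight {Γ : Subgroup G} (s : ℝ) (γ : Γ) : ℝ≥0∞ :=
  ENNReal.ofReal (Real.exp (-s * dist UpperHalfPlane.I ((γ : G) • UpperHalfPlane.I)))

/-- The probability measure
`(∑_γ exp (-s d(i, γ i)))⁻¹ ∑_γ exp (-s d(i, γ i)) δ_{γ i}`, for `s` above the critical exponent. -/
def orbitMeasure (Γ : Subgroup G) (s : ℝ) : Measure (OnePoint ℂ) :=
  (∑' γ : Γ, orbitWeight s γ)⁻¹ • Measure.sum fun γ : Γ =>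
    orbitWeight s γ • Measure.dirac (((((γ : G) • UpperHalfPlane.I : ℍ) : ℂ)) : OnePoint ℂ)

/-- `ν` is a Patterson measure of `Γ` with respect to `i`: up to a positive factor it is a weak limit
of the measures `orbitMeasure Γ s` as `s` decreases to the critical exponent (along some sequence). -/
def IsPattersonMeasure (Γ : Subgroup G) (ν : Measure (OnePoint ℂ)) : Prop :=
  ∃ (c : ℝ≥0∞) (ν₀ : Measure (OnePoint ℂ)) (s : ℕ → ℝ),
    c ≠ 0 ∧ c ≠ ∞ ∧ IsProbabilityMeasure ν₀ ∧ ν = c • ν₀ ∧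
    Tendsto s atTop (𝓝[>] (criticalExponent Γ)) ∧
    ∀ f : C(OnePoint ℂ, ℝ),
      Tendsto (fun j => ∫ w, f w ∂(orbitMeasure Γ (s j))) atTop (𝓝 (∫ w, f w ∂ν₀))

/-- The part on `ℝ` of a measure on the sphere. -/
def onReal (ν : Measure (OnePoint ℂ)) : Measure ℝ :=
  ν.comap fun u : ℝ => ((u : ℂ) : OnePoint ℂ)

/-- The base eigenfunction `x + iy ↦ ∫_ℝ ((u² + 1) y / ((x - u)² + y²))^δ dν(u)`. -/
def baseEigenfunction (δ : ℝ) (ν : Measure (OnePoint ℂ)) (z : ℍ) : ℝ :=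
  ∫ u : ℝ, ((u ^ 2 + 1) * z.im / ((z.re - u) ^ 2 + z.im ^ 2)) ^ δ ∂(onReal ν)

/-! ### The space `L²(Γ\G)` and the base representation -/

/-- `Γ\G`, the space of orbits of `Γ` acting on `G` by left multiplication. -/
abbrev LeftQuotient (Γ : Subgroup G) : Type := Quotient (MulAction.orbitRel Γ G)

/-- The projection `G → Γ\G`. -/
def proj (Γ : Subgroup G) (g : G) : LeftQuotient Γ := Quotient.mk _ g

/-- The function `f` on `G` has norm one in `L²(Γ\G)`: the integral of `|f|²` over any fundamental
domain for `Γ` in `G` equals one. -/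
def HasUnitNorm (Γ : Subgroup G) (μ : Measure G) (f : G → ℝ) : Prop :=
  ∀ D : Set G, IsFundamentalDomain Γ D μ → ∫⁻ g in D, ‖f g‖ₑ ^ 2 ∂μ = 1

variable {Γ : Subgroup G}

/-- The function `φ` on `G` is a representative of the class `f ∈ L²(Γ\G)`, pulled back to `G`. -/
def Represents (μ : Measure G) {μX : Measure (LeftQuotient Γ)} (φ : G → ℂ) (f : Lp ℂ 2 μX) : Prop :=
  ∀ᵐ g ∂μ, f (proj Γ g) = φ g

/-- A closed subspace of `L²(Γ\G)` invariant under right translations `f ↦ f(· h)`, `h ∈ G`. -/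
structure IsSubrepresentation (μ : Measure G) {μX : Measure (LeftQuotient Γ)}
    (V : Submodule ℂ (Lp ℂ 2 μX)) : Prop where
  isClosed : IsClosed (V : Set (Lp ℂ 2 μX))
  translate_mem : ∀ f ∈ V, ∀ (h : G) (f' : Lp ℂ 2 μX),
    (∀ᵐ g ∂μ, f' (proj Γ g) = f (proj Γ (g * h))) → f' ∈ V

/-- The base representation: an irreducible infinite dimensional subrepresentation of `L²(Γ\G)` on
which the Casimir operator acts (on smooth functions) by the scalar `δ (1 - δ)`. -/
structure IsBaseRepresentation (μ : Measure G) {μX : Measure (LeftQuotient Γ)} (δ : ℝ)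
    (V : Submodule ℂ (Lp ℂ 2 μX)) : Prop where
  isSubrepresentation : IsSubrepresentation μ V
  infinite_dimensional : ¬ FiniteDimensional ℂ V
  irreducible : ∀ W : Submodule ℂ (Lp ℂ 2 μX),
    IsSubrepresentation μ W → W ≤ V → W = ⊥ ∨ W = V
  casimir_eq : ∀ f ∈ V, ∀ φ : G → ℂ, IsSmooth φ → Represents μ φ f →
    ∀ x y θ : ℝ, 0 < y → casimir φ x y θ = (δ * (1 - δ) : ℝ) * φ (iwasawa x y θ)

/-- `φ` is a smooth vector of `V ⊆ L²(Γ\G)` (as a left `Γ`-invariant function on `G`) of norm one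
with `φ(g k_θ) = e^{2miθ} φ(g)`. -/
structure IsUnitKTypeVector (μ : Measure G) {μX : Measure (LeftQuotient Γ)}
    (V : Submodule ℂ (Lp ℂ 2 μX)) (m : ℤ) (φ : G → ℂ) : Prop where
  left_invariant : ∀ γ ∈ Γ, ∀ g : G, φ (γ * g) = φ g
  smooth : IsSmooth φ
  ktype : ∀ (g : G) (θ : ℝ), φ (g * kElt θ) = Complex.exp (2 * m * Complex.I * θ) * φ g
  mem : ∃ f ∈ V, ‖f‖ = 1 ∧ Represents μ φ f

/-! ### The explicit formula -/

/-- The factor `√(Γ(δ+ℓ) Γ(1-δ)) / √(Γ(δ) Γ(1-δ+ℓ))`. -/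
def gammaFactor (δ : ℝ) (ℓ : ℕ) : ℝ :=
  √(Real.Gamma (δ + ℓ) * Real.Gamma (1 - δ)) / √(Real.Gamma δ * Real.Gamma (1 - δ + ℓ))

/-- For the sign `ε = ±1`, the function
`e^{±2ℓiθ} · gammaFactor δ ℓ ·
  ∫_ℝ ((u²+1)y / ((x-u)²+y²))^δ (((x-u) ∓ iy) / ((x-u) ± iy))^ℓ dν(u)`. -/
def explicitVector (δ : ℝ) (ν : Measure (OnePoint ℂ)) (ε : ℤˣ) (ℓ : ℕ) (x y θ : ℝ) : ℂ :=
  Complex.exp ((ε : ℤ) * 2 * ℓ * Complex.I * θ) * (gammaFactor δ ℓ : ℂ) *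
    ∫ u : ℝ, (((((u ^ 2 + 1) * y / ((x - u) ^ 2 + y ^ 2)) ^ δ : ℝ)) : ℂ) *
      ((((x : ℂ) - u) - (ε : ℤ) * Complex.I * y) / (((x : ℂ) - u) + (ε : ℤ) * Complex.I * y)) ^ ℓ
      ∂(onReal ν)

end BaseRep

end

noncomputable section

namespace BaseRep

/-! ### The topology of `PSL₂(ℝ)` -/

/-! The formula is governed by one kernel. For a matrix $A$ with rows $(a,b)$, $(c,d)$ put
$q=(b-ud)+i(a-uc)$, and let $v_m$ be the integral over the boundary measure of
$((u^2+1)/|q|^2)^\delta(\bar q/q)^m$; this is `weightVec`. Right rotation multiplies $q$ by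
$e^{-i\theta}$, so $v_m$ has weight $m$. The diagonal flow $g\mapsto g a_{e^t}$ gives $q'=-\bar
q/2$, whence $v_m'=\tfrac{\delta+m}2v_{m+1}+\tfrac{\delta-m}2v_{m-1}$ (`hasFlowDeriv_weightVec`).
All $v_m$ are dominated by the positive function $v_0$, which is the base eigenfunction.

Invariance: since $v_0$ has norm one over every fundamental domain, replacing a piece of a domain by
a $\Gamma$-translate changes nothing, and so $v_0$ is $\Gamma$-invariant
(`isLeftInvariant_of_hasUnitNorm`). Splitting flow derivatives into weights passes invariance on to
every $v_m$.

Norms: the integral over $\Gamma\backslash G$ of a flow derivative vanishes. Applied to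
$v_m\overline{v_{m+1}}$ this gives $(\delta+m)\|v_{m+1}\|^2=(m+1-\delta)\|v_m\|^2$
(`weightVec_norm_recursion`), which the Gamma factors solve.

Multiplicity one: smoothing any $f\in V$ by test functions gives smooth vectors of $V$ (Gårding
vectors), on which the Casimir operator acts by the known scalar. In weight zero such a vector is
compared with the positive ground state $v_0$: integration by parts shows that the quotient by $v_0$
is constant along the diagonal flow, hence constant by the Cartan decomposition
(`eq_const_mul_baseVec`). Raising and lowering are inverse to each other up to nonzero scalars,
which carries the result to all weights (`IsGardingVector.eq_const_mul`). Some Gårding vector of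
pure weight is nonzero, so the whole ladder $v_m$ lies in $V$ (`exists_isGardingVector_weightVec`).
An arbitrary smooth vector of weight $m$ in $V$ is a limit of Gårding vectors of weight $m$, hence
also a multiple of $v_m$ (`eq_const_mul_weightVec`). -/

lemma toG_mul (A B : SL(2, ℝ)) : toG (A * B) = toG A * toG B := rfl

lemma toG_one : toG 1 = 1 := rfl

lemma toG_surjective : Function.Surjective toG := Quotient.mk_surjective

lemma continuous_toG : Continuous toG := continuous_quotient_mk'

lemma isOpenMap_toG : IsOpenMap toG := QuotientGroup.isOpenMap_coe

lemma isOpenQuotientMap_toG : IsOpenQuotientMap toG :=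
  ⟨toG_surjective, continuous_toG, isOpenMap_toG⟩

lemma toG_eq_iff {A B : SL(2, ℝ)} : toG A = toG B ↔ A = B ∨ A = -B := by
  unfold toG
  rw [QuotientGroup.eq, Matrix.SpecialLinearGroup.mem_center_iff]
  constructor
  · rintro ⟨r, hr, h⟩
    have hr2 : r = 1 ∨ r = -1 := by
      have h2 : (r - 1) * (r + 1) = 0 := by
        have : r ^ 2 = 1 := by simpa using hr
        linear_combination this
      rcases mul_eq_zero.1 h2 with h | h
      · exact Or.inl (by linarith)
      · exact Or.inr (by linarith)
    rcases hr2 with rfl | rfl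
    · left
      have : A⁻¹ * B = 1 := by ext i j; rw [← h]; simp
      rw [inv_mul_eq_one] at this; exact this
    · right
      have : A⁻¹ * B = -1 := by
        ext i j; rw [← h]; fin_cases i <;> fin_cases j <;> simp [Matrix.scalar]
      have h2 : B = -A := by rw [inv_mul_eq_iff_eq_mul] at this; rw [this]; simp
      rw [h2]; simp
  · rintro (rfl | rfl)
    · exact ⟨1, by simp, by simp⟩
    · refine ⟨-1, by simp, ?_⟩
      rw [show (-B)⁻¹ * B = -1 by
        rw [inv_mul_eq_iff_eq_mul]; simp]
      ext i j; fin_cases i <;> fin_cases j <;> simp [Matrix.scalar]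

instance : SecondCountableTopology SL(2, ℝ) := by
  have : SecondCountableTopology (Matrix (Fin 2) (Fin 2) ℝ) :=
    inferInstanceAs (SecondCountableTopology (Fin 2 → Fin 2 → ℝ))
  exact Topology.IsInducing.subtypeVal.secondCountableTopology

lemma isClosedEmbedding_val :
    IsClosedEmbedding (Subtype.val : SL(2, ℝ) → Matrix (Fin 2) (Fin 2) ℝ) :=
  IsClosed.isClosedEmbedding_subtypeVal
    (isClosed_eq (by fun_prop) continuous_const)

instance : LocallyCompactSpace SL(2, ℝ) := by
  have : LocallyCompactSpace (Matrix (Fin 2) (Fin 2) ℝ) :=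
    inferInstanceAs (LocallyCompactSpace (Fin 2 → Fin 2 → ℝ))
  exact isClosedEmbedding_val.locallyCompactSpace

instance : PolishSpace SL(2, ℝ) := by
  have : PolishSpace (Matrix (Fin 2) (Fin 2) ℝ) :=
    inferInstanceAs (PolishSpace (Fin 2 → Fin 2 → ℝ))
  exact isClosedEmbedding_val.polishSpace

instance : IsClosed (Subgroup.center SL(2, ℝ) : Set SL(2, ℝ)) := by
  have : (Subgroup.center SL(2, ℝ) : Set SL(2, ℝ)) = {1, -1} := by
    ext A
    have := @toG_eq_iff 1 A
    unfold toG at this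
    rw [QuotientGroup.eq] at this
    simp only [inv_one, one_mul] at this
    rw [SetLike.mem_coe, this]
    simp only [Set.mem_insert_iff, Set.mem_singleton_iff, eq_comm (a := (1 : SL(2, ℝ))),
      neg_eq_iff_eq_neg]
  rw [this]
  exact (Set.toFinite _).isClosed

instance : T2Space G := inferInstance

instance : SecondCountableTopology G := inferInstance

instance : LocallyCompactSpace G := inferInstance

/-! ### Iwasawa and Cartan decompositions -/

lemma SL_ext {A B : SL(2, ℝ)} (h00 : A 0 0 = B 0 0) (h01 : A 0 1 = B 0 1) (h10 : A 1 0 = B 1 0)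
    (h11 : A 1 1 = B 1 1) : A = B := by
  ext i j
  fin_cases i <;> fin_cases j <;> assumption

lemma SL_mul_apply (A B : SL(2, ℝ)) (i j : Fin 2) :
    (A * B) i j = A i 0 * B 0 j + A i 1 * B 1 j := by
  rw [Matrix.SpecialLinearGroup.coe_mul, Matrix.mul_apply, Fin.sum_univ_two]

lemma SL_one_apply (i j : Fin 2) : (1 : SL(2, ℝ)) i j = if i = j then 1 else 0 := by
  rw [Matrix.SpecialLinearGroup.coe_one, Matrix.one_apply]

lemma SL_neg_apply (A : SL(2, ℝ)) (i j : Fin 2) : (-A) i j = -A i j := by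
  rw [Matrix.SpecialLinearGroup.coe_neg, Matrix.neg_apply]

@[simp] lemma kMat_00 (θ : ℝ) : kMat θ 0 0 = Real.cos θ := rfl
@[simp] lemma kMat_01 (θ : ℝ) : kMat θ 0 1 = Real.sin θ := rfl
@[simp] lemma kMat_10 (θ : ℝ) : kMat θ 1 0 = -Real.sin θ := rfl
@[simp] lemma kMat_11 (θ : ℝ) : kMat θ 1 1 = Real.cos θ := rfl
@[simp] lemma nMat_00 (x : ℝ) : nMat x 0 0 = 1 := rfl
@[simp] lemma nMat_01 (x : ℝ) : nMat x 0 1 = x := rfl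
@[simp] lemma nMat_10 (x : ℝ) : nMat x 1 0 = 0 := rfl
@[simp] lemma nMat_11 (x : ℝ) : nMat x 1 1 = 1 := rfl
@[simp] lemma aMat_00 (y : ℝ) (hy : 0 < y) : aMat y hy 0 0 = √y := rfl
@[simp] lemma aMat_01 (y : ℝ) (hy : 0 < y) : aMat y hy 0 1 = 0 := rfl
@[simp] lemma aMat_10 (y : ℝ) (hy : 0 < y) : aMat y hy 1 0 = 0 := rfl
@[simp] lemma aMat_11 (y : ℝ) (hy : 0 < y) : aMat y hy 1 1 = (√y)⁻¹ := rfl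

lemma kMat_add (s t : ℝ) : kMat (s + t) = kMat s * kMat t := by
  apply SL_ext <;> simp only [SL_mul_apply, kMat_00, kMat_01, kMat_10, kMat_11, Real.cos_add,
    Real.sin_add] <;> ring

lemma kElt_add (s t : ℝ) : kElt (s + t) = kElt s * kElt t := by
  simp only [kElt, kMat_add, toG_mul]

lemma kMat_zero : kMat 0 = 1 := by
  apply SL_ext <;> simp [SL_one_apply]

lemma kElt_zero : kElt 0 = 1 := by
  rw [kElt, kMat_zero, toG_one]

lemma kElt_pi : kElt Real.pi = 1 := by
  rw [← toG_one, kElt, toG_eq_iff]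
  right
  apply SL_ext <;> simp [SL_one_apply, SL_neg_apply]

lemma kElt_neg (s : ℝ) : kElt (-s) = (kElt s)⁻¹ := by
  rw [eq_inv_iff_mul_eq_one, ← kElt_add, neg_add_cancel, kElt_zero]

/-- The one-parameter subgroup `t ↦ a_{e^t}`, as matrices. -/
def expMat (t : ℝ) : SL(2, ℝ) :=
  ⟨!![Real.exp (t / 2), 0; 0, Real.exp (-(t / 2))], by
    rw [Matrix.det_fin_two_of, ← Real.exp_add]; simp⟩

/-- The one-parameter subgroup `t ↦ a_{e^t}`. -/
def expElt (t : ℝ) : G := toG (expMat t)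

@[simp] lemma expMat_00 (t : ℝ) : expMat t 0 0 = Real.exp (t / 2) := rfl
@[simp] lemma expMat_01 (t : ℝ) : expMat t 0 1 = 0 := rfl
@[simp] lemma expMat_10 (t : ℝ) : expMat t 1 0 = 0 := rfl
@[simp] lemma expMat_11 (t : ℝ) : expMat t 1 1 = Real.exp (-(t / 2)) := rfl

lemma aElt_of_pos {y : ℝ} (hy : 0 < y) : aElt y = toG (aMat y hy) := dif_pos hy

lemma aElt_exp (t : ℝ) : aElt (Real.exp t) = expElt t := by
  rw [aElt_of_pos (Real.exp_pos t), expElt]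
  congr 1
  apply SL_ext <;> simp [Real.exp_half, Real.exp_neg]

lemma aElt_eq_expElt {y : ℝ} (hy : 0 < y) : aElt y = expElt (Real.log y) := by
  rw [← aElt_exp, Real.exp_log hy]

lemma expElt_add (s t : ℝ) : expElt (s + t) = expElt s * expElt t := by
  rw [expElt, expElt, expElt, ← toG_mul]
  congr 1
  apply SL_ext <;> simp [SL_mul_apply, ← Real.exp_add] <;> ring

lemma expElt_zero : expElt 0 = 1 := by
  rw [← toG_one, expElt]
  congr 1
  apply SL_ext <;> simp [SL_one_apply]

lemma continuous_SL_iff {X : Type*} [TopologicalSpace X] {f : X → SL(2, ℝ)} :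
    Continuous f ↔ ∀ i j, Continuous fun x => f x i j := by
  constructor
  · intro h i j
    exact (continuous_apply_apply i j).comp (isClosedEmbedding_val.continuous.comp h)
  · intro h
    exact isClosedEmbedding_val.isInducing.continuous_iff.2 (continuous_matrix h)

lemma continuous_kElt : Continuous kElt := by
  refine continuous_toG.comp (continuous_SL_iff.2 fun i j => ?_)
  fin_cases i <;> fin_cases j <;> simp <;> fun_prop

lemma continuous_expElt : Continuous expElt := by
  refine continuous_toG.comp (continuous_SL_iff.2 fun i j => ?_)
  fin_cases i <;> fin_cases j <;> simp <;> fun_prop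

lemma det_eq_one (A : SL(2, ℝ)) : A 0 0 * A 1 1 - A 0 1 * A 1 0 = 1 := by
  have := A.det_coe
  rwa [Matrix.det_fin_two] at this

lemma bottom_row_pos (A : SL(2, ℝ)) : 0 < A 1 0 ^ 2 + A 1 1 ^ 2 := by
  have h := det_eq_one A
  by_contra hc
  have h0 : A 1 0 = 0 := by nlinarith [sq_nonneg (A 1 0), sq_nonneg (A 1 1)]
  have h1 : A 1 1 = 0 := by nlinarith [sq_nonneg (A 1 0), sq_nonneg (A 1 1)]
  rw [h0, h1] at h
  norm_num at h

lemma exists_cos_sin {p q : ℝ} (h : p ^ 2 + q ^ 2 = 1) :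
    ∃ θ : ℝ, Real.cos θ = p ∧ Real.sin θ = q := by
  have hn : ‖(⟨p, q⟩ : ℂ)‖ = 1 := by
    rw [Complex.norm_def, Complex.normSq_mk, Real.sqrt_eq_one]; linarith
  have hz : (⟨p, q⟩ : ℂ) ≠ 0 := by
    rw [← norm_ne_zero_iff, hn]; exact one_ne_zero
  exact ⟨Complex.arg ⟨p, q⟩, by rw [Complex.cos_arg hz, hn, div_one],
    by rw [Complex.sin_arg, hn, div_one]⟩

lemma iwasawa_eq {y : ℝ} (hy : 0 < y) (x θ : ℝ) :
    iwasawa x y θ = toG (nMat x * aMat y hy * kMat θ) := by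
  rw [iwasawa, aElt_of_pos hy]; rfl

/-- The translation and dilation parameters are the real and imaginary parts of $A\cdot i$; the
angle is read off the bottom row, which equals $y^{-1/2}(-\sin\theta,\cos\theta)$. -/
lemma exists_eq_iwasawa_mat (A : SL(2, ℝ)) :
    ∃ θ, A = nMat ((A 0 0 * A 1 0 + A 0 1 * A 1 1) / (A 1 0 ^ 2 + A 1 1 ^ 2)) *
      aMat (1 / (A 1 0 ^ 2 + A 1 1 ^ 2)) (one_div_pos.2 (bottom_row_pos A)) * kMat θ := by
  have hd := det_eq_one A
  obtain ⟨r, hrdef⟩ : ∃ r, r = A 1 0 ^ 2 + A 1 1 ^ 2 := ⟨_, rfl⟩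
  have hr : 0 < r := by rw [hrdef]; exact bottom_row_pos A
  have hs : (√r) ^ 2 = r := Real.sq_sqrt hr.le
  have hs0 : 0 < √r := Real.sqrt_pos.2 hr
  obtain ⟨θ, hc, hsn⟩ := exists_cos_sin (p := A 1 1 / √r) (q := -(A 1 0) / √r) (by
    rw [div_pow, div_pow, hs]; field_simp; rw [hrdef]; ring)
  refine ⟨θ, ?_⟩
  have hs1 := hs0.ne'
  have e1 : √(1 / r) = 1 / √r := by rw [Real.sqrt_div zero_le_one, Real.sqrt_one]
  have hr0 := hr.ne'
  -- The determinant relation expresses the top row through the bottom row and the inner product of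
  -- the two rows.
  have ha : A 0 0 = (A 1 1 + (A 0 0 * A 1 0 + A 0 1 * A 1 1) * A 1 0) / r := by
    rw [eq_div_iff hr0, hrdef]; linear_combination A 1 1 * hd
  have hb : A 0 1 = (-A 1 0 + (A 0 0 * A 1 0 + A 0 1 * A 1 1) * A 1 1) / r := by
    rw [eq_div_iff hr0, hrdef]; linear_combination (-A 1 0) * hd
  apply SL_ext <;> simp only [SL_mul_apply, kMat_00, kMat_01, kMat_10, kMat_11, nMat_00, nMat_01,
    nMat_10, nMat_11, aMat_00, aMat_01, aMat_10, aMat_11, hc, hsn, e1, ← hrdef]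
  · refine ha.trans ?_
    generalize √r = s at *
    subst hs
    field_simp
    ring
  · refine hb.trans ?_
    generalize √r = s at *
    subst hs
    field_simp
    ring
  · field_simp; ring
  · field_simp; ring

lemma exists_eq_iwasawa (g : G) : ∃ x y θ, 0 < y ∧ g = iwasawa x y θ := by
  obtain ⟨A, rfl⟩ := toG_surjective g
  obtain ⟨θ, h⟩ := exists_eq_iwasawa_mat A
  refine ⟨(A 0 0 * A 1 0 + A 0 1 * A 1 1) / (A 1 0 ^ 2 + A 1 1 ^ 2), 1 / (A 1 0 ^ 2 + A 1 1 ^ 2), θ,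
    one_div_pos.2 (bottom_row_pos A), ?_⟩
  rw [iwasawa_eq (one_div_pos.2 (bottom_row_pos A)), ← h]

/-- Rotating on the left, the inner product of the two rows changes sign after a quarter turn, so it
vanishes for some angle by the intermediate value theorem. The Iwasawa decomposition of the rotated
matrix then has no unipotent part. -/
lemma exists_cartan (g : G) : ∃ θ t θ' : ℝ, g = kElt θ * expElt t * kElt θ' := by
  obtain ⟨A, rfl⟩ := toG_surjective g
  let f : ℝ → ℝ := fun θ => (kMat θ * A) 0 0 * (kMat θ * A) 1 0 + (kMat θ * A) 0 1 * (kMat θ * A) 1 1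
  have hf : f = fun θ => (Real.cos θ * A 0 0 + Real.sin θ * A 1 0) *
      (-Real.sin θ * A 0 0 + Real.cos θ * A 1 0) + (Real.cos θ * A 0 1 + Real.sin θ * A 1 1) *
      (-Real.sin θ * A 0 1 + Real.cos θ * A 1 1) := by
    funext θ
    simp [f, SL_mul_apply]
  have hfc : Continuous f := by rw [hf]; fun_prop
  have h0 : f (Real.pi / 2) = -f 0 := by rw [hf]; simp; ring
  obtain ⟨θ, -, hθ⟩ : ∃ θ ∈ Set.uIcc 0 (Real.pi / 2), f θ = 0 := by
    have := intermediate_value_uIcc (a := 0) (b := Real.pi / 2) hfc.continuousOn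
    apply this
    rw [h0, Set.mem_uIcc]
    rcases le_total (f 0) 0 with h | h
    · left; constructor <;> linarith
    · right; constructor <;> linarith
  obtain ⟨θ', h⟩ := exists_eq_iwasawa_mat (kMat θ * A)
  have hn : nMat 0 = 1 := by
    apply SL_ext <;> simp [SL_one_apply]
  have hθ2 : (kMat θ * A) 0 0 * (kMat θ * A) 1 0 + (kMat θ * A) 0 1 * (kMat θ * A) 1 1 = 0 := hθ
  rw [hθ2, zero_div, hn, one_mul] at h
  refine ⟨-θ, Real.log (1 / ((kMat θ * A) 1 0 ^ 2 + (kMat θ * A) 1 1 ^ 2)), θ', ?_⟩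
  rw [← aElt_eq_expElt (one_div_pos.2 (bottom_row_pos (kMat θ * A))),
    aElt_of_pos (one_div_pos.2 (bottom_row_pos (kMat θ * A))), mul_assoc]
  have := congrArg toG h
  rw [toG_mul, toG_mul] at this
  rw [kElt_neg, eq_inv_mul_iff_mul_eq]
  exact this

/-- A function that is invariant under right multiplication by the diagonal group and the rotation
group is constant. -/
lemma eq_const_of_right_invariant {E : Type*} {F : G → E} (hk : ∀ g θ, F (g * kElt θ) = F g)
    (ha : ∀ g t, F (g * expElt t) = F g) (g : G) : F g = F 1 := by
  obtain ⟨θ, t, θ', rfl⟩ := exists_cartan g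
  rw [hk, ha, ← one_mul (kElt θ), hk]

/-! ### Unimodularity -/

/-- The modular character takes values in a commutative monoid, so it kills commutators, and
$\mathrm{PSL}_2(\mathbb R)$ is perfect. -/
lemma modularCharacterFun_eq_one (g : G) : Measure.modularCharacterFun g = 1 := by
  have hle : commutator G ≤ (Measure.modularCharacter (G := G)).ker := by
    rw [commutator_def, Subgroup.commutator_le]
    intro a _ b _
    rw [MonoidHom.mem_ker, commutatorElement_def, map_mul, map_mul, map_mul]
    rw [mul_right_comm (Measure.modularCharacter a), ← map_mul, mul_inv_cancel, map_one, one_mul,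
      ← map_mul, mul_inv_cancel, map_one]
  rw [SL2Simple.PSL_commutator_eq_top ⟨2, by norm_num, by norm_num⟩] at hle
  exact hle (Subgroup.mem_top g)

instance (μ : Measure G) [μ.IsHaarMeasure] : μ.IsMulRightInvariant where
  map_mul_right_eq_self g := by
    rw [Measure.map_right_mul_eq_modularCharacterFun_smul, modularCharacterFun_eq_one, one_smul]

/-! ### The quotient `Γ\G` -/

section Quotient

variable (Γ : Subgroup G)

lemma proj_surjective : Function.Surjective (proj Γ) := Quotient.mk_surjective

lemma continuous_proj : Continuous (proj Γ) := continuous_quotient_mk'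

lemma measurable_proj : Measurable (proj Γ) := measurable_quotient_mk' (s := MulAction.orbitRel Γ G)

lemma isOpenQuotientMap_proj : IsOpenQuotientMap (proj Γ) :=
  MulAction.isOpenQuotientMap_quotientMk

variable {Γ}

lemma proj_eq_iff {g h : G} : proj Γ g = proj Γ h ↔ ∃ γ ∈ Γ, γ * h = g := by
  unfold proj
  rw [Quotient.eq, MulAction.orbitRel_apply, MulAction.mem_orbit_iff]
  constructor
  · rintro ⟨γ, h⟩; exact ⟨γ, γ.2, h⟩
  · rintro ⟨γ, hγ, h⟩; exact ⟨⟨γ, hγ⟩, h⟩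

lemma proj_mul {γ : G} (hγ : γ ∈ Γ) (g : G) : proj Γ (γ * g) = proj Γ g :=
  proj_eq_iff.2 ⟨γ, hγ, rfl⟩

variable (Γ) in
/-- Right translation by `h` on `Γ\G`. -/
def rightMul (h : G) : LeftQuotient Γ → LeftQuotient Γ :=
  Quotient.map' (· * h) (by
    rintro a b hab
    obtain ⟨γ, hγ, e⟩ := proj_eq_iff.1 (Quotient.sound' hab : proj Γ a = proj Γ b)
    exact Quotient.exact' (proj_eq_iff.2 ⟨γ, hγ, by rw [← e, mul_assoc]⟩ :
      proj Γ (a * h) = proj Γ (b * h)))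

lemma rightMul_proj (h g : G) : rightMul Γ h (proj Γ g) = proj Γ (g * h) := rfl

lemma continuous_rightMul_uncurry :
    Continuous fun p : LeftQuotient Γ × G => rightMul Γ p.2 p.1 := by
  have hq := (isOpenQuotientMap_proj Γ).prodMap (IsOpenQuotientMap.id (X := G))
  rw [hq.isQuotientMap.continuous_iff]
  exact (continuous_proj Γ).comp (continuous_fst.mul continuous_snd)

lemma continuous_rightMul (h : G) : Continuous (rightMul Γ h) :=
  continuous_rightMul_uncurry.comp (Continuous.prodMk_left h)

lemma measurePreserving_proj (μ : Measure G) (μX : Measure (LeftQuotient Γ))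
    [QuotientMeasureEqMeasurePreimage μ μX] {D : Set G} (hD : IsFundamentalDomain Γ D μ) :
    MeasurePreserving (proj Γ) (μ.restrict D) μX := hD.measurePreserving_quotient_mk μX

lemma isFundamentalDomain_of_strict (μ : Measure G) {D : Set G} (hD : MeasurableSet D)
    [Countable Γ] (h : ∀ x : G, ∃! γ : Γ, γ • x ∈ D) : IsFundamentalDomain Γ D μ :=
  IsFundamentalDomain.mk' hD.nullMeasurableSet h

variable [DiscreteTopology Γ]

instance : Countable Γ := countable_of_Lindelof_of_discrete

instance : SecondCountableTopology (LeftQuotient Γ) :=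
  (isOpenQuotientMap_proj Γ).isQuotientMap.secondCountableTopology (isOpenQuotientMap_proj Γ).isOpenMap

instance : ProperlyDiscontinuousSMul Γ G :=
  Subgroup.properlyDiscontinuousSMul_of_tendsto_cofinite Γ
    (Subgroup.tendsto_coe_cofinite_of_discrete Γ ⟨inferInstance⟩)

instance : T2Space (LeftQuotient Γ) := t2Space_of_properlyDiscontinuousSMul_of_t2Space

instance : LocallyCompactSpace (LeftQuotient Γ) :=
  (isOpenQuotientMap_proj Γ).locallyCompactSpace

/-- A continuous surjection from a Polish space onto a second countable Hausdorff space pushes the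
Borel σ-algebra to the Borel σ-algebra. It is used for $\mathrm{SL}_2(\mathbb R)\to G$ and for
$\mathrm{SL}_2(\mathbb R)\to\Gamma\backslash G$. -/
instance : BorelSpace (LeftQuotient Γ) := by
  constructor
  have h1 : MeasurableSpace.map toG (borel SL(2, ℝ)) = borel G :=
    continuous_toG.map_borel_eq toG_surjective
  have h2 : MeasurableSpace.map (proj Γ ∘ toG) (borel SL(2, ℝ)) = borel (LeftQuotient Γ) :=
    ((continuous_proj Γ).comp continuous_toG).map_borel_eq
      ((proj_surjective Γ).comp toG_surjective)
  rw [← MeasurableSpace.map_comp, h1] at h2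
  rw [← h2]
  rfl

lemma measurable_rightMul (h : G) : Measurable (rightMul Γ h) := (continuous_rightMul h).measurable

/-! ### Fundamental domains -/

variable (Γ) in
/-- The translates of `U` by the elements of `Γ` are pairwise disjoint. -/
def IsWandering (U : Set G) : Prop := ∀ γ : Γ, ∀ x ∈ U, γ • x ∈ U → γ = 1

/-- By discreteness some neighbourhood $W$ of the identity meets $\Gamma$ only in $1$; it suffices
that $UU^{-1}\subseteq W$. -/
lemma exists_isWandering (g : G) : ∃ U : Set G, IsOpen U ∧ g ∈ U ∧ IsWandering Γ U := by
  obtain ⟨W, hW, hWΓ⟩ : ∃ W ∈ 𝓝 (1 : G), ∀ γ : Γ, (γ : G) ∈ W → γ = 1 := by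
    have : ({1} : Set Γ) ∈ 𝓝 (1 : Γ) := by simp
    rw [nhds_subtype, mem_comap] at this
    obtain ⟨W, hW, h⟩ := this
    exact ⟨W, hW, fun γ hγ => h hγ⟩
  have hc : Tendsto (fun p : G × G => p.1 * p.2⁻¹) (𝓝 g ×ˢ 𝓝 g) (𝓝 1) := by
    have : Continuous fun p : G × G => p.1 * p.2⁻¹ := by fun_prop
    have := this.tendsto (g, g)
    rwa [nhds_prod_eq, mul_inv_cancel] at this
  obtain ⟨V, hV, h⟩ := mem_prod_same_iff.1 (hc hW)
  obtain ⟨U, hUV, hU, hg⟩ := mem_nhds_iff.1 hV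
  refine ⟨U, hU, hg, fun γ x hx hγx => hWΓ γ ?_⟩
  have : ((γ : G) * x, x) ∈ V ×ˢ V := ⟨hUV hγx, hUV hx⟩
  simpa using h this

/-- A wandering open set is contained in a Borel set that meets every orbit exactly once. -/
lemma exists_strict_fundamentalDomain {U : Set G} (hU : IsOpen U) (hw : IsWandering Γ U) :
    ∃ D : Set G, MeasurableSet D ∧ U ⊆ D ∧ ∀ x : G, ∃! γ : Γ, γ • x ∈ D := by
  choose V hVo hVm hVw using exists_isWandering (Γ := Γ)
  obtain ⟨S, hS, hcov⟩ := TopologicalSpace.countable_cover_nhds fun g => (hVo g).mem_nhds (hVm g)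
  have hSne : S.Nonempty := by
    by_contra h
    rw [Set.not_nonempty_iff_eq_empty] at h
    simp only [h, Set.mem_empty_iff_false, Set.iUnion_of_empty, Set.iUnion_empty] at hcov
    exact Set.empty_ne_univ hcov
  obtain ⟨f, rfl⟩ := hS.exists_eq_range hSne
  -- The given set is put first, so that making the saturations disjoint removes nothing from it.
  let u : ℕ → Set G := fun n => Nat.casesOn n U fun k => V (f k)
  have huo : ∀ n, IsOpen (u n) := by rintro (_ | n); exacts [hU, hVo _]
  have huw : ∀ n, IsWandering Γ (u n) := by rintro (_ | n); exacts [hw, hVw _]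
  let s : ℕ → Set G := fun n => ⋃ γ : Γ, (fun x => γ • x) ⁻¹' u n
  have hso : ∀ n, IsOpen (s n) := fun n =>
    isOpen_iUnion fun γ => (huo n).preimage (continuous_const_smul γ)
  have hsinv : ∀ n (γ : Γ) x, γ • x ∈ s n ↔ x ∈ s n := by
    intro n γ x
    simp only [s, Set.mem_iUnion, Set.mem_preimage]
    constructor
    · rintro ⟨η, h⟩; exact ⟨η * γ, by rwa [mul_smul]⟩
    · rintro ⟨η, h⟩; exact ⟨η * γ⁻¹, by rwa [mul_smul, inv_smul_smul]⟩
  have hus : ∀ n, u n ⊆ s n := fun n x hx => Set.mem_iUnion.2 ⟨1, by simpa using hx⟩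
  have hdinv : ∀ n (γ : Γ) x, γ • x ∈ disjointed s n ↔ x ∈ disjointed s n := by
    intro n γ x
    simp only [disjointed_eq_inter_compl, Set.mem_inter_iff, Set.mem_iInter, Set.mem_compl_iff,
      hsinv]
  have hsU : ⋃ n, disjointed s n = Set.univ := by
    rw [iUnion_disjointed, Set.eq_univ_iff_forall]
    intro x
    have : x ∈ ⋃ x ∈ Set.range f, V x := by rw [hcov]; trivial
    simp only [Set.mem_iUnion, Set.mem_range] at this
    obtain ⟨_, ⟨n, rfl⟩, h⟩ := this
    exact Set.mem_iUnion.2 ⟨n + 1, hus (n + 1) h⟩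
  refine ⟨⋃ n, u n ∩ disjointed s n, MeasurableSet.iUnion fun n =>
    (huo n).measurableSet.inter (MeasurableSet.disjointed (fun n => (hso n).measurableSet) n),
    fun x hx => ?_, fun x => ?_⟩
  · refine Set.mem_iUnion.2 ⟨0, hx, ?_⟩
    rw [disjointed_zero]
    exact hus 0 hx
  · obtain ⟨n, hn⟩ : ∃ n, x ∈ disjointed s n := by
      rw [← Set.mem_iUnion, hsU]; trivial
    obtain ⟨γ, hγ⟩ := Set.mem_iUnion.1 (disjointed_subset s n hn)
    refine ⟨γ, Set.mem_iUnion.2 ⟨n, hγ, (hdinv n γ x).2 hn⟩, fun η hη => ?_⟩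
    obtain ⟨m, hm, hm2⟩ := Set.mem_iUnion.1 hη
    have hmn : m = n := by
      by_contra hne
      exact Set.disjoint_left.1 (disjoint_disjointed s hne) ((hdinv m η x).1 hm2) hn
    subst hmn
    have := huw m (η * γ⁻¹) (γ • x) hγ (by rwa [mul_smul, inv_smul_smul])
    rwa [mul_inv_eq_one] at this

variable (μ : Measure G) [μ.IsHaarMeasure]

variable (Γ) in
lemma exists_fundamentalDomain : ∃ D : Set G, MeasurableSet D ∧ ∀ x : G, ∃! γ : Γ, γ • x ∈ D := by
  obtain ⟨U, hU, -, hw⟩ := exists_isWandering (Γ := Γ) 1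
  obtain ⟨D, hD, -, h⟩ := exists_strict_fundamentalDomain hU hw
  exact ⟨D, hD, h⟩

variable (μX : Measure (LeftQuotient Γ)) [QuotientMeasureEqMeasurePreimage μ μX]

lemma sigmaFinite_quotient (μ : Measure G) [μ.IsHaarMeasure] (μX : Measure (LeftQuotient Γ))
    [QuotientMeasureEqMeasurePreimage μ μX] : SigmaFinite μX := by
  obtain ⟨D, hD, h⟩ := exists_fundamentalDomain Γ
  have : HasFundamentalDomain Γ G μ := ⟨D, isFundamentalDomain_of_strict μ hD h⟩
  exact QuotientMeasureEqMeasurePreimage.sigmaFiniteQuotient (ν := μ) μX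

/-- The preimage of a null set is $\Gamma$-invariant and meets a fundamental domain in a null set,
so it is null. -/
lemma quasiMeasurePreserving_proj : Measure.QuasiMeasurePreserving (proj Γ) μ μX := by
  refine ⟨measurable_proj Γ, ?_⟩
  refine Measure.AbsolutelyContinuous.mk fun s hs h0 => ?_
  rw [Measure.map_apply (measurable_proj Γ) hs]
  obtain ⟨D, hD, h⟩ := exists_fundamentalDomain Γ
  have hDf := isFundamentalDomain_of_strict μ hD h
  refine hDf.measure_zero_of_invariant _ (fun γ => ?_) ?_
  · ext x
    rw [Set.mem_smul_set_iff_inv_smul_mem]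
    have : proj Γ (γ⁻¹ • x) = proj Γ x := proj_mul (γ⁻¹).2 x
    simp only [Set.mem_preimage, this]
  · rw [← (measurePreserving_proj μ μX hDf).measure_preimage hs.nullMeasurableSet,
      Measure.restrict_apply (measurable_proj Γ hs)] at h0
    exact h0

/-- A right translate of a fundamental domain is again one, and $\mu$ is right invariant by
unimodularity. -/
lemma measurePreserving_rightMul (μ : Measure G) [μ.IsHaarMeasure] (μX : Measure (LeftQuotient Γ))
    [QuotientMeasureEqMeasurePreimage μ μX] (h : G) :
    MeasurePreserving (rightMul Γ h) μX μX := by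
  obtain ⟨D, hD, hu⟩ := exists_fundamentalDomain Γ
  have hDf := isFundamentalDomain_of_strict μ hD hu
  have hD' : MeasurableSet ((· * h) ⁻¹' D) := (measurable_mul_const h) hD
  have hDf' : IsFundamentalDomain Γ ((· * h) ⁻¹' D) μ :=
    isFundamentalDomain_of_strict μ hD' fun x => by
      simpa [Subgroup.smul_def, mul_assoc] using hu (x * h)
  have h1 := measurePreserving_proj μ μX hDf
  have h2 := measurePreserving_proj μ μX hDf'
  refine ⟨measurable_rightMul h, ?_⟩
  nth_rw 1 [← h2.map_eq]
  rw [Measure.map_map (measurable_rightMul h) (measurable_proj Γ)]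
  have h3 : MeasurePreserving (· * h) (μ.restrict ((· * h) ⁻¹' D)) (μ.restrict D) :=
    (measurePreserving_mul_right μ h).restrict_preimage hD
  have : rightMul Γ h ∘ proj Γ = proj Γ ∘ (· * h) := rfl
  rw [this, ← Measure.map_map (measurable_proj Γ) (measurable_mul_const h), h3.map_eq, h1.map_eq]

/-- On a wandering open set, integrals on `G` are dominated by integrals on `Γ\G`. -/
lemma lintegral_wandering_le (μ : Measure G) (μX : Measure (LeftQuotient Γ))
    [QuotientMeasureEqMeasurePreimage μ μX] {U : Set G} (hU : IsOpen U) (hw : IsWandering Γ U)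
    {F : LeftQuotient Γ → ℝ≥0∞} (hF : Measurable F) :
    ∫⁻ g in U, F (proj Γ g) ∂μ ≤ ∫⁻ x, F x ∂μX := by
  obtain ⟨D, hD, hUD, hu⟩ := exists_strict_fundamentalDomain hU hw
  rw [← (measurePreserving_proj μ μX (isFundamentalDomain_of_strict μ hD hu)).lintegral_comp hF]
  exact lintegral_mono_set hUD

lemma isLocallyFiniteMeasure_quotient (μ : Measure G) [μ.IsHaarMeasure] (μX : Measure (LeftQuotient Γ))
    [QuotientMeasureEqMeasurePreimage μ μX] :
    IsLocallyFiniteMeasure μX := by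
  refine ⟨fun x => ?_⟩
  obtain ⟨g, rfl⟩ := proj_surjective Γ x
  obtain ⟨U, hU, hg, hw⟩ := exists_isWandering (Γ := Γ) g
  obtain ⟨s, hs, hso, hfin⟩ := μ.exists_isOpen_measure_lt_top g
  obtain ⟨D, hD, hUD, hu⟩ := exists_strict_fundamentalDomain hU hw
  have hWo := (isOpenQuotientMap_proj Γ).isOpenMap _ (hU.inter hso)
  refine ⟨proj Γ '' (U ∩ s), hWo.mem_nhds ⟨g, ⟨hg, hs⟩, rfl⟩, ?_⟩
  rw [(isFundamentalDomain_of_strict μ hD hu).projection_respects_measure_apply μX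
    hWo.measurableSet]
  refine lt_of_le_of_lt (measure_mono ?_) hfin
  rintro x ⟨⟨w, hw', hx⟩, hxD⟩
  obtain ⟨γ, hγ, e⟩ := proj_eq_iff.1 hx
  -- A point of the domain that is equivalent to a point of $U\cap s$ coincides with it, because $U$
  -- lies in the domain. So the image of $U\cap s$ has measure at most that of $s$.
  have h1 : (⟨γ, hγ⟩ : Γ) = 1 := by
    refine (hu x).unique ?_ (by simpa using hxD)
    change γ * x ∈ D
    rw [e]
    exact hUD hw'.1
  have h2 : γ = 1 := congrArg Subtype.val h1
  rw [h2, one_mul] at e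
  rw [e]
  exact hw'.2

lemma isOpenPosMeasure_quotient (μ : Measure G) [μ.IsHaarMeasure] (μX : Measure (LeftQuotient Γ))
    [QuotientMeasureEqMeasurePreimage μ μX] : μX.IsOpenPosMeasure := by
  refine ⟨fun O hO hne h0 => ?_⟩
  have h1 := (quasiMeasurePreserving_proj μ μX).preimage_null h0
  obtain ⟨x, hx⟩ := hne
  obtain ⟨g, rfl⟩ := proj_surjective Γ x
  exact ((hO.preimage (continuous_proj Γ)).measure_pos μ ⟨g, hx⟩).ne' h1

end Quotient

/-! ### Functions on `Γ\G` -/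

section Descent

variable (Γ : Subgroup G) {E : Type*}

/-- Invariance under left translation by `Γ`. -/
def IsLeftInvariant (φ : G → E) : Prop := ∀ γ ∈ Γ, ∀ g, φ (γ * g) = φ g

/-- The function on `Γ\G` defined by a left `Γ`-invariant function on `G`. -/
def desc (φ : G → E) (x : LeftQuotient Γ) : E := φ x.out

variable {Γ}

lemma desc_proj {φ : G → E} (hφ : IsLeftInvariant Γ φ) (g : G) : desc Γ φ (proj Γ g) = φ g := by
  have h : proj Γ (proj Γ g).out = proj Γ g := Quotient.out_eq _
  obtain ⟨γ, hγ, e⟩ := proj_eq_iff.1 h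
  rw [desc, ← e, hφ γ hγ]

lemma continuous_desc [TopologicalSpace E] {φ : G → E} (hφ : IsLeftInvariant Γ φ)
    (hc : Continuous φ) : Continuous (desc Γ φ) := by
  rw [(isOpenQuotientMap_proj Γ).isQuotientMap.continuous_iff]
  exact hc.congr fun g => (desc_proj hφ g).symm

lemma IsLeftInvariant.comp_mul {φ : G → E} (hφ : IsLeftInvariant Γ φ) (h : G) :
    IsLeftInvariant Γ fun g => φ (g * h) := fun γ hγ g => by
  simp only [mul_assoc, hφ γ hγ]

lemma desc_rightMul {φ : G → E} (hφ : IsLeftInvariant Γ φ) (h : G) (x : LeftQuotient Γ) :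
    desc Γ φ (rightMul Γ h x) = desc Γ (fun g => φ (g * h)) x := by
  obtain ⟨g, rfl⟩ := proj_surjective Γ x
  rw [rightMul_proj, desc_proj hφ, desc_proj (hφ.comp_mul h)]

end Descent

/-- A measure on `Γ\G` that is invariant under right translations. -/
class IsRightInvariantMeasure {Γ : Subgroup G} (μX : Measure (LeftQuotient Γ)) : Prop where
  sigmaFinite : SigmaFinite μX
  isLocallyFinite : IsLocallyFiniteMeasure μX
  isOpenPos : μX.IsOpenPosMeasure
  measurePreserving : ∀ h : G, MeasurePreserving (rightMul Γ h) μX μX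

attribute [instance] IsRightInvariantMeasure.sigmaFinite IsRightInvariantMeasure.isLocallyFinite
  IsRightInvariantMeasure.isOpenPos

lemma isRightInvariantMeasure {Γ : Subgroup G} [DiscreteTopology Γ] (μ : Measure G)
    [μ.IsHaarMeasure] (μX : Measure (LeftQuotient Γ)) [QuotientMeasureEqMeasurePreimage μ μX] :
    IsRightInvariantMeasure μX :=
  ⟨sigmaFinite_quotient μ μX, isLocallyFiniteMeasure_quotient μ μX,
    isOpenPosMeasure_quotient μ μX, measurePreserving_rightMul μ μX⟩

/-! ### Weights and derivatives along the diagonal flow. -/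

section Flow

variable {Γ : Subgroup G}

/-- `φ` transforms under right translation by `k_θ` with the character `e^{2miθ}`. -/
def HasWeight (m : ℤ) (φ : G → ℂ) : Prop :=
  ∀ (g : G) (θ : ℝ), φ (g * kElt θ) = Complex.exp (2 * m * Complex.I * θ) * φ g

lemma HasWeight.mul {m n : ℤ} {φ ψ : G → ℂ} (hφ : HasWeight m φ) (hψ : HasWeight n ψ) :
    HasWeight (m + n) (fun g => φ g * ψ g) := fun g θ => by
  simp only [hφ g θ, hψ g θ]
  rw [show (2 * ((m + n : ℤ) : ℂ) * Complex.I * θ) = 2 * m * Complex.I * θ + 2 * n * Complex.I * θ by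
    push_cast; ring, Complex.exp_add]
  ring

lemma HasWeight.conj {m : ℤ} {φ : G → ℂ} (hφ : HasWeight m φ) :
    HasWeight (-m) (fun g => (starRingEnd ℂ) (φ g)) := fun g θ => by
  simp only [hφ g θ, map_mul, ← Complex.exp_conj]
  congr 2
  simp [Complex.conj_ofNat]

lemma HasWeight.const_mul {m : ℤ} {φ : G → ℂ} (hφ : HasWeight m φ) (c : ℂ) :
    HasWeight m (fun g => c * φ g) := fun g θ => by
  simp only [hφ g θ]; ring

lemma HasWeight.add {m : ℤ} {φ ψ : G → ℂ} (hφ : HasWeight m φ) (hψ : HasWeight m ψ) :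
    HasWeight m (fun g => φ g + ψ g) := fun g θ => by
  simp only [hφ g θ, hψ g θ]; ring

/-- The derivative along the flow `g ↦ g a_{e^t}`. -/
def HasFlowDeriv (F F' : G → ℂ) : Prop := ∀ g, HasDerivAt (fun t => F (g * expElt t)) (F' g) 0

/-- Since $t\mapsto a_{e^t}$ is a one-parameter group, the derivative at time $s$ is the derivative
at time $0$ from the point $g a_{e^s}$. -/
lemma HasFlowDeriv.hasDerivAt {F F' : G → ℂ} (h : HasFlowDeriv F F') (g : G) (s : ℝ) :
    HasDerivAt (fun t => F (g * expElt t)) (F' (g * expElt s)) s := by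
  have h1 := h (g * expElt s)
  have h2 : HasDerivAt (fun t : ℝ => F (g * expElt s * expElt (t - s))) (F' (g * expElt s)) s := by
    have := HasDerivAt.comp_sub_const (f := fun t => F (g * expElt s * expElt t)) s s
      (by rw [sub_self]; exact h1)
    exact this
  refine h2.congr_of_eventuallyEq (Eventually.of_forall fun t => ?_)
  simp only [mul_assoc, ← expElt_add]
  congr 3
  ring

lemma HasFlowDeriv.mul {F F' H H' : G → ℂ} (hF : HasFlowDeriv F F') (hH : HasFlowDeriv H H') :
    HasFlowDeriv (fun g => F g * H g) (fun g => F' g * H g + F g * H' g) := fun g => by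
  have := (hF g).fun_mul (hH g)
  rwa [expElt_zero, mul_one] at this

lemma HasFlowDeriv.add {F F' H H' : G → ℂ} (hF : HasFlowDeriv F F') (hH : HasFlowDeriv H H') :
    HasFlowDeriv (fun g => F g + H g) (fun g => F' g + H' g) := fun g => (hF g).add (hH g)

lemma HasFlowDeriv.sub {F F' H H' : G → ℂ} (hF : HasFlowDeriv F F') (hH : HasFlowDeriv H H') :
    HasFlowDeriv (fun g => F g - H g) (fun g => F' g - H' g) := fun g => (hF g).sub (hH g)

lemma HasFlowDeriv.const_mul {F F' : G → ℂ} (hF : HasFlowDeriv F F') (c : ℂ) :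
    HasFlowDeriv (fun g => c * F g) (fun g => c * F' g) := fun g => (hF g).const_mul c

lemma HasFlowDeriv.conj {F F' : G → ℂ} (hF : HasFlowDeriv F F') :
    HasFlowDeriv (fun g => (starRingEnd ℂ) (F g)) (fun g => (starRingEnd ℂ) (F' g)) :=
  fun g => by
    have := Complex.conjCLE.toContinuousLinearMap.hasFDerivAt.comp_hasDerivAt (0 : ℝ) (hF g)
    exact this

lemma HasFlowDeriv.div {F F' H H' : G → ℂ} (hF : HasFlowDeriv F F') (hH : HasFlowDeriv H H')
    (h0 : ∀ g, H g ≠ 0) :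
    HasFlowDeriv (fun g => F g / H g) (fun g => (F' g * H g - F g * H' g) / H g ^ 2) := fun g => by
  have := (hF g).fun_div (hH g) (by simpa [expElt_zero] using h0 g)
  rwa [expElt_zero, mul_one] at this

lemma HasFlowDeriv.unique {F F' F'' : G → ℂ} (h : HasFlowDeriv F F') (h' : HasFlowDeriv F F'') :
    F' = F'' := funext fun g => (h g).unique (h' g)

lemma HasFlowDeriv.comp_mul_left {F F' : G → ℂ} (hF : HasFlowDeriv F F') (γ : G) :
    HasFlowDeriv (fun g => F (γ * g)) (fun g => F' (γ * g)) := fun g => by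
  simpa [mul_assoc] using hF (γ * g)

/-- Left translation commutes with the flow, which acts on the right. -/
lemma HasFlowDeriv.isLeftInvariant {F F' : G → ℂ} (h : HasFlowDeriv F F')
    (hF : IsLeftInvariant Γ F) : IsLeftInvariant Γ F' := fun γ hγ g => by
  have h1 := h.comp_mul_left γ
  have h2 : (fun g => F (γ * g)) = F := funext fun g => hF γ hγ g
  rw [h2] at h1
  exact congrFun (h1.unique h) g

end Flow

/-! ### Integration by parts on $\Gamma\backslash G$. -/

section Integration

variable {Γ : Subgroup G} [DiscreteTopology Γ] {μX : Measure (LeftQuotient Γ)}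
  [IsRightInvariantMeasure μX]

lemma integral_comp_rightMul {E : Type*} [NormedAddCommGroup E] [NormedSpace ℝ E]
    [SecondCountableTopology E] {f : LeftQuotient Γ → E} (hf : Continuous f) (h : G) :
    ∫ x, f (rightMul Γ h x) ∂μX = ∫ x, f x ∂μX := by
  have hm := IsRightInvariantMeasure.measurePreserving (μX := μX) h
  have := integral_map (μ := μX) hm.measurable.aemeasurable (f := f) (by
    rw [hm.map_eq]; exact hf.aestronglyMeasurable)
  rw [← this, hm.map_eq]

lemma integral_desc_mul {φ : G → ℂ} (hφ : IsLeftInvariant Γ φ) (hc : Continuous φ) (h : G) :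
    ∫ x, desc Γ (fun g => φ (g * h)) x ∂μX = ∫ x, desc Γ φ x ∂μX := by
  rw [← integral_comp_rightMul (continuous_desc hφ hc) h]
  exact integral_congr_ae (Eventually.of_forall fun x => (desc_rightMul hφ h x).symm)

/-- Right translation by $k_{\pi/(2m)}$ preserves the integral and changes the sign of the
integrand. -/
lemma integral_desc_eq_zero_of_weight {m : ℤ} (hm : m ≠ 0) {φ : G → ℂ} (hφ : IsLeftInvariant Γ φ)
    (hc : Continuous φ) (hw : HasWeight m φ) : ∫ x, desc Γ φ x ∂μX = 0 := by
  have h := integral_desc_mul (μX := μX) hφ hc (kElt (Real.pi / (2 * m)))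
  have e : Complex.exp (2 * m * Complex.I * ((Real.pi / (2 * m) : ℝ) : ℂ)) = -1 := by
    rw [← Complex.exp_pi_mul_I]
    congr 1
    have : (m : ℂ) ≠ 0 := by exact_mod_cast hm
    push_cast
    field_simp
  have e2 : ∀ x, desc Γ (fun g => φ (g * kElt (Real.pi / (2 * m)))) x = - desc Γ φ x := by
    intro x
    simp only [desc, hw _ _, e]
    ring
  simp_rw [e2] at h
  rw [integral_neg] at h
  exact self_eq_neg.1 h.symm

/-- The integral over `Γ\G` of a derivative along a right-translation flow vanishes. -/
lemma integral_desc_flowDeriv {F F' : G → ℂ} (hF : IsLeftInvariant Γ F) (hFc : Continuous F)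
    (hF'c : Continuous F') (h : HasFlowDeriv F F') (hi : Integrable (desc Γ F) μX)
    (hi' : Integrable (desc Γ F') μX) : ∫ x, desc Γ F' x ∂μX = 0 := by
  have hF' : IsLeftInvariant Γ F' := h.isLeftInvariant hF
  have hc' : Continuous fun p : LeftQuotient Γ × ℝ => desc Γ F' (rightMul Γ (expElt p.2) p.1) :=
    (continuous_desc hF' hF'c).comp (continuous_rightMul_uncurry.comp
      (continuous_fst.prodMk (continuous_expElt.comp continuous_snd)))
  have hmp := IsRightInvariantMeasure.measurePreserving (μX := μX)
  -- The derivative is integrated along flow lines over $[0,1]$. After Fubini, one side is $\int F'$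
  -- and the other is $\int F(xa_e)-\int F(x)=0$, by invariance of the measure.
  have hftc : ∀ x, ∫ s in (0 : ℝ)..1, desc Γ F' (rightMul Γ (expElt s) x) =
      desc Γ F (rightMul Γ (expElt 1) x) - desc Γ F x := by
    intro x
    obtain ⟨g, rfl⟩ := proj_surjective Γ x
    simp_rw [rightMul_proj, desc_proj hF, desc_proj hF']
    rw [intervalIntegral.integral_eq_sub_of_hasDerivAt (fun s _ => h.hasDerivAt g s)]
    · rw [expElt_zero, mul_one]
    · exact (hF'c.comp (continuous_const.mul continuous_expElt)).intervalIntegrable _ _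
  have hint : Integrable (Function.uncurry fun (x : LeftQuotient Γ) (s : ℝ) =>
      desc Γ F' (rightMul Γ (expElt s) x)) (μX.prod (volume.restrict (Set.Ioc (0 : ℝ) 1))) := by
    refine (integrable_prod_iff' (f := fun p : LeftQuotient Γ × ℝ =>
      desc Γ F' (rightMul Γ (expElt p.2) p.1)) hc'.aestronglyMeasurable).2 ?_
    constructor
    · refine Eventually.of_forall fun s => ?_
      exact (hmp (expElt s)).integrable_comp_of_integrable hi'
    · have : ∀ s : ℝ, ∫ x, ‖desc Γ F' (rightMul Γ (expElt s) x)‖ ∂μX = ∫ x, ‖desc Γ F' x‖ ∂μX := by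
        intro s
        exact integral_comp_rightMul (continuous_desc hF' hF'c).norm (expElt s)
      simp only [this]
      exact integrable_const _
  have hswap := integral_integral_swap hint
  simp_rw [← intervalIntegral.integral_of_le zero_le_one, hftc] at hswap
  have e3 := integral_sub (μ := μX) (f := fun x => desc Γ F (rightMul Γ (expElt 1) x))
    ((hmp (expElt 1)).integrable_comp_of_integrable hi) hi
  rw [e3] at hswap
  simp_rw [integral_comp_rightMul (continuous_desc hF' hF'c),
    integral_comp_rightMul (continuous_desc hF hFc), sub_self] at hswap
  simpa using hswap.symm

end Integration

/-! ### Functions on `PSL₂(ℝ)` from even functions of matrices -/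

/-- The function on `PSL₂(ℝ)` induced by a function of matrices (meaningful for even functions). -/
def evenLift {E : Type*} (f : SL(2, ℝ) → E) (g : G) : E := f (Quotient.out g)

lemma evenLift_toG {E : Type*} {f : SL(2, ℝ) → E} (hf : ∀ A, f (-A) = f A) (A : SL(2, ℝ)) :
    evenLift f (toG A) = f A := by
  have h : toG (Quotient.out (toG A)) = toG A := Quotient.out_eq _
  rcases toG_eq_iff.1 h with h | h
  · rw [evenLift, h]
  · rw [evenLift, h, hf]

lemma continuous_of_comp_toG {E : Type*} [TopologicalSpace E] {f : G → E}
    (h : Continuous fun A => f (toG A)) : Continuous f :=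
  isOpenQuotientMap_toG.isQuotientMap.continuous_iff.2 h

/-! ### The kernel of the explicit vectors -/

/-- For `A = (a b; c d)`, the number `(b - u d) + i (a - u c)`. -/
def bdry (A : SL(2, ℝ)) (u : ℝ) : ℂ := ⟨A 0 1 - u * A 1 1, A 0 0 - u * A 1 0⟩

/-- The squared Hilbert–Schmidt norm. -/
def hs (A : SL(2, ℝ)) : ℝ := A 0 0 ^ 2 + A 0 1 ^ 2 + A 1 0 ^ 2 + A 1 1 ^ 2

lemma normSq_bdry (A : SL(2, ℝ)) (u : ℝ) :
    Complex.normSq (bdry A u) = (A 0 1 - u * A 1 1) ^ 2 + (A 0 0 - u * A 1 0) ^ 2 := by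
  rw [bdry, Complex.normSq_mk]; ring

/-- The determinant relation recovers $1$ and $u$ as combinations of the two components of $q$ with
the entries of $A$ as coefficients; Cauchy–Schwarz concludes. This bounds the kernel uniformly in
$u$, so a finite boundary measure suffices for dominated convergence. -/
lemma le_hs_mul_normSq_bdry (A : SL(2, ℝ)) (u : ℝ) :
    u ^ 2 + 1 ≤ hs A * Complex.normSq (bdry A u) := by
  have hd := det_eq_one A
  rw [normSq_bdry, hs]
  have h1 : A 1 1 * (A 0 0 - u * A 1 0) - A 1 0 * (A 0 1 - u * A 1 1) = 1 := by
    linear_combination hd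
  have h2 : A 0 1 * (A 0 0 - u * A 1 0) - A 0 0 * (A 0 1 - u * A 1 1) = u := by
    linear_combination u * hd
  generalize A 0 0 - u * A 1 0 = p at *
  generalize A 0 1 - u * A 1 1 = q at *
  have e : u ^ 2 + 1 = (A 0 1 * p - A 0 0 * q) ^ 2 + (A 1 1 * p - A 1 0 * q) ^ 2 := by
    rw [h1, h2]; ring
  rw [e]
  nlinarith [sq_nonneg (A 0 1 * q + A 0 0 * p), sq_nonneg (A 1 1 * q + A 1 0 * p)]

lemma normSq_bdry_pos (A : SL(2, ℝ)) (u : ℝ) : 0 < Complex.normSq (bdry A u) := by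
  rw [Complex.normSq_pos]
  intro h
  have := le_hs_mul_normSq_bdry A u
  rw [h, map_zero, mul_zero] at this
  nlinarith [sq_nonneg u]

lemma bdry_ne_zero (A : SL(2, ℝ)) (u : ℝ) : bdry A u ≠ 0 :=
  Complex.normSq_pos.1 (normSq_bdry_pos A u)

/-- The quotient `(u² + 1) / |q|²`. -/
def ratio (A : SL(2, ℝ)) (u : ℝ) : ℝ := (u ^ 2 + 1) / Complex.normSq (bdry A u)

lemma ratio_pos (A : SL(2, ℝ)) (u : ℝ) : 0 < ratio A u :=
  div_pos (by positivity) (normSq_bdry_pos A u)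

lemma ratio_le_hs (A : SL(2, ℝ)) (u : ℝ) : ratio A u ≤ hs A := by
  rw [ratio, div_le_iff₀ (normSq_bdry_pos A u)]
  exact le_hs_mul_normSq_bdry A u

/-- The kernel `((u² + 1) / |q|²)^δ (q̄ / q)^m`. -/
def kernel (δ : ℝ) (m : ℤ) (A : SL(2, ℝ)) (u : ℝ) : ℂ :=
  ((ratio A u ^ δ : ℝ) : ℂ) * ((starRingEnd ℂ) (bdry A u) / bdry A u) ^ m

lemma norm_conj_div {q : ℂ} (hq : q ≠ 0) : ‖(starRingEnd ℂ) q / q‖ = 1 := by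
  rw [norm_div, RCLike.norm_conj, div_self (norm_ne_zero_iff.2 hq)]

lemma norm_kernel (δ : ℝ) (m : ℤ) (A : SL(2, ℝ)) (u : ℝ) :
    ‖kernel δ m A u‖ = ratio A u ^ δ := by
  rw [kernel, norm_mul, norm_zpow, norm_conj_div (bdry_ne_zero A u), one_zpow, mul_one,
    Complex.norm_real, Real.norm_of_nonneg (Real.rpow_nonneg (ratio_pos A u).le δ)]

lemma norm_kernel_le {δ : ℝ} (hδ : 0 ≤ δ) (m : ℤ) (A : SL(2, ℝ)) (u : ℝ) :
    ‖kernel δ m A u‖ ≤ hs A ^ δ := by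
  rw [norm_kernel]
  exact Real.rpow_le_rpow (ratio_pos A u).le (ratio_le_hs A u) hδ

lemma bdry_neg (A : SL(2, ℝ)) (u : ℝ) : bdry (-A) u = -bdry A u := by
  apply Complex.ext <;> simp only [bdry, SL_neg_apply, Complex.neg_re, Complex.neg_im] <;> ring

/-- Evenness makes the kernel a function on $\mathrm{PSL}_2(\mathbb R)$. -/
lemma kernel_neg (δ : ℝ) (m : ℤ) (A : SL(2, ℝ)) (u : ℝ) : kernel δ m (-A) u = kernel δ m A u := by
  rw [kernel, kernel, ratio, ratio, bdry_neg, Complex.normSq_neg, map_neg, neg_div_neg_eq]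

lemma conj_kernel (δ : ℝ) (m : ℤ) (A : SL(2, ℝ)) (u : ℝ) :
    (starRingEnd ℂ) (kernel δ m A u) = kernel δ (-m) A u := by
  rw [kernel, kernel, map_mul, Complex.conj_ofReal, map_zpow₀, map_div₀, Complex.conj_conj,
    zpow_neg, ← inv_zpow, inv_div]

lemma continuous_bdry : Continuous fun p : SL(2, ℝ) × ℝ => bdry p.1 p.2 := by
  have h := continuous_SL_iff.1 (continuous_fst (X := SL(2, ℝ)) (Y := ℝ))
  have e : (fun p : SL(2, ℝ) × ℝ => bdry p.1 p.2) = fun p =>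
      ((p.1 0 1 - p.2 * p.1 1 1 : ℝ) : ℂ) + ((p.1 0 0 - p.2 * p.1 1 0 : ℝ) : ℂ) * Complex.I := by
    funext p
    apply Complex.ext <;> simp [bdry]
  rw [e]
  have h00 := h 0 0
  have h01 := h 0 1
  have h10 := h 1 0
  have h11 := h 1 1
  fun_prop

lemma continuous_ratio : Continuous fun p : SL(2, ℝ) × ℝ => ratio p.1 p.2 := by
  refine Continuous.div (by fun_prop) (Complex.continuous_normSq.comp continuous_bdry) fun p => ?_
  exact (normSq_bdry_pos p.1 p.2).ne'

lemma continuous_kernel (δ : ℝ) (m : ℤ) : Continuous fun p : SL(2, ℝ) × ℝ => kernel δ m p.1 p.2 := by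
  have h : ∀ p : SL(2, ℝ) × ℝ, bdry p.1 p.2 ≠ 0 := fun p => bdry_ne_zero _ _
  refine Continuous.mul ?_ ?_
  · exact Complex.continuous_ofReal.comp
      (continuous_ratio.rpow_const fun p => Or.inl (ratio_pos p.1 p.2).ne')
  · refine Continuous.zpow₀ (Continuous.div (Complex.continuous_conj.comp continuous_bdry)
      continuous_bdry h) m fun p => Or.inl ?_
    exact div_ne_zero ((map_ne_zero _).2 (h p)) (h p)

/-- Consequently $|q|$ is unchanged and $\bar q/q$ is multiplied by $e^{2i\theta}$, which is the
source of the weight $m$. -/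
lemma bdry_mul_kMat (A : SL(2, ℝ)) (θ u : ℝ) :
    bdry (A * kMat θ) u = Complex.exp (-(θ * Complex.I)) * bdry A u := by
  rw [← neg_mul, ← Complex.ofReal_neg, Complex.exp_mul_I, ← Complex.ofReal_cos, ← Complex.ofReal_sin]
  apply Complex.ext <;>
    simp [bdry, SL_mul_apply, -Complex.ofReal_cos, -Complex.ofReal_sin] <;> ring

lemma kernel_mul_kMat (δ : ℝ) (m : ℤ) (A : SL(2, ℝ)) (θ u : ℝ) :
    kernel δ m (A * kMat θ) u = Complex.exp (2 * m * Complex.I * θ) * kernel δ m A u := by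
  have h1 : Complex.normSq (Complex.exp (-(θ * Complex.I))) = 1 := by
    rw [Complex.normSq_eq_norm_sq, ← neg_mul, ← Complex.ofReal_neg, Complex.norm_exp_ofReal_mul_I,
      one_pow]
  have h2 : (starRingEnd ℂ) (Complex.exp (-(θ * Complex.I))) / Complex.exp (-(θ * Complex.I)) =
      Complex.exp (2 * Complex.I * θ) := by
    rw [← Complex.exp_conj, ← Complex.exp_sub]
    congr 1
    simp
    ring
  rw [kernel, kernel, ratio, ratio, bdry_mul_kMat, map_mul, h1, one_mul, map_mul, mul_div_mul_comm,
    h2, mul_zpow, ← Complex.exp_int_mul]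
  rw [show (m : ℂ) * (2 * Complex.I * θ) = 2 * m * Complex.I * θ by ring]
  ring

lemma bdry_mul_expMat (A : SL(2, ℝ)) (t u : ℝ) :
    bdry (A * expMat t) u = ((Real.exp (-(t / 2)) * (bdry A u).re : ℝ) : ℂ) +
      ((Real.exp (t / 2) * (bdry A u).im : ℝ) : ℂ) * Complex.I := by
  apply Complex.ext <;> simp [bdry, SL_mul_apply, -Complex.ofReal_mul, -Complex.ofReal_exp] <;> ring

/-- The flow scales the real part by $e^{-t/2}$ and the imaginary part by $e^{t/2}$. -/
lemma hasDerivAt_bdry (A : SL(2, ℝ)) (u : ℝ) :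
    HasDerivAt (fun t => bdry (A * expMat t) u) (-(starRingEnd ℂ) (bdry A u) / 2) 0 := by
  have h1 : HasDerivAt (fun t : ℝ => Real.exp (-(t / 2)) * (bdry A u).re)
      (-(1 / 2) * (bdry A u).re) 0 := by
    have := ((((hasDerivAt_id (0 : ℝ)).div_const 2).neg).exp).mul_const (bdry A u).re
    simpa using this
  have h2 : HasDerivAt (fun t : ℝ => Real.exp (t / 2) * (bdry A u).im)
      (1 / 2 * (bdry A u).im) 0 := by
    have := ((((hasDerivAt_id (0 : ℝ)).div_const 2)).exp).mul_const (bdry A u).im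
    simpa using this
  have h := h1.ofReal_comp.fun_add (h2.ofReal_comp.mul_const Complex.I)
  refine (h.congr_deriv ?_).congr_of_eventuallyEq
    (Eventually.of_forall fun t => bdry_mul_expMat A t u)
  apply Complex.ext <;> simp <;> ring

/-- With $w=\bar q/q$ and $q'=-\bar q/2$, the logarithmic derivative of $(u^2+1)/|q|^2$ is
$(w+w^{-1})/2$ and that of $w$ is $(w-w^{-1})/2$. Weighting them by $\delta$ and $m$ and collecting
powers of $w$ gives the two neighbouring kernels. -/
lemma hasDerivAt_kernel (δ : ℝ) (m : ℤ) (A : SL(2, ℝ)) (u : ℝ) :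
    HasDerivAt (fun t => kernel δ m (A * expMat t) u)
      (((δ + m) / 2) * kernel δ (m + 1) A u + ((δ - m) / 2) * kernel δ (m - 1) A u) 0 := by
  have hA : A * expMat 0 = A := by
    rw [show expMat 0 = 1 by apply SL_ext <;> simp [SL_one_apply], mul_one]
  have hq := hasDerivAt_bdry A u
  have hq0 := bdry_ne_zero A u
  have hN0 := normSq_bdry_pos A u
  have hqc : HasDerivAt (fun t => (starRingEnd ℂ) (bdry (A * expMat t) u)) (-bdry A u / 2) 0 := by
    have := Complex.conjCLE.toContinuousLinearMap.hasFDerivAt.comp_hasDerivAt (0 : ℝ) hq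
    refine this.congr_deriv ?_
    simp [Complex.conj_ofNat]
  have hw := hqc.fun_div hq (by simpa only [hA] using hq0)
  simp only [hA] at hw
  have hwm := (hasDerivAt_zpow m ((starRingEnd ℂ) (bdry A u) / bdry A u)
    (Or.inl (div_ne_zero ((map_ne_zero _).2 hq0) hq0))).comp_of_eq (0 : ℝ) hw (by simp only [hA])
  have hN : HasDerivAt (fun t => Complex.normSq (bdry (A * expMat t) u))
      ((bdry A u).im ^ 2 - (bdry A u).re ^ 2) 0 := by
    have h1 : HasDerivAt (fun t : ℝ => Real.exp (-t) * (bdry A u).re ^ 2 +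
        Real.exp t * (bdry A u).im ^ 2) ((bdry A u).im ^ 2 - (bdry A u).re ^ 2) 0 := by
      have := (((hasDerivAt_id (0 : ℝ)).neg.exp).mul_const ((bdry A u).re ^ 2)).fun_add
        (((hasDerivAt_id (0 : ℝ)).exp).mul_const ((bdry A u).im ^ 2))
      refine this.congr_deriv ?_
      simp; ring
    refine h1.congr_of_eventuallyEq (Eventually.of_forall fun t => ?_)
    simp only [bdry_mul_expMat, Complex.normSq_add_mul_I, mul_pow, ← Real.exp_nat_mul]
    congr 3
    all_goals push_cast; ring
  have hr : HasDerivAt (fun t => ratio (A * expMat t) u)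
      (-(u ^ 2 + 1) * ((bdry A u).im ^ 2 - (bdry A u).re ^ 2) / Complex.normSq (bdry A u) ^ 2) 0 := by
    have := (hasDerivAt_const (0 : ℝ) (u ^ 2 + 1)).fun_div hN (by simpa only [hA] using hN0.ne')
    refine this.congr_deriv ?_
    rw [hA]; ring
  have hrδ := (hr.rpow_const (p := δ) (Or.inl (by simpa only [hA] using (ratio_pos A u).ne'))).ofReal_comp
  have h := hrδ.fun_mul hwm
  refine h.congr_deriv ?_
  simp only [Function.comp, hA]
  have hc0 : (starRingEnd ℂ) (bdry A u) ≠ 0 := (map_ne_zero _).2 hq0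
  have hw0 := div_ne_zero hc0 hq0
  have hrr : ratio A u ^ (δ - 1) = ratio A u ^ δ / ratio A u := Real.rpow_sub_one (ratio_pos A u).ne' δ
  rw [kernel, kernel, zpow_add_one₀ hw0, zpow_sub_one₀ hw0, hrr, ratio]
  have hNC : (Complex.normSq (bdry A u) : ℂ) = bdry A u * (starRingEnd ℂ) (bdry A u) :=
    (Complex.mul_conj _).symm
  have hre : ((bdry A u).im ^ 2 - (bdry A u).re ^ 2 : ℂ) =
      -(bdry A u ^ 2 + (starRingEnd ℂ) (bdry A u) ^ 2) / 2 := by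
    apply Complex.ext <;> simp [pow_two] <;> ring
  have hu : ((u : ℂ) ^ 2 + 1) ≠ 0 := by
    have : (0 : ℝ) < u ^ 2 + 1 := by positivity
    exact_mod_cast this.ne'
  push_cast
  rw [hNC, hre]
  generalize ((((u ^ 2 + 1) / Complex.normSq (bdry A u)) ^ δ : ℝ) : ℂ) = R
  generalize ((starRingEnd ℂ) (bdry A u) / bdry A u) ^ m = W
  generalize (starRingEnd ℂ) (bdry A u) = c at *
  generalize bdry A u = q at *
  field_simp
  ring

/-! ### The explicit vectors of all weights. -/

section ExplicitVector

variable (δ : ℝ) (σ : Measure ℝ)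

/-- The function `e^{2miθ} ∫ ((u²+1) y / ((x-u)²+y²))^δ (((x-u) - iy) / ((x-u) + iy))^m dσ(u)` on
`PSL₂(ℝ)`. -/
def weightVec (m : ℤ) : G → ℂ := evenLift fun A => ∫ u, kernel δ m A u ∂σ

/-- The function `∫ ((u²+1) y / ((x-u)²+y²))^δ dσ(u)` on `PSL₂(ℝ)`. -/
def baseVec : G → ℝ := evenLift fun A => ∫ u, ratio A u ^ δ ∂σ

lemma weightVec_toG (m : ℤ) (A : SL(2, ℝ)) :
    weightVec δ σ m (toG A) = ∫ u, kernel δ m A u ∂σ :=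
  evenLift_toG (f := fun A => ∫ u, kernel δ m A u ∂σ) (fun A => by simp only [kernel_neg]) A

lemma ratio_neg (A : SL(2, ℝ)) (u : ℝ) : ratio (-A) u = ratio A u := by
  rw [ratio, ratio, bdry_neg, Complex.normSq_neg]

lemma baseVec_toG (A : SL(2, ℝ)) : baseVec δ σ (toG A) = ∫ u, ratio A u ^ δ ∂σ :=
  evenLift_toG (f := fun A => ∫ u, ratio A u ^ δ ∂σ) (fun A => by simp only [ratio_neg]) A

lemma weightVec_zero (g : G) : weightVec δ σ 0 g = baseVec δ σ g := by
  obtain ⟨A, rfl⟩ := toG_surjective g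
  rw [weightVec_toG, baseVec_toG, ← integral_complex_ofReal]
  simp [kernel]

lemma norm_weightVec_le (m : ℤ) (g : G) : ‖weightVec δ σ m g‖ ≤ baseVec δ σ g := by
  obtain ⟨A, rfl⟩ := toG_surjective g
  rw [weightVec_toG, baseVec_toG]
  refine (norm_integral_le_integral_norm _).trans_eq ?_
  simp only [norm_kernel]

lemma conj_weightVec (m : ℤ) (g : G) :
    (starRingEnd ℂ) (weightVec δ σ m g) = weightVec δ σ (-m) g := by
  obtain ⟨A, rfl⟩ := toG_surjective g
  rw [weightVec_toG, weightVec_toG, ← integral_conj]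
  simp only [conj_kernel]

lemma hasWeight_weightVec (m : ℤ) : HasWeight m (weightVec δ σ m) := fun g θ => by
  obtain ⟨A, rfl⟩ := toG_surjective g
  rw [kElt, ← toG_mul, weightVec_toG, weightVec_toG, ← integral_const_mul]
  simp only [kernel_mul_kMat]

variable {δ} {σ}

lemma continuous_hs : Continuous hs := by
  have h := continuous_SL_iff.1 (continuous_id (X := SL(2, ℝ)))
  have h00 := h 0 0
  have h01 := h 0 1
  have h10 := h 1 0
  have h11 := h 1 1
  simp only [id] at h00 h01 h10 h11
  unfold hs
  fun_prop

lemma hs_nonneg (A : SL(2, ℝ)) : 0 ≤ hs A := by unfold hs; positivity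

lemma eventually_hs_rpow_le (hδ : 0 ≤ δ) (A : SL(2, ℝ)) :
    ∀ᶠ B in 𝓝 A, hs B ^ δ ≤ (hs A + 1) ^ δ := by
  have : ∀ᶠ B in 𝓝 A, hs B < hs A + 1 :=
    continuous_hs.continuousAt.eventually_lt continuousAt_const (by linarith)
  filter_upwards [this] with B hB
  exact Real.rpow_le_rpow (hs_nonneg B) hB.le hδ

variable [IsFiniteMeasure σ]

lemma integrable_kernel (hδ : 0 ≤ δ) (m : ℤ) (A : SL(2, ℝ)) : Integrable (kernel δ m A) σ :=
  Integrable.of_bound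
    ((continuous_kernel δ m).comp (Continuous.prodMk_right A)).aestronglyMeasurable (hs A ^ δ)
    (Eventually.of_forall fun u => norm_kernel_le hδ m A u)

lemma continuous_weightVec (hδ : 0 ≤ δ) (m : ℤ) : Continuous (weightVec δ σ m) := by
  refine continuous_of_comp_toG ?_
  simp only [weightVec_toG]
  refine continuous_iff_continuousAt.2 fun A => ?_
  refine continuousAt_of_dominated (bound := fun _ => (hs A + 1) ^ δ) ?_ ?_ (integrable_const _) ?_
  · exact Eventually.of_forall fun B => (integrable_kernel hδ m B).aestronglyMeasurable
  · filter_upwards [eventually_hs_rpow_le hδ A] with B hB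
    exact Eventually.of_forall fun u => (norm_kernel_le hδ m B u).trans hB
  · exact Eventually.of_forall fun u =>
      ((continuous_kernel δ m).comp (Continuous.prodMk_left u)).continuousAt

lemma expMat_zero : expMat 0 = 1 := by apply SL_ext <;> simp [SL_one_apply]

lemma expMat_add (s t : ℝ) : expMat (s + t) = expMat s * expMat t := by
  apply SL_ext <;> simp [SL_mul_apply, ← Real.exp_add] <;> ring

lemma continuous_expMat : Continuous expMat := by
  refine continuous_SL_iff.2 fun i j => ?_
  fin_cases i <;> fin_cases j <;> simp <;> fun_prop

lemma hasDerivAt_kernel' (δ : ℝ) (m : ℤ) (A : SL(2, ℝ)) (u s : ℝ) :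
    HasDerivAt (fun t => kernel δ m (A * expMat t) u)
      (((δ + m) / 2) * kernel δ (m + 1) (A * expMat s) u +
        ((δ - m) / 2) * kernel δ (m - 1) (A * expMat s) u) s := by
  have h := hasDerivAt_kernel δ m (A * expMat s) u
  have h2 := HasDerivAt.comp_sub_const (f := fun t => kernel δ m (A * expMat s * expMat t) u) s s
    (by rw [sub_self]; exact h)
  refine h2.congr_of_eventuallyEq (Eventually.of_forall fun t => ?_)
  simp only [mul_assoc, ← expMat_add]
  congr 3
  ring

/-- The derivative of an explicit vector along the diagonal flow. -/
lemma hasFlowDeriv_weightVec (hδ : 0 ≤ δ) (m : ℤ) :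
    HasFlowDeriv (weightVec δ σ m) fun g =>
      ((δ + m) / 2) * weightVec δ σ (m + 1) g + ((δ - m) / 2) * weightVec δ σ (m - 1) g := by
  intro g
  obtain ⟨A, rfl⟩ := toG_surjective g
  simp only [expElt, ← toG_mul, weightVec_toG]
  have hA : A * expMat 0 = A := by rw [expMat_zero, mul_one]
  have hcont : ContinuousAt (fun t => A * expMat t) 0 :=
    (continuous_const.mul continuous_expMat).continuousAt
  have hev : ∀ᶠ t in 𝓝 (0 : ℝ), hs (A * expMat t) ^ δ ≤ (hs A + 1) ^ δ := by
    have := eventually_hs_rpow_le hδ A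
    rw [← hA] at this
    have h2 := hcont.eventually this
    simpa only [hA] using h2
  have h := hasDerivAt_integral_of_dominated_loc_of_deriv_le
    (F := fun t u => kernel δ m (A * expMat t) u) (x₀ := (0 : ℝ)) (μ := σ)
    (bound := fun _ => ‖((δ + m) / 2 : ℂ)‖ * (hs A + 1) ^ δ + ‖((δ - m) / 2 : ℂ)‖ * (hs A + 1) ^ δ)
    (F' := fun s u => ((δ + m) / 2) * kernel δ (m + 1) (A * expMat s) u +
        ((δ - m) / 2) * kernel δ (m - 1) (A * expMat s) u)
    hev
    (Eventually.of_forall fun t => (integrable_kernel hδ m _).aestronglyMeasurable)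
    (integrable_kernel hδ m _)
    (((integrable_kernel hδ (m + 1) _).const_mul _).add
      ((integrable_kernel hδ (m - 1) _).const_mul _)).aestronglyMeasurable
    (Eventually.of_forall fun u t ht => by
      refine (norm_add_le _ _).trans ?_
      rw [norm_mul, norm_mul]
      gcongr
      · exact (norm_kernel_le hδ _ _ u).trans ht
      · exact (norm_kernel_le hδ _ _ u).trans ht)
    (integrable_const _)
    (Eventually.of_forall fun u t _ => hasDerivAt_kernel' δ m A u t)
  refine h.2.congr_deriv ?_
  simp only [hA]
  rw [integral_add ((integrable_kernel hδ (m + 1) _).const_mul _)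
    ((integrable_kernel hδ (m - 1) _).const_mul _), integral_const_mul, integral_const_mul]

lemma baseVec_pos (hδ : 0 ≤ δ) (hσ : σ ≠ 0) (g : G) : 0 < baseVec δ σ g := by
  obtain ⟨A, rfl⟩ := toG_surjective g
  rw [baseVec_toG]
  have hi : Integrable (fun u => ratio A u ^ δ) σ := by
    refine (integrable_kernel (σ := σ) hδ 0 A).norm.congr (Eventually.of_forall fun u => ?_)
    exact norm_kernel δ 0 A u
  have hp : ∀ u, 0 < ratio A u ^ δ := fun u => Real.rpow_pos_of_pos (ratio_pos A u) δ
  rw [integral_pos_iff_support_of_nonneg (fun u => (hp u).le) hi]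
  have : Function.support (fun u => ratio A u ^ δ) = Set.univ :=
    Set.eq_univ_of_forall fun u => (hp u).ne'
  rw [this]
  exact (Measure.measure_univ_pos).2 hσ

end ExplicitVector

/-! ### The explicit vectors in coordinates -/

lemma iwasawa_smul_I {y : ℝ} (hy : 0 < y) (x θ : ℝ) :
    iwasawa x y θ • UpperHalfPlane.I = ⟨⟨x, y⟩, hy⟩ := by
  have hk : kMat θ • UpperHalfPlane.I = UpperHalfPlane.I := by
    apply UpperHalfPlane.ext
    rw [UpperHalfPlane.specialLinearGroup_apply]
    have h : (Real.cos θ : ℂ) + -Real.sin θ * Complex.I ≠ 0 := by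
      intro h
      have h1 := congrArg Complex.re h
      have h2 := congrArg Complex.im h
      simp [-Complex.ofReal_cos, -Complex.ofReal_sin] at h1 h2
      have := Real.sin_sq_add_cos_sq θ
      rw [h1, h2] at this
      norm_num at this
    simp [-Complex.ofReal_cos, -Complex.ofReal_sin]
    rw [div_eq_iff (by rw [add_comm]; simpa using h)]
    linear_combination (Real.sin θ : ℂ) * Complex.I_sq
  rw [iwasawa_eq hy]
  change (nMat x * aMat y hy * kMat θ) • UpperHalfPlane.I = _
  rw [mul_smul, hk]
  apply UpperHalfPlane.ext
  rw [UpperHalfPlane.specialLinearGroup_apply]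
  have hs : √y ≠ 0 := (Real.sqrt_pos.2 hy).ne'
  have hss : √y * √y = y := Real.mul_self_sqrt hy.le
  have e00 : (nMat x * aMat y hy) 0 0 = √y := by simp [SL_mul_apply]
  have e01 : (nMat x * aMat y hy) 0 1 = x * (√y)⁻¹ := by simp [SL_mul_apply]
  have e10 : (nMat x * aMat y hy) 1 0 = 0 := by simp [SL_mul_apply]
  have e11 : (nMat x * aMat y hy) 1 1 = (√y)⁻¹ := by simp [SL_mul_apply]
  simp only [e00, e01, e10, e11]
  apply Complex.ext
  · simp [hs]
  · simp [hss]

/-- This links the matrix form of the kernel to the stated formula; the real factor $y^{-1/2}$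
cancels in $\bar q/q$ and supplies the $y$ in the numerator of the ratio. -/
lemma bdry_iwasawa {y : ℝ} (hy : 0 < y) (x u : ℝ) :
    bdry (nMat x * aMat y hy * kMat 0) u = ((√y)⁻¹ : ℝ) * (((x : ℂ) - u) + Complex.I * y) := by
  rw [kMat_zero, mul_one]
  have hs : √y ≠ 0 := (Real.sqrt_pos.2 hy).ne'
  have hss : y = √y * √y := (Real.mul_self_sqrt hy.le).symm
  apply Complex.ext
  · simp [bdry, SL_mul_apply]; ring
  · simp [bdry, SL_mul_apply]
    rw [eq_inv_mul_iff_mul_eq₀ hs, ← hss]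

lemma ratio_iwasawa {y : ℝ} (hy : 0 < y) (x u : ℝ) :
    ratio (nMat x * aMat y hy * kMat 0) u = (u ^ 2 + 1) * y / ((x - u) ^ 2 + y ^ 2) := by
  have hss : (√y) * √y = y := Real.mul_self_sqrt hy.le
  have hn : Complex.normSq (((x : ℂ) - u) + Complex.I * y) = (x - u) ^ 2 + y ^ 2 := by
    rw [mul_comm, ← Complex.ofReal_sub, Complex.normSq_add_mul_I]
  rw [ratio, bdry_iwasawa, Complex.normSq_mul, hn, Complex.normSq_ofReal, ← mul_inv, hss]
  field_simp

lemma weightVec_iwasawa (δ : ℝ) (ν : Measure (OnePoint ℂ)) (ε : ℤˣ) (ℓ : ℕ) {y : ℝ} (hy : 0 < y)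
    (x θ : ℝ) : explicitVector δ ν ε ℓ x y θ =
      gammaFactor δ ℓ * weightVec δ (onReal ν) ((ε : ℤ) * ℓ) (iwasawa x y θ) := by
  have e : iwasawa x y θ = iwasawa x y 0 * kElt θ := by
    simp only [iwasawa, kElt_zero, mul_one]
  rw [e, hasWeight_weightVec, iwasawa_eq hy, weightVec_toG, explicitVector]
  have hk : ∀ u : ℝ, kernel δ ((ε : ℤ) * ℓ) (nMat x * aMat y hy * kMat 0) u =
      ((((u ^ 2 + 1) * y / ((x - u) ^ 2 + y ^ 2)) ^ δ : ℝ) : ℂ) *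
      ((((x : ℂ) - u) - (ε : ℤ) * Complex.I * y) / (((x : ℂ) - u) + (ε : ℤ) * Complex.I * y)) ^ ℓ := by
    intro u
    have hs : (((√y)⁻¹ : ℝ) : ℂ) ≠ 0 := by
      exact_mod_cast inv_ne_zero (Real.sqrt_pos.2 hy).ne'
    rw [kernel, ratio_iwasawa, bdry_iwasawa, map_mul, Complex.conj_ofReal, mul_div_mul_left _ _ hs,
      zpow_mul, zpow_natCast]
    congr 2
    -- For the sign $-1$ the kernel carries the inverse of $\bar q/q$, that is, its conjugate.
    rcases Int.units_eq_one_or ε with rfl | rfl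
    · simp [sub_eq_add_neg]
    · simp [sub_eq_add_neg]
  simp only [hk]
  push_cast
  rw [show 2 * ((ε : ℤ) * ℓ : ℂ) * Complex.I * θ = (ε : ℤ) * 2 * ℓ * Complex.I * θ by ring]
  ring

lemma baseVec_eq_baseEigenfunction (δ : ℝ) (ν : Measure (OnePoint ℂ)) (g : G) :
    baseVec δ (onReal ν) g = baseEigenfunction δ ν (g • UpperHalfPlane.I) := by
  obtain ⟨x, y, θ, hy, rfl⟩ := exists_eq_iwasawa g
  have e : iwasawa x y θ = iwasawa x y 0 * kElt θ := by
    simp only [iwasawa, kElt_zero, mul_one]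
  have h := hasWeight_weightVec δ (onReal ν) 0 (iwasawa x y 0) θ
  rw [← e, weightVec_zero, weightVec_zero] at h
  simp only [Int.cast_zero, mul_zero, zero_mul, Complex.exp_zero, one_mul] at h
  rw [Complex.ofReal_inj.1 h, iwasawa_smul_I hy, iwasawa_eq hy, baseVec_toG, baseEigenfunction]
  simp only [ratio_iwasawa]
  rfl

/-! ### Invariance of the base eigenfunction -/

/-- A positive continuous function whose square has the same finite integral over every fundamental
domain is left `Γ`-invariant. -/
lemma isLeftInvariant_of_hasUnitNorm {Γ : Subgroup G} [DiscreteTopology Γ] (μ : Measure G)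
    [μ.IsHaarMeasure] {F : G → ℝ} (hF : Continuous F) (hpos : ∀ g, 0 < F g)
    (h : HasUnitNorm Γ μ F) : IsLeftInvariant Γ F := by
  intro γ hγ g
  obtain ⟨U, hU, hgU, hw⟩ := exists_isWandering (Γ := Γ) g
  obtain ⟨D, hD, hUD, hu⟩ := exists_strict_fundamentalDomain hU hw
  have hwm : Measurable fun g => ‖F g‖ₑ ^ 2 := by fun_prop
  have hwm' : Measurable fun g => ‖F (γ * g)‖ₑ ^ 2 := hwm.comp (measurable_const_mul γ)
  -- Exchange argument: replacing a piece $A$ of $D$ by $\gamma A$ gives another fundamental domain,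
  -- so the equality of the two norms forces $\int_A F^2=\int_{\gamma A}F^2$.
  have key : ∀ A : Set G, MeasurableSet A → A ⊆ D →
      ∫⁻ g in A, ‖F g‖ₑ ^ 2 ∂μ = ∫⁻ g in A, ‖F (γ * g)‖ₑ ^ 2 ∂μ := by
    intro A hA hAD
    set B : Set G := (fun x => γ⁻¹ * x) ⁻¹' A with hB
    have hBm : MeasurableSet B := (measurable_const_mul γ⁻¹) hA
    have huniq : ∀ x : G, ∀ η : Γ, x ∈ D → (η : G) * x ∈ D → η = 1 := fun x η hx hηx =>
      (hu x).unique hηx (by simpa using hx)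
    -- If $x\in D$ and $\gamma^{-1}x\in A\subseteq D$, then $\gamma=1$ and $x\in A$.
    have hdisj : Disjoint (D \ A) B := by
      rw [Set.disjoint_left]
      rintro x ⟨hxD, hxA⟩ hxB
      have h1 := huniq x (⟨γ, hγ⟩⁻¹ : Γ) hxD (hAD hxB)
      have h2 : γ⁻¹ = 1 := congrArg Subtype.val h1
      rw [hB, Set.mem_preimage, h2, one_mul] at hxB
      exact hxA hxB
    have hD' : ∀ x : G, ∃! η : Γ, η • x ∈ D \ A ∪ B := by
      intro x
      obtain ⟨η, hη, hη'⟩ := hu x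
      by_cases hA' : η • x ∈ A
      · refine ⟨⟨γ, hγ⟩ * η, Or.inr ?_, fun ξ hξ => ?_⟩
        · change γ⁻¹ * (γ * η * x) ∈ A
          rw [mul_assoc, inv_mul_cancel_left]
          exact hA'
        · rcases hξ with hξ | hξ
          · have := hη' ξ hξ.1
            subst this
            exact absurd hA' hξ.2
          · have h1 : γ⁻¹ * (ξ * x) ∈ A := hξ
            have := hη' (⟨γ, hγ⟩⁻¹ * ξ) (by
              change γ⁻¹ * ξ * x ∈ D
              rw [mul_assoc]; exact hAD h1)
            rw [← this, mul_inv_cancel_left]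
      · refine ⟨η, Or.inl ⟨hη, hA'⟩, fun ξ hξ => ?_⟩
        rcases hξ with hξ | hξ
        · exact hη' ξ hξ.1
        · have h1 : γ⁻¹ * (ξ * x) ∈ A := hξ
          have h2 : (⟨γ, hγ⟩⁻¹ * ξ) • x ∈ A := by
            change γ⁻¹ * ξ * x ∈ A
            rw [mul_assoc]; exact h1
          rw [hη' _ (hAD h2)] at h2
          exact absurd h2 hA'
    have h1 := h D (isFundamentalDomain_of_strict μ hD hu)
    have h2 := h _ (isFundamentalDomain_of_strict μ ((hD.diff hA).union hBm) hD')
    rw [lintegral_union hBm hdisj] at h2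
    have h3 : ∫⁻ g in D, ‖F g‖ₑ ^ 2 ∂μ =
        ∫⁻ g in D \ A, ‖F g‖ₑ ^ 2 ∂μ + ∫⁻ g in A, ‖F g‖ₑ ^ 2 ∂μ := by
      rw [← lintegral_union hA Set.disjoint_sdiff_left, Set.sdiff_union_of_subset hAD]
    -- Finiteness of the common part allows its cancellation in `ℝ≥0∞`.
    have h4 : ∫⁻ g in D \ A, ‖F g‖ₑ ^ 2 ∂μ ≠ ∞ := by
      refine ne_top_of_le_ne_top ENNReal.one_ne_top (le_of_le_of_eq ?_ h1)
      exact lintegral_mono_set Set.sdiff_subset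
    have h5 : ∫⁻ g in A, ‖F g‖ₑ ^ 2 ∂μ = ∫⁻ g in B, ‖F g‖ₑ ^ 2 ∂μ := by
      rw [h3, ← h2] at h1
      exact (ENNReal.add_right_inj h4).1 h1
    rw [h5]
    have h6 : MeasurePreserving (fun x => γ * x) (μ.restrict A) (μ.restrict B) := by
      have := (measurePreserving_mul_left μ γ).restrict_preimage hBm
      have e : (fun x => γ * x) ⁻¹' B = A := by
        ext x; simp [hB]
      rwa [e] at this
    exact (h6.lintegral_comp hwm).symm
  have hfin : ∫⁻ g in D, ‖F g‖ₑ ^ 2 ∂μ ≠ ∞ := by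
    rw [h D (isFundamentalDomain_of_strict μ hD hu)]; exact ENNReal.one_ne_top
  -- Equal integrals over all measurable pieces of $U$ give equality almost everywhere there.
  -- Positivity then removes the square, and continuity removes the exceptional set.
  have hae : (fun g => ‖F g‖ₑ ^ 2) =ᵐ[μ.restrict U] fun g => ‖F (γ * g)‖ₑ ^ 2 := by
    refine ae_eq_of_forall_setLIntegral_eq_of_sigmaFinite hwm hwm' fun s hs _ => ?_
    rw [Measure.restrict_restrict hs]
    exact key _ (hs.inter hU.measurableSet) (Set.inter_subset_right.trans hUD)
  have hae2 : F =ᵐ[μ.restrict U] fun g => F (γ * g) := by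
    filter_upwards [hae] with x hx
    have h1 := (ENNReal.pow_right_strictMono two_ne_zero).injective hx
    rw [← ofReal_norm, ← ofReal_norm, ENNReal.ofReal_eq_ofReal_iff (norm_nonneg _) (norm_nonneg _),
      Real.norm_of_nonneg (hpos _).le, Real.norm_of_nonneg (hpos _).le] at h1
    exact h1
  exact (Measure.eqOn_open_of_ae_eq hae2 hU hF.continuousOn
    (hF.comp (continuous_const_mul γ)).continuousOn hgU).symm

/-! ### Splitting into weights -/

/-- The weight `m + 1` component of a sum of vectors of weights `m + 1` and `m - 1`. -/
def upperPart (m : ℤ) (φ : G → ℂ) (g : G) : ℂ :=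
  (φ g - Complex.I * Complex.exp (-(m * Complex.I * Real.pi / 2)) * φ (g * kElt (Real.pi / 4))) / 2

/-- The weight `m - 1` component of a sum of vectors of weights `m + 1` and `m - 1`. -/
def lowerPart (m : ℤ) (φ : G → ℂ) (g : G) : ℂ :=
  (φ g + Complex.I * Complex.exp (-(m * Complex.I * Real.pi / 2)) * φ (g * kElt (Real.pi / 4))) / 2

lemma upperPart_add_lowerPart (m : ℤ) (φ : G → ℂ) (g : G) :
    upperPart m φ g + lowerPart m φ g = φ g := by
  rw [upperPart, lowerPart]; ring

/-- The normalised translation by $k_{\pi/4}$ acts as $i$ in weight $m+1$ and as $-i$ in weight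
$m-1$, so a single rotation separates the two weights. -/
lemma HasWeight.mul_kElt_quarter_pi {m : ℤ} {a : G → ℂ} (ha : HasWeight (m + 1) a) (g : G) :
    Complex.exp (-(m * Complex.I * Real.pi / 2)) * a (g * kElt (Real.pi / 4)) = Complex.I * a g := by
  rw [ha, ← mul_assoc, ← Complex.exp_add]
  congr 1
  refine Eq.trans ?_ Complex.exp_pi_div_two_mul_I
  congr 1
  push_cast
  ring

lemma HasWeight.mul_kElt_quarter_pi' {m : ℤ} {b : G → ℂ} (hb : HasWeight (m - 1) b) (g : G) :
    Complex.exp (-(m * Complex.I * Real.pi / 2)) * b (g * kElt (Real.pi / 4)) = -Complex.I * b g := by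
  rw [hb, ← mul_assoc, ← Complex.exp_add]
  congr 1
  rw [← Complex.exp_neg_pi_div_two_mul_I]
  congr 1
  push_cast
  ring

lemma upperPart_add {m : ℤ} {a b : G → ℂ} (ha : HasWeight (m + 1) a) (hb : HasWeight (m - 1) b) :
    upperPart m (fun g => a g + b g) = a := by
  funext g
  rw [upperPart]
  linear_combination (-Complex.I / 2) * ha.mul_kElt_quarter_pi g +
    (-Complex.I / 2) * hb.mul_kElt_quarter_pi' g + ((b g - a g) / 2) * Complex.I_sq

lemma lowerPart_add {m : ℤ} {a b : G → ℂ} (ha : HasWeight (m + 1) a) (hb : HasWeight (m - 1) b) :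
    lowerPart m (fun g => a g + b g) = b := by
  funext g
  have h := upperPart_add_lowerPart m (fun g => a g + b g) g
  rw [upperPart_add ha hb] at h
  exact add_left_cancel h

lemma IsLeftInvariant.upperPart {Γ : Subgroup G} {φ : G → ℂ} (h : IsLeftInvariant Γ φ) (m : ℤ) :
    IsLeftInvariant Γ (upperPart m φ) := fun γ hγ g => by
  simp only [BaseRep.upperPart, mul_assoc, h γ hγ]

/-! ### Invariance and norms of the explicit vectors. -/

section Spectral

variable {Γ : Subgroup G} {δ : ℝ} {σ : Measure ℝ} [IsFiniteMeasure σ]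

lemma add_int_ne_zero (hδ₁ : 1 / 2 < δ) (hδ₂ : δ < 1) (m : ℤ) : (δ + m : ℂ) ≠ 0 := by
  intro h
  have h1 : δ + m = 0 := by exact_mod_cast h
  have h2 : (-1 : ℝ) < m := by linarith
  have h3 : (m : ℝ) < 0 := by linarith
  have h4 : (-1 : ℤ) < m := by exact_mod_cast h2
  have h5 : m < (0 : ℤ) := by exact_mod_cast h3
  omega

/-- The flow derivative of an invariant $v_n$ is invariant, and so is its part of weight $n+1$,
which is a nonzero multiple of $v_{n+1}$. Negative weights follow by conjugation. -/
lemma isLeftInvariant_weightVec (hδ₁ : 1 / 2 < δ) (hδ₂ : δ < 1)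
    (h : IsLeftInvariant Γ (baseVec δ σ)) (m : ℤ) : IsLeftInvariant Γ (weightVec δ σ m) := by
  have hnat : ∀ n : ℕ, IsLeftInvariant Γ (weightVec δ σ n) := by
    intro n
    induction n with
    | zero =>
      intro γ hγ g
      rw [Nat.cast_zero, weightVec_zero, weightVec_zero, h γ hγ]
    | succ n ih =>
      have hd := hasFlowDeriv_weightVec (σ := σ) (by linarith : 0 ≤ δ) (n : ℤ)
      have hi := (hd.isLeftInvariant ih).upperPart n
      rw [upperPart_add ((hasWeight_weightVec δ σ (n + 1 : ℤ)).const_mul _)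
        ((hasWeight_weightVec δ σ (n - 1 : ℤ)).const_mul _)] at hi
      intro γ hγ g
      have := hi γ hγ g
      have h0 : ((δ + (n : ℤ)) / 2 : ℂ) ≠ 0 :=
        div_ne_zero (add_int_ne_zero hδ₁ hδ₂ n) two_ne_zero
      push_cast at this h0 ⊢
      exact mul_left_cancel₀ h0 this
  rcases Int.eq_nat_or_neg m with ⟨n, rfl | rfl⟩
  · exact hnat n
  · intro γ hγ g
    rw [← conj_weightVec, ← conj_weightVec, hnat n γ hγ]

variable {μX : Measure (LeftQuotient Γ)}

lemma integrable_desc_of_le [DiscreteTopology Γ] {φ : G → ℂ} (hφ : IsLeftInvariant Γ φ) (hc : Continuous φ)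
    {w : G → ℝ} (hw : Integrable (desc Γ w) μX) {C : ℝ} (h : ∀ g, ‖φ g‖ ≤ C * w g) :
    Integrable (desc Γ φ) μX :=
  (hw.const_mul C).mono' (continuous_desc hφ hc).aestronglyMeasurable
    (Eventually.of_forall fun _ => h _)

/-- The base eigenfunction of exponent `δ ∈ (1/2, 1)` is left `Γ`-invariant and square integrable on
`Γ\G`. -/
structure SquareIntegrableBase (δ : ℝ) (σ : Measure ℝ) (μX : Measure (LeftQuotient Γ)) : Prop where
  half_lt : 1 / 2 < δ
  lt_one : δ < 1
  invariant : IsLeftInvariant Γ (baseVec δ σ)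
  integrable_sq : Integrable (desc Γ fun g => baseVec δ σ g ^ 2) μX

lemma SquareIntegrableBase.nonneg {δ : ℝ} {σ : Measure ℝ} {μX : Measure (LeftQuotient Γ)}
    (hb : SquareIntegrableBase δ σ μX) : 0 ≤ δ := by linarith [hb.half_lt]

lemma SquareIntegrableBase.isLeftInvariant (hb : SquareIntegrableBase δ σ μX) (m : ℤ) :
    IsLeftInvariant Γ (weightVec δ σ m) :=
  isLeftInvariant_weightVec hb.half_lt hb.lt_one hb.invariant m

lemma SquareIntegrableBase.continuous (hb : SquareIntegrableBase δ σ μX) (m : ℤ) :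
    Continuous (weightVec δ σ m) := continuous_weightVec hb.nonneg m

lemma integral_desc_add {φ ψ : G → ℂ} (hφ : Integrable (desc Γ φ) μX)
    (hψ : Integrable (desc Γ ψ) μX) :
    ∫ x, desc Γ (fun g => φ g + ψ g) x ∂μX = ∫ x, desc Γ φ x ∂μX + ∫ x, desc Γ ψ x ∂μX :=
  integral_add hφ hψ

lemma integral_desc_const_mul (c : ℂ) (φ : G → ℂ) :
    ∫ x, desc Γ (fun g => c * φ g) x ∂μX = c * ∫ x, desc Γ φ x ∂μX :=
  integral_const_mul c _

lemma integrable_desc_add {φ ψ : G → ℂ} (hφ : Integrable (desc Γ φ) μX)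
    (hψ : Integrable (desc Γ ψ) μX) : Integrable (desc Γ fun g => φ g + ψ g) μX := hφ.add hψ

lemma integrable_desc_const_mul (c : ℂ) {φ : G → ℂ} (hφ : Integrable (desc Γ φ) μX) :
    Integrable (desc Γ fun g => c * φ g) μX := hφ.const_mul c

lemma IsLeftInvariant.mul {φ ψ : G → ℂ} (hφ : IsLeftInvariant Γ φ) (hψ : IsLeftInvariant Γ ψ) :
    IsLeftInvariant Γ fun g => φ g * ψ g := fun γ hγ g => by simp only [hφ γ hγ, hψ γ hγ]

/-- Every product $v_mv_n$ is dominated by $v_0^2$. -/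
lemma integrable_weightVec_mul [DiscreteTopology Γ] (hb : SquareIntegrableBase δ σ μX) (m n : ℤ) :
    Integrable (desc Γ fun g => weightVec δ σ m g * weightVec δ σ n g) μX := by
  have hδ := hb.nonneg
  refine integrable_desc_of_le (fun γ hγ g => ?_)
    ((continuous_weightVec hδ m).mul (continuous_weightVec hδ n)) hb.integrable_sq (C := 1) fun g => ?_
  · rw [hb.isLeftInvariant m γ hγ, hb.isLeftInvariant n γ hγ]
  · rw [norm_mul, one_mul, sq]
    exact mul_le_mul (norm_weightVec_le δ σ m g) (norm_weightVec_le δ σ n g) (norm_nonneg _)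
      ((norm_nonneg _).trans (norm_weightVec_le δ σ m g))

lemma integral_weightVec_mul_eq_zero [DiscreteTopology Γ] [IsRightInvariantMeasure μX] (hb : SquareIntegrableBase δ σ μX) {m n : ℤ} (hmn : m + n ≠ 0) :
    ∫ x, desc Γ (fun g => weightVec δ σ m g * weightVec δ σ n g) x ∂μX = 0 := by
  have hδ := hb.nonneg
  refine integral_desc_eq_zero_of_weight hmn (fun γ hγ g => ?_)
    ((continuous_weightVec hδ m).mul (continuous_weightVec hδ n))
    ((hasWeight_weightVec δ σ m).mul (hasWeight_weightVec δ σ n))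
  rw [hb.isLeftInvariant m γ hγ, hb.isLeftInvariant n γ hγ]

/-- The flow derivative of $v_mv_{-(m+1)}$ integrates to zero. Of its four terms only the two of
weight zero survive, and these are squared norms because $v_{-k}=\overline{v_k}$. -/
lemma weightVec_norm_recursion [DiscreteTopology Γ] [IsRightInvariantMeasure μX] (hb : SquareIntegrableBase δ σ μX) (m : ℤ) :
    (δ + m) * ∫ x, desc Γ (fun g => weightVec δ σ (m + 1) g * weightVec δ σ (-(m + 1)) g) x ∂μX =
      (m + 1 - δ) * ∫ x, desc Γ (fun g => weightVec δ σ m g * weightVec δ σ (-m) g) x ∂μX := by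
  have hδ := hb.nonneg
  have hinv := hb.isLeftInvariant
  have hd := (hasFlowDeriv_weightVec (σ := σ) hδ m).mul
    (hasFlowDeriv_weightVec (σ := σ) hδ (-(m + 1)))
  have hI := integrable_weightVec_mul hb
  have hZ := fun {m n : ℤ} => integral_weightVec_mul_eq_zero (μX := μX) hb (m := m) (n := n)
  have e : (fun g => ((δ + m) / 2 * weightVec δ σ (m + 1) g + (δ - m) / 2 * weightVec δ σ (m - 1) g) *
        weightVec δ σ (-(m + 1)) g + weightVec δ σ m g *
        ((δ + (-(m + 1) : ℤ)) / 2 * weightVec δ σ (-(m + 1) + 1) g +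
          (δ - (-(m + 1) : ℤ)) / 2 * weightVec δ σ (-(m + 1) - 1) g)) =
      fun g => ((δ + m) / 2 * (weightVec δ σ (m + 1) g * weightVec δ σ (-(m + 1)) g) +
        (δ - m) / 2 * (weightVec δ σ (m - 1) g * weightVec δ σ (-(m + 1)) g)) +
        ((δ - m - 1) / 2 * (weightVec δ σ m g * weightVec δ σ (-m) g) +
        (δ + m + 1) / 2 * (weightVec δ σ m g * weightVec δ σ (-(m + 1) - 1) g)) := by
    funext g
    rw [show -(m + 1) + 1 = -m by ring]
    push_cast
    ring
  rw [e] at hd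
  have hc := fun k => continuous_weightVec (σ := σ) hδ k
  have hcm := fun (k : ℤ × ℤ) (c : ℂ) => integrable_desc_const_mul c (hI k.1 k.2)
  have hi1 := integrable_desc_add (hcm (m + 1, -(m + 1)) ((δ + m) / 2))
    (hcm (m - 1, -(m + 1)) ((δ - m) / 2))
  have hi2 := integrable_desc_add (hcm (m, -m) ((δ - m - 1) / 2))
    (hcm (m, -(m + 1) - 1) ((δ + m + 1) / 2))
  have h0 := integral_desc_flowDeriv (μX := μX) ((hinv m).mul (hinv (-(m + 1))))
    ((hc m).mul (hc _))
    (by have h1 := hc m; have h2 := hc (m + 1); have h3 := hc (m - 1); have h4 := hc (-(m + 1))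
        have h5 := hc (-m); have h6 := hc (-(m + 1) - 1); fun_prop) hd (hI _ _)
    (integrable_desc_add hi1 hi2)
  rw [integral_desc_add hi1 hi2, integral_desc_add (hcm _ _) (hcm _ _),
    integral_desc_add (hcm (m, -m) _) (hcm (m, -(m + 1) - 1) _), integral_desc_const_mul,
    integral_desc_const_mul, integral_desc_const_mul, integral_desc_const_mul] at h0
  rw [hZ (m := m - 1) (n := -(m + 1)) (by omega),
    hZ (m := m) (n := -(m + 1) - 1) (by omega)] at h0
  linear_combination 2 * h0

lemma integral_normSq_weightVec (σ : Measure ℝ) (m : ℤ) :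
    ∫ x, desc Γ (fun g => weightVec δ σ m g * weightVec δ σ (-m) g) x ∂μX =
      (∫ x, ‖desc Γ (weightVec δ σ m) x‖ ^ 2 ∂μX : ℝ) := by
  rw [← integral_complex_ofReal]
  refine integral_congr_ae (Eventually.of_forall fun x => ?_)
  simp only [desc]
  rw [← conj_weightVec, Complex.mul_conj, Complex.normSq_eq_norm_sq]

/-- The norms of the explicit vectors. -/
lemma gammaFactor_sq_mul_integral [DiscreteTopology Γ] [IsRightInvariantMeasure μX] (hb : SquareIntegrableBase δ σ μX) (ℓ : ℕ) :
    gammaFactor δ ℓ ^ 2 * ∫ x, ‖desc Γ (weightVec δ σ ℓ) x‖ ^ 2 ∂μX =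
      ∫ x, ‖desc Γ (weightVec δ σ 0) x‖ ^ 2 ∂μX := by
  have hδ₁ := hb.half_lt
  have hδ₂ := hb.lt_one
  have hδ : 0 < δ := by linarith
  have hG1 : 0 < Real.Gamma δ := Real.Gamma_pos_of_pos hδ
  have hG2 : 0 < Real.Gamma (1 - δ) := Real.Gamma_pos_of_pos (by linarith)
  have hG3 : ∀ n : ℕ, 0 < Real.Gamma (δ + n) := fun n => Real.Gamma_pos_of_pos (by positivity)
  have hG4 : ∀ n : ℕ, 0 < Real.Gamma (1 - δ + n) := fun n =>
    Real.Gamma_pos_of_pos (by have : (0 : ℝ) ≤ n := n.cast_nonneg; linarith)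
  have hsq : ∀ n : ℕ, gammaFactor δ n ^ 2 =
      (Real.Gamma (δ + n) * Real.Gamma (1 - δ)) / (Real.Gamma δ * Real.Gamma (1 - δ + n)) := by
    intro n
    rw [gammaFactor, div_pow, Real.sq_sqrt (mul_pos (hG3 n) hG2).le,
      Real.sq_sqrt (mul_pos hG1 (hG4 n)).le]
  induction ℓ with
  | zero =>
    rw [hsq, Nat.cast_zero, Nat.cast_zero, add_zero, add_zero, mul_comm (Real.Gamma δ), div_self, one_mul]
    exact (mul_pos hG2 hG1).ne'
  | succ n ih =>
    rw [← ih]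
    have hr := weightVec_norm_recursion (μX := μX) hb n
    rw [integral_normSq_weightVec σ, integral_normSq_weightVec σ] at hr
    have hr' : (δ + n) * ∫ x, ‖desc Γ (weightVec δ σ (n + 1)) x‖ ^ 2 ∂μX =
        (n + 1 - δ) * ∫ x, ‖desc Γ (weightVec δ σ n) x‖ ^ 2 ∂μX := by
      exact_mod_cast hr
    rw [hsq, hsq]
    push_cast
    -- By the functional equation the squared Gamma factors have successive ratio
    -- $(\delta+n)/(n+1-\delta)$, the inverse of the ratio of squared norms.
    rw [← add_assoc, ← add_assoc, Real.Gamma_add_one (by positivity : δ + (n : ℝ) ≠ 0),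
      Real.Gamma_add_one (by have : (0 : ℝ) ≤ n := n.cast_nonneg; linarith : 1 - δ + (n : ℝ) ≠ 0)]
    have h5 := (hG3 n).ne'
    have h6 := (hG4 n).ne'
    have h7 : 1 - δ + (n : ℝ) ≠ 0 := by have : (0 : ℝ) ≤ n := n.cast_nonneg; linarith
    field_simp
    linear_combination hr'

end Spectral

/-! ### The ground state argument in weight zero. -/

section Liouville

variable {Γ : Subgroup G} {δ : ℝ} {σ : Measure ℝ} {μX : Measure (LeftQuotient Γ)}

lemma IsLeftInvariant.conj {φ : G → ℂ} (hφ : IsLeftInvariant Γ φ) :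
    IsLeftInvariant Γ fun g => (starRingEnd ℂ) (φ g) := fun γ hγ g => by simp only [hφ γ hγ]

lemma IsLeftInvariant.div {φ ψ : G → ℂ} (hφ : IsLeftInvariant Γ φ) (hψ : IsLeftInvariant Γ ψ) :
    IsLeftInvariant Γ fun g => φ g / ψ g := fun γ hγ g => by simp only [hφ γ hγ, hψ γ hγ]

lemma IsLeftInvariant.add {φ ψ : G → ℂ} (hφ : IsLeftInvariant Γ φ) (hψ : IsLeftInvariant Γ ψ) :
    IsLeftInvariant Γ fun g => φ g + ψ g := fun γ hγ g => by simp only [hφ γ hγ, hψ γ hγ]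

lemma IsLeftInvariant.sub {φ ψ : G → ℂ} (hφ : IsLeftInvariant Γ φ) (hψ : IsLeftInvariant Γ ψ) :
    IsLeftInvariant Γ fun g => φ g - ψ g := fun γ hγ g => by simp only [hφ γ hγ, hψ γ hγ]

lemma IsLeftInvariant.const_mul {φ : G → ℂ} (hφ : IsLeftInvariant Γ φ) (c : ℂ) :
    IsLeftInvariant Γ fun g => c * φ g := fun γ hγ g => by simp only [hφ γ hγ]

lemma HasWeight.div_zero {m : ℤ} {φ ψ : G → ℂ} (hφ : HasWeight m φ) (hψ : HasWeight 0 ψ) :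
    HasWeight m (fun g => φ g / ψ g) := fun g θ => by
  simp only [hφ g θ, hψ g θ]
  simp [mul_div_assoc]

/-- A continuous `Γ`-invariant function with vanishing `L²` norm on `Γ\G` is zero. -/
lemma eq_zero_of_integral_norm_sq [DiscreteTopology Γ] [IsRightInvariantMeasure μX] {φ : G → ℂ}
    (hφ : IsLeftInvariant Γ φ) (hc : Continuous φ)
    (hi : Integrable (desc Γ fun g => ‖φ g‖ ^ 2) μX)
    (h0 : ∫ x, desc Γ (fun g => ‖φ g‖ ^ 2) x ∂μX = 0) (g : G) : φ g = 0 := by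
  have h1 := (integral_eq_zero_iff_of_nonneg (fun x => by simp only [desc]; positivity) hi).1 h0
  have h2 : desc Γ φ =ᵐ[μX] fun _ => 0 := by
    filter_upwards [h1] with x hx
    simpa [desc] using hx
  have h3 := Continuous.ae_eq_iff_eq μX (continuous_desc hφ hc) continuous_const |>.1 h2
  rw [← desc_proj hφ g, h3]

variable [IsFiniteMeasure σ] [DiscreteTopology Γ] [IsRightInvariantMeasure μX]

/-- The ground state `baseVec` spans its eigenspace: a square integrable function of weight zero
satisfying the second order equation of `baseVec` is a multiple of it. -/
lemma eq_const_mul_baseVec (hb : SquareIntegrableBase δ σ μX) (hσ : σ ≠ 0)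
    {ψ ψ' ψ'' p n : G → ℂ} (hψ : IsLeftInvariant Γ ψ) (hp : IsLeftInvariant Γ p)
    (hn : IsLeftInvariant Γ n) (hψc : Continuous ψ) (hψ'c : Continuous ψ') (hpc : Continuous p)
    (hnc : Continuous n) (hd : HasFlowDeriv ψ ψ') (hd' : HasFlowDeriv ψ' ψ'')
    (hψw : HasWeight 0 ψ) (hpw : HasWeight 2 p) (hnw : HasWeight (-2) n)
    (heq : ∀ g, ψ'' g = -(δ * (1 - δ) / 2) * ψ g + p g + n g)
    (hw : Integrable (desc Γ fun g => ‖ψ g‖ ^ 2 + ‖ψ' g‖ ^ 2 + ‖p g‖ ^ 2 + ‖n g‖ ^ 2) μX) :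
    ∃ c : ℂ, ∀ g, ψ g = c * baseVec δ σ g := by
  have hδ := hb.nonneg
  have hδ₁ := hb.lt_one
  set v := weightVec δ σ with hv
  have hvc : ∀ k, Continuous (v k) := hb.continuous
  have hvi : ∀ k, IsLeftInvariant Γ (v k) := hb.isLeftInvariant
  have hvw : ∀ k, HasWeight k (v k) := hasWeight_weightVec δ σ
  have hbase : ∀ g, v 0 g = baseVec δ σ g := weightVec_zero δ σ
  have hpos : ∀ g, 0 < baseVec δ σ g := baseVec_pos hδ hσ
  have hB0 : ∀ g, v 0 g ≠ 0 := fun g => by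
    rw [hbase]; exact_mod_cast (hpos g).ne'
  have hle : ∀ k g, ‖v k g‖ ≤ ‖v 0 g‖ := fun k g => by
    rw [hbase, Complex.norm_real, Real.norm_of_nonneg (hpos g).le]
    exact norm_weightVec_le δ σ k g
  have hconj : ∀ k g, (starRingEnd ℂ) (v k g) = v (-k) g := conj_weightVec δ σ
  -- First and second flow derivatives of $v_0$, from the flow derivative formula in weights $0$ and
  -- $\pm1$.
  set B' : G → ℂ := fun g => (δ / 2) * (v 1 g + v (-1) g) with hB'
  set B'' : G → ℂ := fun g =>
    (δ * (δ + 1) / 4) * (v 2 g + v (-2) g) - (δ * (1 - δ) / 2) * v 0 g with hB''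
  have hBd : HasFlowDeriv (v 0) B' := by
    have := hasFlowDeriv_weightVec (σ := σ) hδ 0
    convert this using 1
    funext g
    simp only [hB', ← hv]
    norm_num
    ring
  have hBd' : HasFlowDeriv B' B'' := by
    have h1 := hasFlowDeriv_weightVec (σ := σ) hδ 1
    have h2 := hasFlowDeriv_weightVec (σ := σ) hδ (-1)
    have := (h1.add h2).const_mul (δ / 2)
    convert this using 1
    funext g
    simp only [hB'', ← hv]
    norm_num
    ring
  -- The logarithmic derivative of the ground state along the flow; it is real and bounded by $1$,
  -- since $|v_{\pm1}|\le v_0$ and $\delta<1$.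
  set b : G → ℂ := fun g => B' g / v 0 g with hbdef
  have hbd := hBd'.div hBd hB0
  have hbc : Continuous b := by
    refine Continuous.div ?_ (hvc 0) hB0
    have h1 := hvc 1
    have h2 := hvc (-1)
    fun_prop
  have hbi : IsLeftInvariant Γ b := (((hvi 1).add (hvi (-1))).const_mul _).div (hvi 0)
  have hbconj : ∀ g, (starRingEnd ℂ) (b g) = b g := fun g => by
    simp only [hbdef, hB', map_div₀, map_mul, map_add, hconj, Complex.conj_ofReal, neg_neg, neg_zero,
      Complex.conj_ofNat]
    rw [add_comm]
  have hbn : ∀ g, ‖b g‖ ≤ 1 := fun g => by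
    have h0 : 0 < ‖v 0 g‖ := norm_pos_iff.2 (hB0 g)
    rw [hbdef, norm_div, div_le_one h0, hB', norm_mul]
    have h1 : ‖(δ / 2 : ℂ)‖ ≤ 1 / 2 := by
      rw [norm_div, Complex.norm_real, Real.norm_of_nonneg hδ]
      simp only [Complex.norm_ofNat]
      linarith
    have h2 : ‖v 1 g + v (-1) g‖ ≤ 2 * ‖v 0 g‖ :=
      (norm_add_le _ _).trans (by linarith [hle 1 g, hle (-1) g])
    calc _ ≤ 1 / 2 * (2 * ‖v 0 g‖) := by gcongr
      _ = ‖v 0 g‖ := by ring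
  set κ : ℂ := (δ * (δ + 1) / 4 : ℂ) with hκ
  have hκn : ‖κ‖ ≤ 1 := by
    have : κ = ((δ * (δ + 1) / 4 : ℝ) : ℂ) := by rw [hκ]; push_cast; ring
    rw [this, Complex.norm_real, Real.norm_of_nonneg (by positivity)]
    nlinarith
  have hrn : ∀ k g, ‖v k g / v 0 g‖ ≤ 1 := fun k g => by
    rw [norm_div, div_le_one (norm_pos_iff.2 (hB0 g))]; exact hle k g
  set Q : G → ℂ := fun g => (ψ' g - b g * ψ g) * (starRingEnd ℂ) (ψ' g - b g * ψ g) with hQ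
  set R₁ : G → ℂ := fun g => (starRingEnd ℂ) (ψ g) * p g +
    (-κ) * ((v 2 g / v 0 g) * (ψ g * (starRingEnd ℂ) (ψ g))) with hR₁
  set R₂ : G → ℂ := fun g => (starRingEnd ℂ) (ψ g) * n g +
    (-κ) * ((v (-2) g / v 0 g) * (ψ g * (starRingEnd ℂ) (ψ g))) with hR₂
  set T : G → ℂ := fun g => (starRingEnd ℂ) (ψ g) * ψ' g - b g * (ψ g * (starRingEnd ℂ) (ψ g)) with hT
  -- Since $b'=B''/B-b^2$ with $B=v_0$, the derivative of $T=\bar\psi\psi'-b|\psi|^2$ is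
  -- $|\psi'-b\psi|^2+\bar\psi\psi''-(B''/B)|\psi|^2$. The functions $\psi$ and $B$ have the same
  -- weight-zero term in their second-order equations, so these terms cancel and only pieces of
  -- weight $\pm2$ remain, whose integrals vanish.
  have hTd : HasFlowDeriv T fun g => (Q g + R₁ g) + R₂ g := by
    have h := (hd.conj.mul hd').sub (hbd.mul (hd.mul hd.conj))
    convert h using 1
    funext g
    simp only [hQ, hR₁, hR₂, map_sub, map_mul, hbconj, heq]
    have h1 : b g * v 0 g = B' g := div_mul_cancel₀ _ (hB0 g)
    rw [← h1]
    have h2 := hB0 g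
    simp only [hB'', ← hκ]
    field_simp
    ring
  have hψi' : IsLeftInvariant Γ ψ' := hd.isLeftInvariant hψ
  have hψψ : IsLeftInvariant Γ fun g => ψ g * (starRingEnd ℂ) (ψ g) := hψ.mul hψ.conj
  have hdi : IsLeftInvariant Γ fun g => ψ' g - b g * ψ g := hψi'.sub (hbi.mul hψ)
  have hdc : Continuous fun g => ψ' g - b g * ψ g := by fun_prop
  have hQi : IsLeftInvariant Γ Q := hdi.mul hdi.conj
  have hR₁i : IsLeftInvariant Γ R₁ :=
    (hψ.conj.mul hp).add ((((hvi 2).div (hvi 0)).mul hψψ).const_mul _)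
  have hR₂i : IsLeftInvariant Γ R₂ :=
    (hψ.conj.mul hn).add ((((hvi (-2)).div (hvi 0)).mul hψψ).const_mul _)
  have hTi : IsLeftInvariant Γ T := (hψ.conj.mul hψi').sub (hbi.mul hψψ)
  have hψψc : Continuous fun g => ψ g * (starRingEnd ℂ) (ψ g) :=
    hψc.mul (Complex.continuous_conj.comp hψc)
  have hψcc : Continuous fun g => (starRingEnd ℂ) (ψ g) := Complex.continuous_conj.comp hψc
  have hQc : Continuous Q := hdc.mul (Complex.continuous_conj.comp hdc)
  have hR₁c : Continuous R₁ :=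
    (hψcc.mul hpc).add (continuous_const.mul (((hvc 2).div (hvc 0) hB0).mul hψψc))
  have hR₂c : Continuous R₂ :=
    (hψcc.mul hnc).add (continuous_const.mul (((hvc (-2)).div (hvc 0) hB0).mul hψψc))
  have hTc : Continuous T := (hψcc.mul hψ'c).sub (hbc.mul hψψc)
  have hdn : ∀ g, ‖ψ' g - b g * ψ g‖ ≤ ‖ψ' g‖ + ‖ψ g‖ := fun g => by
    refine (norm_sub_le _ _).trans ?_
    rw [norm_mul]
    have := mul_le_mul_of_nonneg_right (hbn g) (norm_nonneg (ψ g))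
    linarith
  have hRn : ∀ (k : ℤ) (q : G → ℂ) g, ‖(starRingEnd ℂ) (ψ g) * q g +
      (-κ) * ((v k g / v 0 g) * (ψ g * (starRingEnd ℂ) (ψ g)))‖ ≤ ‖ψ g‖ * ‖q g‖ + ‖ψ g‖ ^ 2 := by
    intro k q g
    refine (norm_add_le _ _).trans ?_
    rw [norm_mul, RCLike.norm_conj, norm_mul, norm_neg, norm_mul, norm_mul, RCLike.norm_conj, sq]
    have h1 := mul_le_mul_of_nonneg_right (hrn k g) (mul_nonneg (norm_nonneg (ψ g)) (norm_nonneg (ψ g)))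
    have h2 := mul_le_mul hκn h1 (by positivity) zero_le_one
    linarith
  have hQI : Integrable (desc Γ Q) μX := by
    refine integrable_desc_of_le hQi hQc hw (C := 2) fun g => ?_
    rw [hQ, norm_mul, RCLike.norm_conj]
    have h1 := hdn g
    have h2 := mul_le_mul h1 h1 (norm_nonneg _) (by positivity)
    nlinarith [sq_nonneg (‖ψ' g‖ - ‖ψ g‖), sq_nonneg ‖p g‖, sq_nonneg ‖n g‖]
  have hR₁I : Integrable (desc Γ R₁) μX := by
    refine integrable_desc_of_le hR₁i hR₁c hw (C := 2) fun g => (hRn 2 p g).trans ?_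
    nlinarith [sq_nonneg (‖ψ g‖ - ‖p g‖), sq_nonneg ‖ψ' g‖, sq_nonneg ‖n g‖, sq_nonneg ‖ψ g‖,
      sq_nonneg ‖p g‖]
  have hR₂I : Integrable (desc Γ R₂) μX := by
    refine integrable_desc_of_le hR₂i hR₂c hw (C := 2) fun g => (hRn (-2) n g).trans ?_
    nlinarith [sq_nonneg (‖ψ g‖ - ‖n g‖), sq_nonneg ‖ψ' g‖, sq_nonneg ‖n g‖, sq_nonneg ‖ψ g‖,
      sq_nonneg ‖p g‖]
  have hTI : Integrable (desc Γ T) μX := by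
    refine integrable_desc_of_le hTi hTc hw (C := 2) fun g => ?_
    have h1 : ‖T g‖ ≤ ‖ψ g‖ * ‖ψ' g‖ + ‖ψ g‖ ^ 2 := by
      refine (norm_sub_le _ _).trans ?_
      rw [norm_mul, RCLike.norm_conj, norm_mul, norm_mul, RCLike.norm_conj, sq]
      have := mul_le_mul_of_nonneg_right (hbn g)
        (mul_nonneg (norm_nonneg (ψ g)) (norm_nonneg (ψ g)))
      linarith
    nlinarith [sq_nonneg (‖ψ g‖ - ‖ψ' g‖), sq_nonneg ‖ψ' g‖, sq_nonneg ‖n g‖, sq_nonneg ‖ψ g‖,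
      sq_nonneg ‖p g‖]
  have hw₂ : HasWeight 0 fun g => ψ g * (starRingEnd ℂ) (ψ g) := by
    simpa using hψw.mul hψw.conj
  have hψcw : HasWeight 0 fun g => (starRingEnd ℂ) (ψ g) := by simpa using hψw.conj
  have hR₁w : HasWeight 2 R₁ := by
    have h1 := hψcw.mul hpw
    have h2 := ((hvw 2).div_zero (hvw 0)).mul hw₂
    rw [zero_add] at h1
    rw [add_zero] at h2
    exact h1.add (h2.const_mul _)
  have hR₂w : HasWeight (-2) R₂ := by
    have h1 := hψcw.mul hnw
    have h2 := ((hvw (-2)).div_zero (hvw 0)).mul hw₂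
    rw [zero_add] at h1
    rw [add_zero] at h2
    exact h1.add (h2.const_mul _)
  have hQRc : Continuous fun g => (Q g + R₁ g) + R₂ g := (hQc.add hR₁c).add hR₂c
  have h0 : ∫ x, desc Γ (fun g => (Q g + R₁ g) + R₂ g) x ∂μX = 0 :=
    integral_desc_flowDeriv hTi hTc hQRc hTd hTI
    (integrable_desc_add (integrable_desc_add hQI hR₁I) hR₂I)
  rw [integral_desc_add (integrable_desc_add hQI hR₁I) hR₂I, integral_desc_add hQI hR₁I,
    integral_desc_eq_zero_of_weight (by norm_num) hR₁i hR₁c hR₁w,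
    integral_desc_eq_zero_of_weight (by norm_num) hR₂i hR₂c hR₂w, add_zero, add_zero] at h0
  have hQr : ∀ g, Q g = ((‖ψ' g - b g * ψ g‖ ^ 2 : ℝ) : ℂ) := fun g => by
    simp only [hQ]
    rw [Complex.mul_conj, Complex.normSq_eq_norm_sq]
  have hQr' : desc Γ Q = fun x => ((desc Γ (fun g => ‖ψ' g - b g * ψ g‖ ^ 2) x : ℝ) : ℂ) := by
    funext x; exact hQr _
  have hzero : ∀ g, ψ' g - b g * ψ g = 0 := by
    refine eq_zero_of_integral_norm_sq (μX := μX) hdi hdc ?_ ?_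
    · rw [hQr'] at hQI
      exact_mod_cast hQI.re
    · rw [hQr', integral_complex_ofReal] at h0
      exact_mod_cast h0
  have hh := hd.div hBd hB0
  -- The relation $\psi'=b\psi$ says that $\psi/v_0$ has zero flow derivative. It is also rotation
  -- invariant, hence constant on $G$ by the Cartan decomposition.
  have hh0 : ∀ g, (ψ' g * v 0 g - ψ g * B' g) / v 0 g ^ 2 = 0 := fun g => by
    have h1 : b g * v 0 g = B' g := div_mul_cancel₀ _ (hB0 g)
    rw [← h1, sub_eq_zero.1 (hzero g)]
    ring
  have hflow : ∀ g t, ψ (g * expElt t) / v 0 (g * expElt t) = ψ g / v 0 g := by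
    intro g t
    have hder : ∀ s, HasDerivAt (fun t => ψ (g * expElt t) / v 0 (g * expElt t)) 0 s := fun s => by
      have := hh.hasDerivAt g s
      rwa [hh0] at this
    have := is_const_of_deriv_eq_zero (fun s => (hder s).differentiableAt)
      (fun s => (hder s).deriv) t 0
    simpa [expElt_zero] using this
  have hrot : ∀ g θ, ψ (g * kElt θ) / v 0 (g * kElt θ) = ψ g / v 0 g := fun g θ => by
    rw [hψw, hvw]; simp
  have hconst := eq_const_of_right_invariant (F := fun g => ψ g / v 0 g) hrot hflow
  refine ⟨ψ 1 / v 0 1, fun g => ?_⟩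
  rw [← hconst g, ← hbase, div_mul_cancel₀ _ (hB0 g)]

end Liouville

/-! ### Functions of given weight in coordinates -/

section Coordinates

/-- The point `A i` of the upper half plane, as a pair of real numbers. -/
def moebiusPt (A : SL(2, ℝ)) : ℝ × ℝ :=
  ((A 0 0 * A 1 0 + A 0 1 * A 1 1) / (A 1 0 ^ 2 + A 1 1 ^ 2), 1 / (A 1 0 ^ 2 + A 1 1 ^ 2))

/-- The square `e^{2iθ}` of the phase in the Iwasawa decomposition of `A`. -/
def phase (A : SL(2, ℝ)) : ℂ :=
  ((A 1 1 : ℂ) - Complex.I * A 1 0) / ((A 1 1 : ℂ) + Complex.I * A 1 0)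

lemma bottom_row_mul (A : SL(2, ℝ)) : ((A 1 1 : ℂ) - Complex.I * A 1 0) *
    ((A 1 1 : ℂ) + Complex.I * A 1 0) = ((A 1 0 ^ 2 + A 1 1 ^ 2 : ℝ) : ℂ) := by
  push_cast
  ring_nf
  rw [Complex.I_sq]
  ring

lemma bottom_row_sub_ne_zero (A : SL(2, ℝ)) : (A 1 1 : ℂ) - Complex.I * A 1 0 ≠ 0 := by
  refine left_ne_zero_of_mul (b := (A 1 1 : ℂ) + Complex.I * A 1 0) ?_
  rw [bottom_row_mul]
  exact_mod_cast (bottom_row_pos A).ne'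

lemma bottom_row_add_ne_zero (A : SL(2, ℝ)) : (A 1 1 : ℂ) + Complex.I * A 1 0 ≠ 0 := by
  refine right_ne_zero_of_mul (a := (A 1 1 : ℂ) - Complex.I * A 1 0) ?_
  rw [bottom_row_mul]
  exact_mod_cast (bottom_row_pos A).ne'

lemma phase_ne_zero (A : SL(2, ℝ)) : phase A ≠ 0 :=
  div_ne_zero (bottom_row_sub_ne_zero A) (bottom_row_add_ne_zero A)

lemma moebiusPt_pos (A : SL(2, ℝ)) : 0 < (moebiusPt A).2 := one_div_pos.2 (bottom_row_pos A)

lemma moebiusPt_mul_kMat (A : SL(2, ℝ)) (θ : ℝ) : moebiusPt (A * kMat θ) = moebiusPt A := by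
  have h := Real.sin_sq_add_cos_sq θ
  have h1 : (A * kMat θ) 1 0 ^ 2 + (A * kMat θ) 1 1 ^ 2 = A 1 0 ^ 2 + A 1 1 ^ 2 := by
    simp only [SL_mul_apply, kMat_00, kMat_01, kMat_10, kMat_11]
    linear_combination (A 1 0 ^ 2 + A 1 1 ^ 2) * h
  have h2 : (A * kMat θ) 0 0 * (A * kMat θ) 1 0 + (A * kMat θ) 0 1 * (A * kMat θ) 1 1 =
      A 0 0 * A 1 0 + A 0 1 * A 1 1 := by
    simp only [SL_mul_apply, kMat_00, kMat_01, kMat_10, kMat_11]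
    linear_combination (A 0 0 * A 1 0 + A 0 1 * A 1 1) * h
  rw [moebiusPt, moebiusPt, h1, h2]

lemma phase_mul_kMat (A : SL(2, ℝ)) (θ : ℝ) :
    phase (A * kMat θ) = Complex.exp (2 * Complex.I * θ) * phase A := by
  have h1 : ((A * kMat θ) 1 1 : ℂ) - Complex.I * (A * kMat θ) 1 0 =
      Complex.exp (θ * Complex.I) * ((A 1 1 : ℂ) - Complex.I * A 1 0) := by
    rw [Complex.exp_mul_I]
    simp only [SL_mul_apply, kMat_00, kMat_01, kMat_10, kMat_11]
    push_cast
    linear_combination (A 1 0 : ℂ) * Complex.sin θ * Complex.I_sq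
  have h2 : ((A * kMat θ) 1 1 : ℂ) + Complex.I * (A * kMat θ) 1 0 =
      Complex.exp (-θ * Complex.I) * ((A 1 1 : ℂ) + Complex.I * A 1 0) := by
    rw [Complex.exp_mul_I, Complex.cos_neg, Complex.sin_neg]
    simp only [SL_mul_apply, kMat_00, kMat_01, kMat_10, kMat_11]
    push_cast
    linear_combination (A 1 0 : ℂ) * Complex.sin θ * Complex.I_sq
  rw [phase, h1, h2, mul_div_mul_comm, ← Complex.exp_sub, ← phase]
  congr 2
  ring

lemma moebiusPt_nMat_mul_aMat (x : ℝ) {y : ℝ} (hy : 0 < y) :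
    moebiusPt (nMat x * aMat y hy) = (x, y) := by
  have h := Real.sq_sqrt hy.le
  have h' := (Real.sqrt_pos.2 hy).ne'
  simp only [moebiusPt, SL_mul_apply, nMat_00, nMat_01, nMat_10, nMat_11, aMat_00, aMat_01, aMat_10,
    aMat_11]
  ext <;> field_simp <;> simp [h]

lemma phase_nMat_mul_aMat (x : ℝ) {y : ℝ} (hy : 0 < y) : phase (nMat x * aMat y hy) = 1 := by
  have h' : (√y : ℂ) ≠ 0 := by exact_mod_cast (Real.sqrt_pos.2 hy).ne'
  simp [phase, SL_mul_apply, h']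

lemma toG_mul_kMat (A : SL(2, ℝ)) (θ : ℝ) : toG A * kElt θ = toG (A * kMat θ) := by
  rw [kElt, ← toG_mul]

/-- A function of weight $m$ is determined by its restriction to the half plane. The phase is a
rational function of the bottom row, so no choice of angle enters. -/
lemma HasWeight.apply_toG {m : ℤ} {φ : G → ℂ} (hw : HasWeight m φ) (A : SL(2, ℝ)) :
    φ (toG A) = phase A ^ m * φ (iwasawa (moebiusPt A).1 (moebiusPt A).2 0) := by
  obtain ⟨θ, h⟩ := exists_eq_iwasawa_mat A
  have hy := moebiusPt_pos A
  have e : A = nMat (moebiusPt A).1 * aMat (moebiusPt A).2 hy * kMat θ := h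
  have hp : phase A = Complex.exp (2 * Complex.I * θ) := by
    rw [e, phase_mul_kMat, phase_nMat_mul_aMat, mul_one]
  have h1 : iwasawa (moebiusPt A).1 (moebiusPt A).2 0 =
      toG (nMat (moebiusPt A).1 * aMat (moebiusPt A).2 hy) := by
    rw [iwasawa_eq hy, kMat_zero, mul_one]
  have h2 : toG A = toG (nMat (moebiusPt A).1 * aMat (moebiusPt A).2 hy) * kElt θ := by
    rw [toG_mul_kMat, ← e]
  rw [h2, hw, ← h1, hp, ← Complex.exp_int_mul]
  congr 2
  ring

lemma continuous_moebiusPt : Continuous moebiusPt := by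
  have h := continuous_SL_iff.1 (continuous_id (X := SL(2, ℝ)))
  have h00 := h 0 0
  have h01 := h 0 1
  have h10 := h 1 0
  have h11 := h 1 1
  simp only [id] at h00 h01 h10 h11
  refine Continuous.prodMk ?_ ?_
  · exact ((h00.mul h10).add (h01.mul h11)).div ((h10.pow 2).add (h11.pow 2))
      fun A => (bottom_row_pos A).ne'
  · exact continuous_const.div ((h10.pow 2).add (h11.pow 2)) fun A => (bottom_row_pos A).ne'

lemma continuous_phase : Continuous phase := by
  have h := continuous_SL_iff.1 (continuous_id (X := SL(2, ℝ)))
  have h10 := Complex.continuous_ofReal.comp (h 1 0)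
  have h11 := Complex.continuous_ofReal.comp (h 1 1)
  exact (h11.sub (continuous_const.mul h10)).div (h11.add (continuous_const.mul h10))
    bottom_row_add_ne_zero

/-- The function `(x, y) ↦ φ (n_x a_y)`. -/
def coordFun (φ : G → ℂ) (p : ℝ × ℝ) : ℂ := φ (iwasawa p.1 p.2 0)

lemma isOpen_halfPlane : IsOpen {p : ℝ × ℝ | 0 < p.2} := isOpen_lt continuous_const continuous_snd

lemma IsSmooth.contDiffOn_coordFun {φ : G → ℂ} (hs : IsSmooth φ) :
    ContDiffOn ℝ ((⊤ : ℕ∞) : WithTop ℕ∞) (coordFun φ) {p | 0 < p.2} := by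
  refine ContDiffOn.comp (f := fun p : ℝ × ℝ => (p.1, p.2, (0 : ℝ))) hs ?_ fun p hp => hp
  fun_prop

lemma IsSmooth.continuous {m : ℤ} {φ : G → ℂ} (hs : IsSmooth φ) (hw : HasWeight m φ) :
    Continuous φ := by
  refine isOpenQuotientMap_toG.isQuotientMap.continuous_iff.2 ?_
  have h : φ ∘ toG = fun A => phase A ^ m * coordFun φ (moebiusPt A) := funext hw.apply_toG
  rw [h]
  refine (continuous_phase.zpow₀ m fun A => Or.inl (phase_ne_zero A)).mul ?_
  exact hs.contDiffOn_coordFun.continuousOn.comp_continuous continuous_moebiusPt moebiusPt_pos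

/-- The operator `iy ∂_x + y ∂_y + m`. -/
def raiseOp (m : ℤ) (u : ℝ × ℝ → ℂ) (p : ℝ × ℝ) : ℂ :=
  Complex.I * p.2 * fderiv ℝ u p (1, 0) + p.2 * fderiv ℝ u p (0, 1) + m * u p

/-- The operator `-iy ∂_x + y ∂_y - m`. -/
def lowerOp (m : ℤ) (u : ℝ × ℝ → ℂ) (p : ℝ × ℝ) : ℂ :=
  -Complex.I * p.2 * fderiv ℝ u p (1, 0) + p.2 * fderiv ℝ u p (0, 1) - m * u p

lemma hasDerivAt_moebiusPt (A : SL(2, ℝ)) :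
    HasDerivAt (fun t => moebiusPt (A * expMat t))
      (2 * A 1 0 * A 1 1 / (A 1 0 ^ 2 + A 1 1 ^ 2) ^ 2,
        (A 1 1 ^ 2 - A 1 0 ^ 2) / (A 1 0 ^ 2 + A 1 1 ^ 2) ^ 2) 0 := by
  have hr := (bottom_row_pos A).ne'
  have hp : HasDerivAt (fun t : ℝ => Real.exp (t / 2)) (1 / 2) 0 := by
    simpa using ((hasDerivAt_id (0 : ℝ)).div_const 2).exp
  have hn : HasDerivAt (fun t : ℝ => Real.exp (-(t / 2))) (-(1 / 2)) 0 := by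
    simpa using (((hasDerivAt_id (0 : ℝ)).div_const 2).neg).exp
  simp only [moebiusPt, SL_mul_apply, expMat_00, expMat_01, expMat_10, expMat_11, mul_zero,
    add_zero, zero_add]
  have hden := ((hp.const_mul (A 1 0)).pow 2).add ((hn.const_mul (A 1 1)).pow 2)
  have hd0 : (A 1 0 * Real.exp (0 / 2)) ^ 2 + (A 1 1 * Real.exp (-(0 / 2))) ^ 2 ≠ 0 := by simpa using hr
  refine HasDerivAt.prodMk ?_ ?_
  · have hnum := ((hp.const_mul (A 0 0)).mul (hp.const_mul (A 1 0))).add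
      ((hn.const_mul (A 0 1)).mul (hn.const_mul (A 1 1)))
    refine (hnum.div hden hd0).congr_deriv ?_
    simp
    field_simp
    linear_combination (4 * A 1 0 * A 1 1) * det_eq_one A
  · refine ((hasDerivAt_const (0 : ℝ) (1 : ℝ)).div hden hd0).congr_deriv ?_
    simp
    field_simp
    ring

lemma hasDerivAt_phase (A : SL(2, ℝ)) :
    HasDerivAt (fun t => phase (A * expMat t))
      (-2 * Complex.I * A 1 0 * A 1 1 / ((A 1 1 : ℂ) + Complex.I * A 1 0) ^ 2) 0 := by
  have hp : HasDerivAt (fun t : ℝ => ((Real.exp (t / 2) : ℝ) : ℂ)) (1 / 2 : ℝ) 0 := by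
    simpa using ((hasDerivAt_id (0 : ℝ)).div_const 2).exp.ofReal_comp
  have hn : HasDerivAt (fun t : ℝ => ((Real.exp (-(t / 2)) : ℝ) : ℂ)) (-(1 / 2) : ℝ) 0 := by
    simpa using (((hasDerivAt_id (0 : ℝ)).div_const 2).neg).exp.ofReal_comp
  simp only [phase, SL_mul_apply, expMat_00, expMat_01, expMat_10, expMat_11, mul_zero,
    add_zero, zero_add, Complex.ofReal_mul]
  have h1 := ((hn.const_mul (A 1 1 : ℂ)).sub ((hp.const_mul (A 1 0 : ℂ)).const_mul Complex.I))
  have h2 := ((hn.const_mul (A 1 1 : ℂ)).add ((hp.const_mul (A 1 0 : ℂ)).const_mul Complex.I))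
  have h0 := bottom_row_add_ne_zero A
  refine (h1.div h2 (by simpa using h0)).congr_deriv ?_
  simp
  field_simp
  ring

/-- By the chain rule the flow derivative is half the sum of the raised and the lowered function,
each accompanied by the phase of its own weight. -/
lemma hasFlowDeriv_of_weight {m : ℤ} {φ φ' : G → ℂ} (hs : IsSmooth φ) (hw : HasWeight m φ)
    (hd : HasFlowDeriv φ φ') (A : SL(2, ℝ)) :
    φ' (toG A) = phase A ^ (m + 1) * (raiseOp m (coordFun φ) (moebiusPt A) / 2) +
      phase A ^ (m - 1) * (lowerOp m (coordFun φ) (moebiusPt A) / 2) := by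
  refine (hd (toG A)).unique ?_
  have e : (fun t => φ (toG A * expElt t)) = fun t => phase (A * expMat t) ^ m *
      coordFun φ (moebiusPt (A * expMat t)) := by
    funext t
    rw [expElt, ← toG_mul, hw.apply_toG]; rfl
  rw [e]
  have hA0 : A * expMat 0 = A := by rw [expMat_zero, mul_one]
  have hu : HasFDerivAt (coordFun φ) (fderiv ℝ (coordFun φ) (moebiusPt A)) (moebiusPt (A * expMat 0)) := by
    rw [hA0]
    exact (((hs.contDiffOn_coordFun).differentiableOn (by simp)).differentiableAt
      (isOpen_halfPlane.mem_nhds (moebiusPt_pos A))).hasFDerivAt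
  have h1 := hu.comp_hasDerivAt (0 : ℝ) (hasDerivAt_moebiusPt A)
  have h2 := (hasDerivAt_zpow m (phase (A * expMat 0)) (Or.inl (phase_ne_zero _))).comp (0 : ℝ)
    (hasDerivAt_phase A)
  refine (h2.mul h1).congr_deriv ?_
  simp only [Function.comp, hA0]
  have hp := phase_ne_zero A
  have hr := (bottom_row_pos A).ne'
  have hrm := bottom_row_mul A
  have hs0 := bottom_row_sub_ne_zero A
  have ha0 := bottom_row_add_ne_zero A
  set L := fderiv ℝ (coordFun φ) (moebiusPt A)
  have hlin : ∀ s t : ℝ, L (s, t) = s * L (1, 0) + t * L (0, 1) := by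
    intro s t
    have : ((s, t) : ℝ × ℝ) = s • (1, 0) + t • (0, 1) := by simp
    rw [this, map_add, map_smul, map_smul, Complex.real_smul, Complex.real_smul]
  rw [hlin, zpow_add₀ hp, zpow_sub₀ hp, zpow_one, raiseOp, lowerOp]
  have hy : ((moebiusPt A).2 : ℂ) = 1 / (((A 1 1 : ℂ) - Complex.I * A 1 0) *
    ((A 1 1 : ℂ) + Complex.I * A 1 0)) := by
    rw [hrm]; simp [moebiusPt]
  have hc1 : ((2 * A 1 0 * A 1 1 / (A 1 0 ^ 2 + A 1 1 ^ 2) ^ 2 : ℝ) : ℂ) =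
      (2 * A 1 0 * A 1 1) / (((A 1 1 : ℂ) - Complex.I * A 1 0) *
    ((A 1 1 : ℂ) + Complex.I * A 1 0)) ^ 2 := by rw [hrm]; push_cast; rfl
  have hc2 : (((A 1 1 ^ 2 - A 1 0 ^ 2) / (A 1 0 ^ 2 + A 1 1 ^ 2) ^ 2 : ℝ) : ℂ) =
      (A 1 1 ^ 2 - A 1 0 ^ 2) / (((A 1 1 : ℂ) - Complex.I * A 1 0) *
    ((A 1 1 : ℂ) + Complex.I * A 1 0)) ^ 2 := by rw [hrm]; push_cast; rfl
  rw [hy, hc1, hc2]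
  set P := phase A ^ m
  have hph : phase A = ((A 1 1 : ℂ) - Complex.I * A 1 0) / ((A 1 1 : ℂ) + Complex.I * A 1 0) := rfl
  rw [hph]
  -- In terms of the forms $w=d-ic$ and $w'=d+ic$ one has $y=1/(ww')$ and phase $w/w'$, and the
  -- claim becomes a rational identity.
  set w := (A 1 1 : ℂ) - Complex.I * A 1 0 with hwdef
  set w' := (A 1 1 : ℂ) + Complex.I * A 1 0 with hwdef'
  have hA11 : (A 1 1 : ℂ) = (w + w') / 2 := by rw [hwdef, hwdef']; ring
  have hA10 : (A 1 0 : ℂ) = Complex.I * (w - w') / 2 := by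
    rw [hwdef, hwdef']; linear_combination (A 1 0 : ℂ) * Complex.I_sq
  rw [hA11, hA10]
  field_simp
  ring_nf
  simp only [Complex.I_sq]
  ring

end Coordinates

/-! ### Raising, lowering and the Casimir operator -/

section Casimir

lemma hasWeight_of_coord {k : ℤ} {a : G → ℂ} {v : ℝ × ℝ → ℂ}
    (h : ∀ A, a (toG A) = phase A ^ k * v (moebiusPt A)) : HasWeight k a := fun g θ => by
  obtain ⟨A, rfl⟩ := toG_surjective g
  rw [toG_mul_kMat, h, h, phase_mul_kMat, moebiusPt_mul_kMat, mul_zpow, ← Complex.exp_int_mul,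
    mul_assoc]
  congr 2
  ring

lemma coordFun_of_coord {k : ℤ} {a : G → ℂ} {v : ℝ × ℝ → ℂ}
    (h : ∀ A, a (toG A) = phase A ^ k * v (moebiusPt A)) {p : ℝ × ℝ} (hp : 0 < p.2) :
    coordFun a p = v p := by
  rw [coordFun, iwasawa_eq hp, kMat_zero, mul_one, h, phase_nMat_mul_aMat,
    moebiusPt_nMat_mul_aMat, one_zpow, one_mul]

section

variable {m : ℤ} {φ φ' : G → ℂ}

lemma upperPart_toG (hs : IsSmooth φ) (hw : HasWeight m φ) (hd : HasFlowDeriv φ φ') (A : SL(2, ℝ)) :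
    upperPart m φ' (toG A) =
      phase A ^ (m + 1) * (raiseOp m (coordFun φ) (moebiusPt A) / 2) := by
  have h1 : Complex.exp (-(m * Complex.I * Real.pi / 2)) *
      Complex.exp (2 * Complex.I * (Real.pi / 4 : ℝ)) ^ (m + 1) = Complex.I := by
    rw [← Complex.exp_int_mul, ← Complex.exp_add]
    refine Eq.trans ?_ Complex.exp_pi_div_two_mul_I
    congr 1
    push_cast
    ring
  have h2 : Complex.exp (-(m * Complex.I * Real.pi / 2)) *
      Complex.exp (2 * Complex.I * (Real.pi / 4 : ℝ)) ^ (m - 1) = -Complex.I := by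
    rw [← Complex.exp_int_mul, ← Complex.exp_add, ← Complex.exp_neg_pi_div_two_mul_I]
    congr 1
    push_cast
    ring
  rw [upperPart, toG_mul_kMat, hasFlowDeriv_of_weight hs hw hd, hasFlowDeriv_of_weight hs hw hd,
    phase_mul_kMat, moebiusPt_mul_kMat, mul_zpow, mul_zpow]
  linear_combination (-Complex.I / 2) * phase A ^ (m + 1) * (raiseOp m (coordFun φ) (moebiusPt A) / 2)
    * h1 - (Complex.I / 2) * phase A ^ (m - 1) * (lowerOp m (coordFun φ) (moebiusPt A) / 2) * h2 +
    (phase A ^ (m - 1) * (lowerOp m (coordFun φ) (moebiusPt A) / 2) -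
      phase A ^ (m + 1) * (raiseOp m (coordFun φ) (moebiusPt A) / 2)) / 2 * Complex.I_sq

lemma lowerPart_toG (hs : IsSmooth φ) (hw : HasWeight m φ) (hd : HasFlowDeriv φ φ') (A : SL(2, ℝ)) :
    lowerPart m φ' (toG A) =
      phase A ^ (m - 1) * (lowerOp m (coordFun φ) (moebiusPt A) / 2) := by
  have h := upperPart_add_lowerPart m φ' (toG A)
  rw [upperPart_toG hs hw hd, hasFlowDeriv_of_weight hs hw hd] at h
  exact add_left_cancel h

lemma HasWeight.upperPart (hs : IsSmooth φ) (hw : HasWeight m φ) (hd : HasFlowDeriv φ φ') :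
    HasWeight (m + 1) (upperPart m φ') :=
  hasWeight_of_coord (v := fun p => raiseOp m (coordFun φ) p / 2) (upperPart_toG hs hw hd)

lemma HasWeight.lowerPart (hs : IsSmooth φ) (hw : HasWeight m φ) (hd : HasFlowDeriv φ φ') :
    HasWeight (m - 1) (lowerPart m φ') :=
  hasWeight_of_coord (v := fun p => lowerOp m (coordFun φ) p / 2) (lowerPart_toG hs hw hd)

end

/-- The partial derivatives of a smooth function on the half plane. -/
lemma contDiffOn_partial {u : ℝ × ℝ → ℂ}
    (hu : ContDiffOn ℝ ((⊤ : ℕ∞) : WithTop ℕ∞) u {p | 0 < p.2}) (e : ℝ × ℝ) :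
    ContDiffOn ℝ ((⊤ : ℕ∞) : WithTop ℕ∞) (fun p => fderiv ℝ u p e) {p | 0 < p.2} :=
  (hu.fderiv_of_isOpen isOpen_halfPlane (by simp)).clm_apply contDiffOn_const

lemma hasFDerivAt_of_smooth {u : ℝ × ℝ → ℂ}
    (hu : ContDiffOn ℝ ((⊤ : ℕ∞) : WithTop ℕ∞) u {p | 0 < p.2}) {p : ℝ × ℝ} (hp : 0 < p.2) :
    HasFDerivAt u (fderiv ℝ u p) p :=
  ((hu.differentiableOn (by simp)).differentiableAt (isOpen_halfPlane.mem_nhds hp)).hasFDerivAt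

lemma hasDerivAt_fst_of_smooth {u : ℝ × ℝ → ℂ}
    (hu : ContDiffOn ℝ ((⊤ : ℕ∞) : WithTop ℕ∞) u {p | 0 < p.2}) {p : ℝ × ℝ} (hp : 0 < p.2) :
    HasDerivAt (fun x => u (x, p.2)) (fderiv ℝ u p (1, 0)) p.1 :=
  (hasFDerivAt_of_smooth hu hp).comp_hasDerivAt p.1
    ((hasDerivAt_id p.1).prodMk (hasDerivAt_const p.1 p.2))

lemma hasDerivAt_snd_of_smooth {u : ℝ × ℝ → ℂ}
    (hu : ContDiffOn ℝ ((⊤ : ℕ∞) : WithTop ℕ∞) u {p | 0 < p.2}) {p : ℝ × ℝ} (hp : 0 < p.2) :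
    HasDerivAt (fun y => u (p.1, y)) (fderiv ℝ u p (0, 1)) p.2 :=
  (hasFDerivAt_of_smooth hu hp).comp_hasDerivAt p.2
    ((hasDerivAt_const p.2 p.1).prodMk (hasDerivAt_id p.2))

lemma partial_comm {u : ℝ × ℝ → ℂ}
    (hu : ContDiffOn ℝ ((⊤ : ℕ∞) : WithTop ℕ∞) u {p | 0 < p.2}) {p : ℝ × ℝ} (hp : 0 < p.2)
    (e e' : ℝ × ℝ) :
    fderiv ℝ (fun q => fderiv ℝ u q e) p e' = fderiv ℝ (fun q => fderiv ℝ u q e') p e := by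
  have h := (hu.contDiffAt (isOpen_halfPlane.mem_nhds hp)).isSymmSndFDerivAt (n := ((⊤ : ℕ∞) : WithTop ℕ∞))
    (by simpa using WithTop.coe_le_coe.2 (le_top (a := (2 : ℕ∞))))
  have hd : DifferentiableAt ℝ (fderiv ℝ u) p :=
    ((hu.fderiv_of_isOpen isOpen_halfPlane (m := ((⊤ : ℕ∞) : WithTop ℕ∞)) (by simp)).differentiableOn (by simp)).differentiableAt
      (isOpen_halfPlane.mem_nhds hp)
  rw [fderiv_clm_apply hd (by fun_prop), fderiv_clm_apply hd (by fun_prop)]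
  simpa using h e' e

/-- By symmetry of the mixed partials the cross terms cancel. Up to an additive constant and a
factor, what remains is the Casimir operator in weight $m$. -/
lemma lowerOp_raiseOp (m : ℤ) {u v : ℝ × ℝ → ℂ}
    (hu : ContDiffOn ℝ ((⊤ : ℕ∞) : WithTop ℕ∞) u {p | 0 < p.2})
    (hv : ∀ p : ℝ × ℝ, 0 < p.2 → v p = raiseOp m u p / 2) {p : ℝ × ℝ} (hp : 0 < p.2) :
    lowerOp (m + 1) v p = (p.2 ^ 2 * (fderiv ℝ (fun q => fderiv ℝ u q (1, 0)) p (1, 0) +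
      fderiv ℝ (fun q => fderiv ℝ u q (0, 1)) p (0, 1)) -
      2 * Complex.I * m * p.2 * fderiv ℝ u p (1, 0) - m * (m + 1) * u p) / 2 := by
  have hev : v =ᶠ[𝓝 p] fun q => raiseOp m u q / 2 :=
    Filter.eventuallyEq_of_mem (isOpen_halfPlane.mem_nhds hp) hv
  have hy : HasFDerivAt (fun q : ℝ × ℝ => (q.2 : ℂ))
      (Complex.ofRealCLM.comp (ContinuousLinearMap.snd ℝ ℝ ℝ)) p :=
    Complex.ofRealCLM.hasFDerivAt.comp p hasFDerivAt_snd
  have h1 := hasFDerivAt_of_smooth (contDiffOn_partial hu (1, 0)) hp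
  have h2 := hasFDerivAt_of_smooth (contDiffOn_partial hu (0, 1)) hp
  have h0 := hasFDerivAt_of_smooth hu hp
  have hd := ((((hy.const_mul Complex.I).mul h1).add (hy.mul h2)).add
    (h0.const_mul (m : ℂ))).mul_const (2⁻¹ : ℂ)
  have hd' := hd.congr_of_eventuallyEq (f₁ := v) (hev.trans (Eventually.of_forall fun q => by
    simp [raiseOp, div_eq_mul_inv]))
  have hc := partial_comm hu hp (1, 0) (0, 1)
  rw [lowerOp, hd'.fderiv, hv p hp, raiseOp]
  simp
  rw [hc]
  linear_combination (-1 / 2 : ℂ) * p.2 ^ 2 * fderiv ℝ (fun p => fderiv ℝ u p (1, 0)) p (1, 0) * Complex.I_sq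

lemma raiseOp_lowerOp (m : ℤ) {u v : ℝ × ℝ → ℂ}
    (hu : ContDiffOn ℝ ((⊤ : ℕ∞) : WithTop ℕ∞) u {p | 0 < p.2})
    (hv : ∀ p : ℝ × ℝ, 0 < p.2 → v p = lowerOp m u p / 2) {p : ℝ × ℝ} (hp : 0 < p.2) :
    raiseOp (m - 1) v p = (p.2 ^ 2 * (fderiv ℝ (fun q => fderiv ℝ u q (1, 0)) p (1, 0) +
      fderiv ℝ (fun q => fderiv ℝ u q (0, 1)) p (0, 1)) -
      2 * Complex.I * m * p.2 * fderiv ℝ u p (1, 0) - m * (m - 1) * u p) / 2 := by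
  have hev : v =ᶠ[𝓝 p] fun q => lowerOp m u q / 2 :=
    Filter.eventuallyEq_of_mem (isOpen_halfPlane.mem_nhds hp) hv
  have hy : HasFDerivAt (fun q : ℝ × ℝ => (q.2 : ℂ))
      (Complex.ofRealCLM.comp (ContinuousLinearMap.snd ℝ ℝ ℝ)) p :=
    Complex.ofRealCLM.hasFDerivAt.comp p hasFDerivAt_snd
  have h1 := hasFDerivAt_of_smooth (contDiffOn_partial hu (1, 0)) hp
  have h2 := hasFDerivAt_of_smooth (contDiffOn_partial hu (0, 1)) hp
  have h0 := hasFDerivAt_of_smooth hu hp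
  have hd := ((((hy.const_mul (-Complex.I)).mul h1).add (hy.mul h2)).sub
    (h0.const_mul (m : ℂ))).mul_const (2⁻¹ : ℂ)
  have hd' := hd.congr_of_eventuallyEq (f₁ := v) (hev.trans (Eventually.of_forall fun q => by
    simp [lowerOp, div_eq_mul_inv]))
  have hc := partial_comm hu hp (1, 0) (0, 1)
  rw [raiseOp, hd'.fderiv, hv p hp, lowerOp]
  simp
  rw [hc]
  linear_combination (-1 / 2 : ℂ) * p.2 ^ 2 * fderiv ℝ (fun p => fderiv ℝ u p (1, 0)) p (1, 0) * Complex.I_sq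


/-- In weight $m$ the derivative $\partial_\theta$ acts by $2mi$, so the Casimir operator becomes a
differential operator on the half plane. -/
lemma casimir_of_weight {m : ℤ} {φ : G → ℂ} (hs : IsSmooth φ) (hw : HasWeight m φ) {p : ℝ × ℝ}
    (hp : 0 < p.2) : casimir φ p.1 p.2 0 =
      -(p.2 ^ 2 * (fderiv ℝ (fun q => fderiv ℝ (coordFun φ) q (1, 0)) p (1, 0) +
      fderiv ℝ (fun q => fderiv ℝ (coordFun φ) q (0, 1)) p (0, 1)) -
      2 * Complex.I * m * p.2 * fderiv ℝ (coordFun φ) p (1, 0)) := by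
  have hu := hs.contDiffOn_coordFun
  set u := coordFun φ with hudef
  have hux := contDiffOn_partial hu (1, 0)
  have huy := contDiffOn_partial hu (0, 1)
  have h1 : iteratedDeriv 2 (fun x' => φ (iwasawa x' p.2 0)) p.1 =
      fderiv ℝ (fun q => fderiv ℝ u q (1, 0)) p (1, 0) := by
    rw [iteratedDeriv_succ, iteratedDeriv_one]
    have : deriv (fun x' => φ (iwasawa x' p.2 0)) = fun x' => fderiv ℝ u (x', p.2) (1, 0) :=
      funext fun x' => (hasDerivAt_fst_of_smooth hu (p := (x', p.2)) hp).deriv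
    rw [this]
    exact (hasDerivAt_fst_of_smooth hux hp).deriv
  have h2 : iteratedDeriv 2 (fun y' => φ (iwasawa p.1 y' 0)) p.2 =
      fderiv ℝ (fun q => fderiv ℝ u q (0, 1)) p (0, 1) := by
    rw [iteratedDeriv_succ, iteratedDeriv_one]
    have : deriv (fun y' => φ (iwasawa p.1 y' 0)) =ᶠ[𝓝 p.2]
        fun y' => fderiv ℝ u (p.1, y') (0, 1) := by
      filter_upwards [lt_mem_nhds hp] with y' hy'
      exact (hasDerivAt_snd_of_smooth hu (p := (p.1, y')) hy').deriv
    rw [this.deriv_eq]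
    exact (hasDerivAt_snd_of_smooth huy hp).deriv
  have h3 : deriv (fun x' => deriv (fun θ' => φ (iwasawa x' p.2 θ')) 0) p.1 =
      2 * m * Complex.I * fderiv ℝ u p (1, 0) := by
    have : (fun x' => deriv (fun θ' => φ (iwasawa x' p.2 θ')) 0) =
        fun x' => 2 * m * Complex.I * u (x', p.2) := by
      funext x'
      have e : (fun θ' => φ (iwasawa x' p.2 θ')) =
          fun θ' : ℝ => Complex.exp (2 * m * Complex.I * θ') * u (x', p.2) := by
        funext θ'
        have : iwasawa x' p.2 θ' = iwasawa x' p.2 0 * kElt θ' := by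
          simp only [iwasawa, kElt_zero, mul_one]
        rw [this, hw]; rfl
      rw [e]
      have hd : HasDerivAt (fun θ' : ℝ => (2 * m * Complex.I * θ' : ℂ)) (2 * m * Complex.I) 0 := by
        simpa using (Complex.ofRealCLM.hasDerivAt (x := (0 : ℝ))).const_mul (2 * m * Complex.I : ℂ)
      simpa using (hd.cexp.mul_const (u (x', p.2))).deriv
    rw [this]
    exact ((hasDerivAt_fst_of_smooth hu hp).const_mul _).deriv
  rw [casimir, h1, h2, h3]
  ring

section

variable {m : ℤ} {φ φ' : G → ℂ} {c : ℂ}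

/-- Lowering after raising multiplies an eigenfunction of the Casimir operator by a scalar. -/
lemma lowerPart_upperPart {p' : G → ℂ} (hs : IsSmooth φ) (hw : HasWeight m φ)
    (hd : HasFlowDeriv φ φ') (hs' : IsSmooth (upperPart m φ'))
    (hd' : HasFlowDeriv (upperPart m φ') p')
    (hc : ∀ x y θ : ℝ, 0 < y → casimir φ x y θ = c * φ (iwasawa x y θ)) (g : G) :
    lowerPart (m + 1) p' g = -(c + m * (m + 1)) / 4 * φ g := by
  obtain ⟨A, rfl⟩ := toG_surjective g
  have hp := moebiusPt_pos A
  have hv : ∀ p : ℝ × ℝ, 0 < p.2 → coordFun (upperPart m φ') p = raiseOp m (coordFun φ) p / 2 :=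
    fun p hp => coordFun_of_coord (v := fun p => raiseOp m (coordFun φ) p / 2)
      (upperPart_toG hs hw hd) hp
  have h := hc (moebiusPt A).1 (moebiusPt A).2 0 hp
  rw [casimir_of_weight hs hw hp] at h
  rw [lowerPart_toG hs' (hw.upperPart hs hd) hd', lowerOp_raiseOp m hs.contDiffOn_coordFun hv hp,
    hw.apply_toG, add_sub_cancel_right, coordFun]
  linear_combination (-1 / 4 : ℂ) * phase A ^ m * h

/-- Raising after lowering multiplies an eigenfunction of the Casimir operator by a scalar. -/
lemma upperPart_lowerPart {p' : G → ℂ} (hs : IsSmooth φ) (hw : HasWeight m φ)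
    (hd : HasFlowDeriv φ φ') (hs' : IsSmooth (lowerPart m φ'))
    (hd' : HasFlowDeriv (lowerPart m φ') p')
    (hc : ∀ x y θ : ℝ, 0 < y → casimir φ x y θ = c * φ (iwasawa x y θ)) (g : G) :
    upperPart (m - 1) p' g = -(c + m * (m - 1)) / 4 * φ g := by
  obtain ⟨A, rfl⟩ := toG_surjective g
  have hp := moebiusPt_pos A
  have hv : ∀ p : ℝ × ℝ, 0 < p.2 → coordFun (lowerPart m φ') p = lowerOp m (coordFun φ) p / 2 :=
    fun p hp => coordFun_of_coord (v := fun p => lowerOp m (coordFun φ) p / 2)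
      (lowerPart_toG hs hw hd) hp
  have h := hc (moebiusPt A).1 (moebiusPt A).2 0 hp
  rw [casimir_of_weight hs hw hp] at h
  rw [upperPart_toG hs' (hw.lowerPart hs hd) hd', raiseOp_lowerOp m hs.contDiffOn_coordFun hv hp,
    hw.apply_toG, sub_add_cancel, coordFun]
  linear_combination (-1 / 4 : ℂ) * phase A ^ m * h

end

end Casimir

/-! ### Test functions on the space of matrices -/

instance : MeasurableSpace SL(2, ℝ) := borel SL(2, ℝ)

instance : BorelSpace SL(2, ℝ) := ⟨rfl⟩

/-- The normed space of real `2 × 2` matrices. -/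
abbrev MatSpace : Type := Fin 2 → Fin 2 → ℝ

/-- The entries of a matrix of determinant one. -/
def entries (A : SL(2, ℝ)) : MatSpace := fun i j => A i j

/-- The product of matrices. -/
def lmul (M t : MatSpace) : MatSpace := fun i j => M i 0 * t 0 j + M i 1 * t 1 j

lemma entries_mul (A B : SL(2, ℝ)) : entries (A * B) = lmul (entries A) (entries B) := by
  funext i j
  exact SL_mul_apply A B i j

/-- Test functions live on the linear space of matrices, where ordinary smoothness makes sense;
closedness of the embedding keeps their restrictions to the group compactly supported. -/
lemma isClosedEmbedding_entries : IsClosedEmbedding entries := isClosedEmbedding_val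

lemma lmul_lmul (M N t : MatSpace) : lmul M (lmul N t) = lmul (lmul M N) t := by
  funext i j
  simp only [lmul]
  ring

lemma lmul_entries_one (t : MatSpace) : lmul (entries 1) t = t := by
  funext i j
  fin_cases i <;> simp [lmul, entries, SL_one_apply]

lemma lmul_entries_inv_cancel (A : SL(2, ℝ)) (t : MatSpace) :
    lmul (entries A) (lmul (entries A⁻¹) t) = t := by
  rw [lmul_lmul, ← entries_mul, mul_inv_cancel, lmul_entries_one]

lemma contDiff_lmul : ContDiff ℝ ((⊤ : ℕ∞) : WithTop ℕ∞) fun p : MatSpace × MatSpace => lmul p.1 p.2 := by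
  refine contDiff_pi.2 fun i => contDiff_pi.2 fun j => ?_
  simp only [lmul]
  fun_prop

lemma continuous_lmul : Continuous fun p : MatSpace × MatSpace => lmul p.1 p.2 :=
  contDiff_lmul.continuous

/-- A smooth compactly supported function on the space of matrices. -/
structure IsTest (κ : MatSpace → ℂ) : Prop where
  contDiff : ContDiff ℝ ((⊤ : ℕ∞) : WithTop ℕ∞) κ
  hasCompactSupport : HasCompactSupport κ

lemma IsTest.continuous_comp {κ : MatSpace → ℂ} (h : IsTest κ) : Continuous fun B => κ (entries B) :=
  h.contDiff.continuous.comp isClosedEmbedding_entries.continuous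

lemma IsTest.hasCompactSupport_comp {κ : MatSpace → ℂ} (h : IsTest κ) :
    HasCompactSupport fun B => κ (entries B) :=
  h.hasCompactSupport.comp_isClosedEmbedding isClosedEmbedding_entries

lemma IsTest.add {κ κ' : MatSpace → ℂ} (h : IsTest κ) (h' : IsTest κ') :
    IsTest fun t => κ t + κ' t :=
  ⟨h.contDiff.add h'.contDiff, h.hasCompactSupport.add h'.hasCompactSupport⟩

lemma IsTest.const_mul {κ : MatSpace → ℂ} (h : IsTest κ) (c : ℂ) : IsTest fun t => c * κ t :=
  ⟨contDiff_const.mul h.contDiff, h.hasCompactSupport.mul_left⟩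

lemma IsTest.comp_lmul {κ : MatSpace → ℂ} (h : IsTest κ) (A : SL(2, ℝ)) :
    IsTest fun t => κ (lmul (entries A) t) := by
  have hc : ContDiff ℝ ((⊤ : ℕ∞) : WithTop ℕ∞) (lmul (entries A)) :=
    contDiff_lmul.comp (contDiff_const.prodMk contDiff_id)
  refine ⟨h.contDiff.comp hc, ?_⟩
  have hc' : Continuous (lmul (entries A⁻¹)) := continuous_lmul.comp (Continuous.prodMk_right _)
  refine HasCompactSupport.intro (h.hasCompactSupport.isCompact.image hc') fun t ht => ?_
  by_contra h0
  refine ht ⟨lmul (entries A) t, subset_tsupport κ h0, ?_⟩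
  simpa using lmul_entries_inv_cancel A⁻¹ t

/-- The derivative of a function on matrices along left multiplication by `a_{e^{-t}}`. -/
def flowDerivTest (κ : MatSpace → ℂ) (t : MatSpace) : ℂ :=
  fderiv ℝ κ t fun i j => (if i = 0 then -(1 / 2) else 1 / 2) * t i j

lemma IsTest.flowDerivTest {κ : MatSpace → ℂ} (h : IsTest κ) : IsTest (flowDerivTest κ) := by
  refine ⟨?_, h.hasCompactSupport.fderiv ℝ |>.mono fun t ht h0 => ht ?_⟩
  · refine (h.contDiff.fderiv_right (by simp)).clm_apply ?_
    refine contDiff_pi.2 fun i => contDiff_pi.2 fun j => ?_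
    fun_prop
  · simp only [BaseRep.flowDerivTest]
    rw [h0]; rfl

lemma hasDerivAt_lmul_expMat {κ : MatSpace → ℂ} (h : IsTest κ) (x : MatSpace) (t : ℝ) :
    HasDerivAt (fun t => κ (lmul (entries (expMat (-t))) x))
      (flowDerivTest κ (lmul (entries (expMat (-t))) x)) t := by
  have hp : HasDerivAt (fun t : ℝ => Real.exp (-t / 2)) (Real.exp (-t / 2) * (-1 / 2)) t :=
    ((hasDerivAt_neg t).div_const 2).exp
  have hn : HasDerivAt (fun t : ℝ => Real.exp (-(-t / 2))) (Real.exp (-(-t / 2)) * -(-1 / 2)) t :=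
    (((hasDerivAt_neg t).div_const 2).neg).exp
  have hd : HasDerivAt (fun t => lmul (entries (expMat (-t))) x)
      (fun i j => (if i = 0 then -(1 / 2) else 1 / 2) * lmul (entries (expMat (-t))) x i j) t := by
    refine hasDerivAt_pi.2 fun i => hasDerivAt_pi.2 fun j => ?_
    fin_cases i
    · refine ((hp.mul_const (x 0 j)).congr_deriv ?_).congr_of_eventuallyEq
        (Eventually.of_forall fun s => ?_)
      · simp [lmul, entries]; ring
      · simp [lmul, entries]
    · refine ((hn.mul_const (x 1 j)).congr_deriv ?_).congr_of_eventuallyEq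
        (Eventually.of_forall fun s => ?_)
      · simp [lmul, entries]; ring
      · simp [lmul, entries]
  exact ((h.contDiff.differentiable (by simp)) _).hasFDerivAt.comp_hasDerivAt t hd

/-- Smoothness of an integral of a test function depending on a parameter. -/
lemma contDiffOn_integral_test {P : Type*} [NormedAddCommGroup P] [NormedSpace ℝ P]
    [LocallyCompactSpace P] {s : Set P} (hs : IsOpen s) {N M : P → MatSpace}
    (hN : ContDiffOn ℝ ((⊤ : ℕ∞) : WithTop ℕ∞) N s) (hM : ContinuousOn M s)
    (hMN : ∀ p ∈ s, ∀ t, lmul (M p) (lmul (N p) t) = t) {κ : MatSpace → ℂ} (h : IsTest κ)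
    {ρ : Measure MatSpace} {F : MatSpace → ℂ} (hF : LocallyIntegrable F ρ) :
    ContDiffOn ℝ ((⊤ : ℕ∞) : WithTop ℕ∞) (fun p => ∫ t, F t * κ (lmul (N p) t) ∂ρ) s := by
  refine contDiffOn_of_locally_contDiffOn fun p₀ hp₀ => ?_
  obtain ⟨K, hK, hpK, hKs⟩ := exists_compact_subset hs hp₀
  refine ⟨interior K, isOpen_interior, hpK, ?_⟩
  have hsub : interior K ⊆ s := interior_subset.trans hKs
  -- A compact set containing the supports of all the parameter-dependent kernels for parameters in
  -- $K$. The integral is the value at $0$ of a convolution with these kernels, which explains the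
  -- signs.
  set k : Set MatSpace := (fun q : P × MatSpace => -lmul (M q.1) q.2) '' (K ×ˢ tsupport κ)
  have hk : IsCompact k := by
    refine (hK.prod h.hasCompactSupport.isCompact).image_of_continuousOn ?_
    refine (continuous_lmul.comp_continuousOn (ContinuousOn.prodMk ?_ continuousOn_snd)).neg
    exact (hM.mono hKs).comp continuousOn_fst fun q hq => hq.1
  have key := contDiffOn_convolution_right_with_param (n := ⊤) (ContinuousLinearMap.mul ℝ ℂ)
    (f := F) (μ := ρ) (g := fun p t => κ (lmul (N p) (-t))) (s := interior K) (k := k)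
    isOpen_interior hk ?_ hF ?_
  · have := key.comp (contDiffOn_id.prodMk (contDiffOn_const (c := (0 : MatSpace))))
      (s := interior K) fun p hp => ⟨hp, Set.mem_univ _⟩
    refine (this.mono Set.inter_subset_right).congr fun p _ => ?_
    simp [convolution]
  · intro p x hp hx
    by_contra h0
    refine hx ⟨(p, lmul (N p) (-x)), ⟨interior_subset hp, subset_tsupport κ h0⟩, ?_⟩
    simp only
    rw [hMN p (hsub hp), neg_neg]
  · refine h.contDiff.comp_contDiffOn (contDiff_lmul.comp_contDiffOn (ContDiffOn.prodMk ?_ ?_))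
    · exact (hN.mono hsub).comp contDiffOn_fst fun q hq => hq.1
    · exact contDiffOn_snd.neg

/-! ### Local integrability of lifts -/

section Lift

variable {Γ : Subgroup G}

/-- The Haar measure of `SL₂(ℝ)`. -/
def haarSL : Measure SL(2, ℝ) := Measure.haar

instance : haarSL.IsHaarMeasure := inferInstanceAs (Measure.IsHaarMeasure Measure.haar)

/-- The image of Haar measure on $\mathrm{SL}_2(\mathbb R)$ is left invariant and locally finite,
hence a multiple of $\mu$. Null sets and local integrability can thus be transferred between the two
groups. -/
instance : (haarSL.map toG).IsMulLeftInvariant :=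
  isMulLeftInvariant_map (QuotientGroup.mk' (Subgroup.center SL(2, ℝ))).toMulHom
    continuous_toG.measurable toG_surjective

instance : IsLocallyFiniteMeasure (haarSL.map toG) := by
  refine ⟨fun g => ?_⟩
  obtain ⟨A, rfl⟩ := toG_surjective g
  obtain ⟨C, hC, hA⟩ := exists_compact_mem_nhds A
  refine ⟨toG '' interior C, ?_, ?_⟩
  · exact (isOpenMap_toG _ isOpen_interior).mem_nhds ⟨A, mem_interior_iff_mem_nhds.2 hA, rfl⟩
  · rw [Measure.map_apply continuous_toG.measurable (isOpenMap_toG _ isOpen_interior).measurableSet]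
    have hsub : toG ⁻¹' (toG '' interior C) ⊆ C ∪ (fun B => -1 * B) '' C := by
      rintro B ⟨B', hB', e⟩
      rcases toG_eq_iff.1 e with h | h
      · exact Or.inl (h ▸ interior_subset hB')
      · exact Or.inr ⟨B', interior_subset hB', by simp [h]⟩
    refine lt_of_le_of_lt (measure_mono hsub) ?_
    exact (hC.union (hC.image (continuous_const_mul _))).measure_lt_top

lemma map_toG_eq_smul (μ : Measure G) [μ.IsHaarMeasure] :
    haarSL.map toG = Measure.haarScalarFactor (haarSL.map toG) μ • μ :=
  Measure.isMulLeftInvariant_eq_smul _ μ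

lemma map_toG_absolutelyContinuous (μ : Measure G) [μ.IsHaarMeasure] : haarSL.map toG ≪ μ := by
  rw [map_toG_eq_smul μ]
  exact Measure.smul_absolutelyContinuous

lemma ae_haarSL_of_ae (μ : Measure G) [μ.IsHaarMeasure] {p : G → Prop} (h : ∀ᵐ g ∂μ, p g) (g : G) :
    ∀ᵐ B ∂haarSL, p (g * toG B) := by
  have h1 : ∀ᵐ x ∂μ, p (g * x) := (measurePreserving_mul_left μ g).quasiMeasurePreserving.ae h
  exact ae_of_ae_map continuous_toG.aemeasurable ((map_toG_absolutelyContinuous μ).ae_le h1)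

variable [DiscreteTopology Γ]

/-- On a wandering neighbourhood the lift is square integrable, because integrals there are
dominated by integrals over the quotient; square integrable functions are integrable on sets of
finite measure. -/
lemma locallyIntegrable_comp_proj (μ : Measure G) [μ.IsHaarMeasure] {μX : Measure (LeftQuotient Γ)}
    [QuotientMeasureEqMeasurePreimage μ μX] (f : Lp ℂ 2 μX) :
    LocallyIntegrable (fun g => f (proj Γ g)) μ := by
  intro g
  obtain ⟨U, hU, hgU, hw⟩ := exists_isWandering (Γ := Γ) g
  obtain ⟨C, hC, hCg⟩ := exists_compact_mem_nhds g
  refine ⟨U ∩ C, inter_mem (hU.mem_nhds hgU) hCg, ?_⟩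
  have hsm : StronglyMeasurable f := Lp.stronglyMeasurable f
  have hm : StronglyMeasurable fun g => f (proj Γ g) := hsm.comp_measurable (measurable_proj Γ)
  have hfin : IsFiniteMeasure (μ.restrict (U ∩ C)) := by
    refine ⟨?_⟩
    rw [Measure.restrict_apply_univ]
    exact lt_of_le_of_lt (measure_mono Set.inter_subset_right) hC.measure_lt_top
  have h2 : MemLp (fun g => f (proj Γ g)) 2 (μ.restrict (U ∩ C)) := by
    refine ⟨hm.aestronglyMeasurable, ?_⟩
    rw [eLpNorm_lt_top_iff_lintegral_rpow_enorm_lt_top two_ne_zero ENNReal.ofNat_ne_top]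
    have h3 := (eLpNorm_lt_top_iff_lintegral_rpow_enorm_lt_top two_ne_zero ENNReal.ofNat_ne_top).1
      (Lp.memLp f).2
    refine lt_of_le_of_lt ((lintegral_mono_set Set.inter_subset_left).trans ?_) h3
    exact lintegral_wandering_le μ μX hU hw (F := fun x => ‖f x‖ₑ ^ (2 : ℝ≥0∞).toReal)
      (hsm.enorm.pow_const _)
  exact h2.integrable (by norm_num)

/-- The lifts of `f` to `SL₂(ℝ)` are locally integrable. -/
def HasIntegrableLifts (f : LeftQuotient Γ → ℂ) : Prop :=
  ∀ g : G, LocallyIntegrable (fun B : SL(2, ℝ) => f (proj Γ (g * toG B))) haarSL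

lemma hasIntegrableLifts (μ : Measure G) [μ.IsHaarMeasure] {μX : Measure (LeftQuotient Γ)}
    [QuotientMeasureEqMeasurePreimage μ μX] (f : Lp ℂ 2 μX) : HasIntegrableLifts f := by
  intro g
  have h1 : LocallyIntegrable (fun B : SL(2, ℝ) => f (proj Γ (toG B))) haarSL := by
    intro B
    obtain ⟨U, hU, hi⟩ := locallyIntegrable_comp_proj μ f (toG B)
    obtain ⟨O, hOU, hO, hBO⟩ := mem_nhds_iff.1 hU
    refine ⟨toG ⁻¹' O, (hO.preimage continuous_toG).mem_nhds hBO, ?_⟩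
    have h2 : Integrable (fun g => f (proj Γ g)) ((haarSL.map toG).restrict O) := by
      rw [map_toG_eq_smul μ, Measure.restrict_smul]
      exact (hi.mono_set hOU).smul_measure_nnreal
    rw [Measure.restrict_map continuous_toG.measurable hO.measurableSet] at h2
    exact (integrable_map_measure h2.aestronglyMeasurable continuous_toG.aemeasurable).1 h2
  obtain ⟨A, rfl⟩ := toG_surjective g
  have h2 : haarSL.map (Homeomorph.mulLeft A) = haarSL := map_mul_left_eq_self haarSL A
  rw [← h2, locallyIntegrable_map_homeomorph] at h1
  refine h1.congr (Eventually.of_forall fun B => ?_)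
  simp [toG_mul]

end Lift

lemma entries_inv (A : SL(2, ℝ)) : entries A⁻¹ =
    ![![entries A 1 1, -entries A 0 1], ![-entries A 1 0, entries A 0 0]] := by
  funext i j
  fin_cases i <;> fin_cases j <;>
    simp [entries, Matrix.SpecialLinearGroup.coe_inv, Matrix.adjugate_fin_two]

/-! ### Gårding vectors -/

section Garding

variable {Γ : Subgroup G}

/-- The average of the right translates of a function `f` on `Γ\G` by `κ`. -/
def garding (κ : MatSpace → ℂ) (f : LeftQuotient Γ → ℂ) (g : G) : ℂ :=
  ∫ B : SL(2, ℝ), κ (entries B) * f (proj Γ (g * toG B)) ∂haarSL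

lemma isLeftInvariant_garding (κ : MatSpace → ℂ) (f : LeftQuotient Γ → ℂ) :
    IsLeftInvariant Γ (garding κ f) := fun γ hγ g => by
  simp only [garding, mul_assoc, proj_mul hγ]

/-- Left invariance of Haar measure moves the translation onto the test function, so derivatives
fall on $\kappa$ and never on $f$. -/
lemma garding_mul_toG (κ : MatSpace → ℂ) (f : LeftQuotient Γ → ℂ) (g : G) (A : SL(2, ℝ)) :
    garding κ f (g * toG A) =
      ∫ B : SL(2, ℝ), κ (lmul (entries A⁻¹) (entries B)) * f (proj Γ (g * toG B)) ∂haarSL := by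
  rw [garding, ← integral_mul_left_eq_self (fun B : SL(2, ℝ) =>
    κ (lmul (entries A⁻¹) (entries B)) * f (proj Γ (g * toG B))) A]
  simp only [← entries_mul, inv_mul_cancel_left, toG_mul, mul_assoc]

lemma garding_mul_kElt (κ : MatSpace → ℂ) (f : LeftQuotient Γ → ℂ) (g : G) (θ : ℝ) :
    garding κ f (g * kElt θ) = garding (fun t => κ (lmul (entries (kMat θ)⁻¹) t)) f g :=
  garding_mul_toG κ f g (kMat θ)

lemma garding_const_mul (c : ℂ) (κ : MatSpace → ℂ) (f : LeftQuotient Γ → ℂ) (g : G) :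
    garding (fun t => c * κ t) f g = c * garding κ f g := by
  simp only [garding, mul_assoc, integral_const_mul]

variable {f : LeftQuotient Γ → ℂ}

lemma integrable_garding {κ : MatSpace → ℂ} (h : IsTest κ) (hf : HasIntegrableLifts f) (g : G) :
    Integrable (fun B : SL(2, ℝ) => κ (entries B) * f (proj Γ (g * toG B))) haarSL := by
  have h1 : LocallyIntegrable (fun B : SL(2, ℝ) => f (proj Γ (g * toG B))) haarSL := hf g
  have h2 := h1.integrable_smul_left_of_hasCompactSupport h.continuous_comp h.hasCompactSupport_comp
  exact h2

lemma garding_add {κ κ' : MatSpace → ℂ} (h : IsTest κ) (h' : IsTest κ')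
    (hf : HasIntegrableLifts f) (g : G) :
    garding (fun t => κ t + κ' t) f g = garding κ f g + garding κ' f g := by
  simp only [garding, add_mul]
  exact integral_add (integrable_garding h hf g) (integrable_garding h' hf g)

lemma hasFlowDeriv_garding {κ : MatSpace → ℂ} (h : IsTest κ) (hf : HasIntegrableLifts f) :
    HasFlowDeriv (garding κ f) (garding (flowDerivTest κ) f) := by
  intro g
  have e : (fun t => garding κ f (g * expElt t)) = fun t => ∫ B : SL(2, ℝ),
      κ (lmul (entries (expMat (-t))) (entries B)) * f (proj Γ (g * toG B)) ∂haarSL := by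
    funext t
    have : (expMat t)⁻¹ = expMat (-t) := by
      rw [inv_eq_iff_mul_eq_one, ← expMat_add, add_neg_cancel, expMat_zero]
    rw [expElt, garding_mul_toG, this]
  rw [e]
  have hl := hf g
  have hcE : ∀ t, Continuous fun B : SL(2, ℝ) => lmul (entries (expMat (-t))) (entries B) := fun t =>
    continuous_lmul.comp (continuous_const.prodMk isClosedEmbedding_entries.continuous)
  have hD := h.flowDerivTest
  obtain ⟨C, hC⟩ := hD.hasCompactSupport.exists_bound_of_continuous hD.contDiff.continuous
  -- For all $|t|<1$ the differentiated integrand is supported in this compact set, on which the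
  -- lift of $f$ is integrable.
  set K : Set SL(2, ℝ) := entries ⁻¹' ((fun q : ℝ × MatSpace => lmul (entries (expMat q.1)) q.2) ''
    (Set.Icc (-1) 1 ×ˢ tsupport (flowDerivTest κ))) with hK
  have hKc : IsCompact K := by
    refine isClosedEmbedding_entries.isCompact_preimage ?_
    refine (isCompact_Icc.prod hD.hasCompactSupport.isCompact).image ?_
    exact continuous_lmul.comp (((isClosedEmbedding_entries.continuous.comp continuous_expMat).comp
      continuous_fst).prodMk continuous_snd)
  have hbound : ∀ B : SL(2, ℝ), ∀ t ∈ Metric.ball (0 : ℝ) 1,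
      ‖flowDerivTest κ (lmul (entries (expMat (-t))) (entries B)) * f (proj Γ (g * toG B))‖ ≤
      C * K.indicator (fun B => ‖f (proj Γ (g * toG B))‖) B := by
    intro B t ht
    rw [norm_mul]
    by_cases hB : B ∈ K
    · rw [Set.indicator_of_mem hB]
      gcongr
      exact hC _
    · rw [Set.indicator_of_notMem hB, mul_zero]
      have : flowDerivTest κ (lmul (entries (expMat (-t))) (entries B)) = 0 := by
        by_contra h0
        refine hB ⟨(t, lmul (entries (expMat (-t))) (entries B)), ⟨?_, subset_tsupport _ h0⟩, ?_⟩
        · rw [Metric.mem_ball, dist_zero_right, Real.norm_eq_abs, abs_lt] at ht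
          exact ⟨ht.1.le, ht.2.le⟩
        · simp only
          rw [lmul_lmul, ← entries_mul, ← expMat_add, add_neg_cancel, expMat_zero,
            lmul_entries_one]
      rw [this, norm_zero, zero_mul]
  have key := hasDerivAt_integral_of_dominated_loc_of_deriv_le (μ := haarSL) (x₀ := (0 : ℝ))
    (s := Metric.ball 0 1)
    (F := fun t B => κ (lmul (entries (expMat (-t))) (entries B)) * f (proj Γ (g * toG B)))
    (F' := fun t B => flowDerivTest κ (lmul (entries (expMat (-t))) (entries B)) *
      f (proj Γ (g * toG B)))
    (bound := fun B => C * K.indicator (fun B => ‖f (proj Γ (g * toG B))‖) B)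
    (Metric.ball_mem_nhds _ one_pos)
    (Eventually.of_forall fun t => (h.contDiff.continuous.comp (hcE t)).aestronglyMeasurable.mul
      hl.aestronglyMeasurable) ?_
    ((hD.contDiff.continuous.comp (hcE 0)).aestronglyMeasurable.mul hl.aestronglyMeasurable)
    (Eventually.of_forall hbound) ?_
    (Eventually.of_forall fun B t _ => (hasDerivAt_lmul_expMat h (entries B) t).mul_const _)
  · refine key.2.congr_deriv ?_
    simp only [neg_zero, expMat_zero, lmul_entries_one]
    rfl
  · simp only [neg_zero, expMat_zero, lmul_entries_one]
    exact integrable_garding h hf g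
  · refine Integrable.const_mul ?_ C
    rw [integrable_indicator_iff hKc.measurableSet]
    exact (hl.integrableOn_isCompact hKc).norm

/-- The measure on matrix space is the image of Haar measure and is carried by the group, so the
extension by zero plays no role in the integrals. -/
lemma HasIntegrableLifts.locallyIntegrable_extend (hf : HasIntegrableLifts f) :
    LocallyIntegrable (Function.extend entries (fun B : SL(2, ℝ) => f (proj Γ (toG B)))
      (0 : MatSpace → ℂ)) (haarSL.map entries) := by
  have hl : LocallyIntegrable (fun B : SL(2, ℝ) => f (proj Γ (toG B))) haarSL := by
    simpa using hf 1
  intro t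
  obtain ⟨C, hC, hCt⟩ := exists_compact_mem_nhds t
  refine ⟨C, hCt, ?_⟩
  have hme := isClosedEmbedding_entries.measurableEmbedding
  rw [IntegrableOn, hme.restrict_map, hme.integrable_map_iff]
  refine ((hl.integrableOn_isCompact (isClosedEmbedding_entries.isCompact_preimage hC))).congr
    (Eventually.of_forall fun B => ?_)
  exact (isClosedEmbedding_entries.injective.extend_apply
    (fun B : SL(2, ℝ) => f (proj Γ (toG B))) (0 : MatSpace → ℂ) B).symm

lemma isSmooth_garding {κ : MatSpace → ℂ} (h : IsTest κ) (hf : HasIntegrableLifts f) :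
    IsSmooth (garding κ f) := by
  have hF := hf.locallyIntegrable_extend
  set H : SL(2, ℝ) → ℂ := fun B => f (proj Γ (toG B)) with hH
  set F : MatSpace → ℂ := Function.extend entries H 0
  set M : ℝ × ℝ × ℝ → MatSpace := fun p =>
    ![![√p.2.1 * Real.cos p.2.2 - p.1 * (√p.2.1)⁻¹ * Real.sin p.2.2,
        √p.2.1 * Real.sin p.2.2 + p.1 * (√p.2.1)⁻¹ * Real.cos p.2.2],
      ![-(√p.2.1)⁻¹ * Real.sin p.2.2, (√p.2.1)⁻¹ * Real.cos p.2.2]] with hM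
  -- The adjugate of $M$, which on the half space is its inverse because the determinant there is
  -- one.
  set N : ℝ × ℝ × ℝ → MatSpace := fun p => ![![M p 1 1, -M p 0 1], ![-M p 1 0, M p 0 0]] with hN
  set s : Set (ℝ × ℝ × ℝ) := {p | 0 < p.2.1} with hs
  have hMe : ∀ p : ℝ × ℝ × ℝ, ∀ hp : 0 < p.2.1, M p = entries (nMat p.1 * aMat p.2.1 hp * kMat p.2.2) := by
    intro p hp
    funext i j
    fin_cases i <;> fin_cases j <;> (simp [hM, entries, SL_mul_apply]; try ring)
  have hNe : ∀ p : ℝ × ℝ × ℝ, ∀ hp : 0 < p.2.1, N p = entries (nMat p.1 * aMat p.2.1 hp * kMat p.2.2)⁻¹ := by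
    intro p hp
    rw [entries_inv, ← hMe p hp]
  have hMs : ContDiffOn ℝ ((⊤ : ℕ∞) : WithTop ℕ∞) M s := by
    have h1 : ContDiffOn ℝ ((⊤ : ℕ∞) : WithTop ℕ∞) (fun p : ℝ × ℝ × ℝ => √p.2.1) s :=
      ContDiffOn.sqrt (by fun_prop) fun p hp => (show 0 < p.2.1 from hp).ne'
    have h2 : ContDiffOn ℝ ((⊤ : ℕ∞) : WithTop ℕ∞) (fun p : ℝ × ℝ × ℝ => (√p.2.1)⁻¹) s :=
      h1.inv fun p hp => (Real.sqrt_pos.2 hp).ne'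
    have h3 : ContDiffOn ℝ ((⊤ : ℕ∞) : WithTop ℕ∞) (fun p : ℝ × ℝ × ℝ => Real.cos p.2.2) s := by
      fun_prop
    have h4 : ContDiffOn ℝ ((⊤ : ℕ∞) : WithTop ℕ∞) (fun p : ℝ × ℝ × ℝ => Real.sin p.2.2) s := by
      fun_prop
    have h5 : ContDiffOn ℝ ((⊤ : ℕ∞) : WithTop ℕ∞) (fun p : ℝ × ℝ × ℝ => p.1) s := by
      fun_prop
    refine contDiffOn_pi.2 fun i => contDiffOn_pi.2 fun j => ?_
    fin_cases i <;> fin_cases j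
    · exact (h1.mul h3).sub ((h5.mul h2).mul h4)
    · exact (h1.mul h4).add ((h5.mul h2).mul h3)
    · exact h2.neg.mul h4
    · exact h2.mul h3
  have hNs : ContDiffOn ℝ ((⊤ : ℕ∞) : WithTop ℕ∞) N s := by
    have h' : ∀ i j, ContDiffOn ℝ ((⊤ : ℕ∞) : WithTop ℕ∞) (fun p => M p i j) s := fun i j =>
      contDiffOn_pi.1 (contDiffOn_pi.1 hMs i) j
    refine contDiffOn_pi.2 fun i => contDiffOn_pi.2 fun j => ?_
    fin_cases i <;> fin_cases j
    · exact h' 1 1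
    · exact (h' 0 1).neg
    · exact (h' 1 0).neg
    · exact h' 0 0
  have hso : IsOpen s := isOpen_lt continuous_const (by fun_prop)
  refine (contDiffOn_integral_test hso hNs hMs.continuousOn ?_ h hF).congr ?_
  · intro p hp t
    rw [hMe p hp, hNe p hp, lmul_entries_inv_cancel]
  · intro p hp
    have hp' : 0 < p.2.1 := hp
    rw [iwasawa_eq hp', ← one_mul (toG _), garding_mul_toG,
      isClosedEmbedding_entries.measurableEmbedding.integral_map]
    refine integral_congr_ae (Eventually.of_forall fun B => ?_)
    simp only [F]
    rw [isClosedEmbedding_entries.injective.extend_apply, hNe p hp', one_mul, mul_comm]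

end Garding

/-! ### Gårding vectors belong to the representation -/

section Membership

variable {Γ : Subgroup G} [DiscreteTopology Γ] {μX : Measure (LeftQuotient Γ)}
  [hX : IsRightInvariantMeasure μX]

/-- Right translation on `L²(Γ\G)`. -/
def translate (h : G) (f : Lp ℂ 2 μX) : Lp ℂ 2 μX :=
  Lp.compMeasurePreserving (rightMul Γ h) (hX.measurePreserving h) f

lemma coeFn_translate (h : G) (f : Lp ℂ 2 μX) :
    translate h f =ᵐ[μX] fun x => f (rightMul Γ h x) :=
  Lp.coeFn_compMeasurePreserving f (hX.measurePreserving h)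

lemma continuous_translate (f : Lp ℂ 2 μX) : Continuous fun h : G => translate h f := by
  have hc : Continuous fun p : G × LeftQuotient Γ => rightMul Γ p.1 p.2 :=
    continuous_rightMul_uncurry.comp continuous_swap
  let c : C(G × LeftQuotient Γ, LeftQuotient Γ) := ⟨_, hc⟩
  exact (continuous_const (y := f)).compMeasurePreservingLp c.curry.continuous
    (fun h => hX.measurePreserving h) ENNReal.ofNat_ne_top

/-- The operator `∫ κ(B) R(B) dB` on `L²(Γ\G)`. -/
def gardingLp (κ : MatSpace → ℂ) (f : Lp ℂ 2 μX) : Lp ℂ 2 μX :=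
  ∫ B : SL(2, ℝ), κ (entries B) • translate (toG B) f ∂haarSL

lemma integrable_gardingLp {κ : MatSpace → ℂ} (h : IsTest κ) (f : Lp ℂ 2 μX) :
    Integrable (fun B : SL(2, ℝ) => κ (entries B) • translate (toG B) f) haarSL :=
  (h.continuous_comp.smul ((continuous_translate f).comp continuous_toG)).integrable_of_hasCompactSupport
    h.hasCompactSupport_comp.smul_right

/-- A closed subspace is complete, so the vector-valued integral can be formed inside $V$ itself. -/
lemma gardingLp_mem {κ : MatSpace → ℂ} (h : IsTest κ) {V : Submodule ℂ (Lp ℂ 2 μX)}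
    (hV : IsClosed (V : Set (Lp ℂ 2 μX))) {f : Lp ℂ 2 μX} (hf : ∀ h : G, translate h f ∈ V) :
    gardingLp κ f ∈ V := by
  have hVc : CompleteSpace V := hV.completeSpace_coe
  let w : SL(2, ℝ) → V := fun B => κ (entries B) • ⟨translate (toG B) f, hf _⟩
  have hw : Integrable w haarSL := by
    refine Continuous.integrable_of_hasCompactSupport ?_ h.hasCompactSupport_comp.smul_right
    exact h.continuous_comp.smul (((continuous_translate f).comp continuous_toG).subtype_mk _)
  have := V.subtypeL.integral_comp_comm hw
  have e : gardingLp κ f = V.subtypeL (∫ B, w B ∂haarSL) := by rw [← this]; rfl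
  rw [e]
  exact (∫ B, w B ∂haarSL).2

/-- The vector-valued and the pointwise integral agree when paired with indicators of sets of finite
measure, by Fubini; this determines the function almost everywhere. -/
lemma gardingLp_ae_eq {κ : MatSpace → ℂ} (h : IsTest κ) (f : Lp ℂ 2 μX) :
    gardingLp κ f =ᵐ[μX] fun x => ∫ B : SL(2, ℝ), κ (entries B) * f (rightMul Γ (toG B) x) ∂haarSL := by
  have hprod : ∀ S : Set (LeftQuotient Γ), μX S < ∞ →
      Integrable (Function.uncurry fun (B : SL(2, ℝ)) x => κ (entries B) * f (rightMul Γ (toG B) x))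
        (haarSL.prod (μX.restrict S)) := by
    intro S hS
    have : IsFiniteMeasure (μX.restrict S) := ⟨by rwa [Measure.restrict_apply_univ]⟩
    have hfi : ∀ B : SL(2, ℝ), MemLp (fun x => f (rightMul Γ (toG B) x)) 2 (μX.restrict S) := fun B =>
      ((Lp.memLp f).comp_measurePreserving (hX.measurePreserving (toG B))).restrict S
    have hfi1 : ∀ B : SL(2, ℝ), Integrable (fun x => f (rightMul Γ (toG B) x)) (μX.restrict S) :=
      fun B => (hfi B).integrable (by norm_num)
    have hm : Measurable fun p : SL(2, ℝ) × LeftQuotient Γ => rightMul Γ (toG p.1) p.2 :=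
      (continuous_rightMul_uncurry.comp (continuous_snd.prodMk
        (continuous_toG.comp continuous_fst))).measurable
    have hsm : StronglyMeasurable fun p : SL(2, ℝ) × LeftQuotient Γ => f (rightMul Γ (toG p.1) p.2) :=
      (Lp.stronglyMeasurable f).comp_measurable hm
    have hκm : StronglyMeasurable fun p : SL(2, ℝ) × LeftQuotient Γ => κ (entries p.1) :=
      (h.continuous_comp.comp continuous_fst).measurable.stronglyMeasurable
    have hI : Integrable (fun B : SL(2, ℝ) => ‖κ (entries B)‖) haarSL :=
      (h.continuous_comp.integrable_of_hasCompactSupport h.hasCompactSupport_comp).norm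
    have hum : AEStronglyMeasurable (Function.uncurry fun (B : SL(2, ℝ)) x =>
        κ (entries B) * f (rightMul Γ (toG B) x)) (haarSL.prod (μX.restrict S)) :=
      (hκm.mul hsm).aestronglyMeasurable
    refine (integrable_prod_iff hum).2 ⟨Eventually.of_forall fun B =>
      (hfi1 B).const_mul (κ (entries B)), ?_⟩
    -- Hölder on $S$: the $L^1$ norm of each translate is at most $\|f\|_2\,\mu_X(S)^{1/2}$,
    -- independently of $B$.
    refine (hI.mul_const ((eLpNorm f 2 μX * μX S ^ (1 / (1 : ℝ) - 1 / 2)).toReal)).mono'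
      ((hκm.mul hsm).norm.integral_prod_right).aestronglyMeasurable (Eventually.of_forall fun B => ?_)
    rw [Real.norm_of_nonneg (integral_nonneg fun x => norm_nonneg _)]
    simp only [Function.uncurry_apply_pair, norm_mul, integral_const_mul]
    refine mul_le_mul_of_nonneg_left ?_ (norm_nonneg _)
    rw [integral_norm_eq_lintegral_enorm (hfi1 B).aestronglyMeasurable]
    refine ENNReal.toReal_mono ?_ ?_
    · exact ENNReal.mul_ne_top (Lp.memLp f).2.ne (ENNReal.rpow_ne_top_of_nonneg (by norm_num) hS.ne)
    · rw [← eLpNorm_one_eq_lintegral_enorm]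
      have h1 := eLpNorm_le_eLpNorm_mul_rpow_measure_univ (μ := μX.restrict S) (p := 1) (q := 2)
        (by norm_num) (hfi B).aestronglyMeasurable
      rw [Measure.restrict_apply_univ] at h1
      refine h1.trans ?_
      simp only [ENNReal.toReal_one, ENNReal.toReal_ofNat]
      gcongr
      refine (eLpNorm_mono_measure _ Measure.restrict_le_self).trans (le_of_eq ?_)
      exact eLpNorm_comp_measurePreserving (Lp.aestronglyMeasurable f) (hX.measurePreserving (toG B))
  refine ae_eq_of_forall_setIntegral_eq_of_sigmaFinite (fun S _ hS => ?_) (fun S _ hS => ?_)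
    fun S hSm hS => ?_
  · have : IsFiniteMeasure (μX.restrict S) := ⟨by rwa [Measure.restrict_apply_univ]⟩
    exact ((Lp.memLp (gardingLp κ f)).restrict S).integrable (by norm_num)
  · exact (hprod S hS).integral_prod_right
  · rw [← L2.inner_indicatorConstLp_one (𝕜 := ℂ) hSm hS.ne, gardingLp,
      ← integral_inner (integrable_gardingLp h f), ← integral_integral_swap (hprod S hS)]
    refine integral_congr_ae (Eventually.of_forall fun B => ?_)
    simp only
    rw [inner_smul_right, L2.inner_indicatorConstLp_one, integral_const_mul]
    congr 1
    exact integral_congr_ae (ae_restrict_of_ae (coeFn_translate (toG B) f))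

lemma represents_gardingLp (μ : Measure G) [μ.IsHaarMeasure] [QuotientMeasureEqMeasurePreimage μ μX]
    {κ : MatSpace → ℂ} (h : IsTest κ) (f : Lp ℂ 2 μX) :
    Represents μ (garding κ f) (gardingLp κ f) :=
  (quasiMeasurePreserving_proj μ μX).ae (gardingLp_ae_eq h f)

lemma IsSubrepresentation.translate_mem' {μ : Measure G} [μ.IsHaarMeasure]
    [QuotientMeasureEqMeasurePreimage μ μX] {V : Submodule ℂ (Lp ℂ 2 μX)}
    (hV : IsSubrepresentation μ V) {f : Lp ℂ 2 μX} (hf : f ∈ V) (h : G) : translate h f ∈ V :=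
  hV.translate_mem f hf h _ ((quasiMeasurePreserving_proj μ μX).ae (coeFn_translate h f))

lemma IsSubrepresentation.exists_represents_garding {μ : Measure G} [μ.IsHaarMeasure]
    [QuotientMeasureEqMeasurePreimage μ μX] {V : Submodule ℂ (Lp ℂ 2 μX)}
    (hV : IsSubrepresentation μ V) {f : Lp ℂ 2 μX} (hf : f ∈ V) {κ : MatSpace → ℂ} (h : IsTest κ) :
    ∃ F ∈ V, Represents μ (garding κ f) F :=
  ⟨gardingLp κ f, gardingLp_mem h hV.isClosed fun g => hV.translate_mem' hf g,
    represents_gardingLp μ h f⟩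

end Membership

/-! ### Projection of test functions to a given weight -/

section WeightTest

/-- The component of weight `m` of a test function. -/
def weightTest (m : ℤ) (κ : MatSpace → ℂ) (t : MatSpace) : ℂ :=
  ∫ θ in Set.Ioc 0 Real.pi, Complex.exp (-(2 * m * Complex.I * θ)) *
    κ (lmul (entries (kMat (-θ))) t)

lemma kMat_inv (θ : ℝ) : (kMat θ)⁻¹ = kMat (-θ) := by
  rw [inv_eq_iff_mul_eq_one, ← kMat_add, add_neg_cancel, kMat_zero]

lemma continuous_kMat : Continuous kMat := by
  refine continuous_SL_iff.2 fun i j => ?_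
  fin_cases i <;> fin_cases j <;> simp <;> fun_prop

lemma continuous_entries_kMat : Continuous fun θ => entries (kMat θ) :=
  isClosedEmbedding_entries.continuous.comp continuous_kMat

lemma contDiff_entries_kMat : ContDiff ℝ ((⊤ : ℕ∞) : WithTop ℕ∞) fun θ => entries (kMat θ) := by
  refine contDiff_pi.2 fun i => contDiff_pi.2 fun j => ?_
  fin_cases i <;> fin_cases j <;> simp [entries] <;> fun_prop

/-- The set of matrices obtained by rotating the support of a test function. -/
def rotatedSupport (κ : MatSpace → ℂ) : Set MatSpace :=
  (fun q : ℝ × MatSpace => lmul (entries (kMat q.1)) q.2) '' (Set.Icc 0 Real.pi ×ˢ tsupport κ)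

lemma IsTest.isCompact_rotatedSupport {κ : MatSpace → ℂ} (h : IsTest κ) :
    IsCompact (rotatedSupport κ) :=
  (isCompact_Icc.prod h.hasCompactSupport.isCompact).image
    (continuous_lmul.comp ((continuous_entries_kMat.comp continuous_fst).prodMk continuous_snd))

lemma eq_zero_of_notMem_rotatedSupport {κ : MatSpace → ℂ} {t : MatSpace}
    (ht : t ∉ rotatedSupport κ) {θ : ℝ} (hθ : θ ∈ Set.Icc 0 Real.pi) :
    κ (lmul (entries (kMat (-θ))) t) = 0 := by
  by_contra h0
  refine ht ⟨(θ, lmul (entries (kMat (-θ))) t), ⟨hθ, subset_tsupport κ h0⟩, ?_⟩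
  simp only
  rw [← kMat_inv, lmul_entries_inv_cancel]

lemma IsTest.weightTest {κ : MatSpace → ℂ} (h : IsTest κ) (m : ℤ) : IsTest (weightTest m κ) := by
  constructor
  · let χ : ContDiffBump (0 : ℝ) := ⟨4, 5, by norm_num, by norm_num⟩
    have hexp : Continuous fun θ : ℝ => Complex.exp (-(2 * m * Complex.I * θ)) := by fun_prop
    have key := contDiffOn_convolution_right_with_param (n := ⊤) (ContinuousLinearMap.mul ℝ ℂ)
      (f := fun θ : ℝ => Complex.exp (-(2 * m * Complex.I * θ)))
      (μ := volume.restrict (Set.Ioc 0 Real.pi))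
      (g := fun (t : MatSpace) (s : ℝ) => ((χ (-s) : ℝ) : ℂ) * κ (lmul (entries (kMat s)) t))
      (s := Set.univ) (k := Metric.closedBall 0 5) isOpen_univ (isCompact_closedBall _ _) ?_
      hexp.locallyIntegrable ?_
    · have := key.comp (contDiffOn_id.prodMk (contDiffOn_const (c := (0 : ℝ))))
        (s := Set.univ) fun p hp => ⟨hp, Set.mem_univ _⟩
      refine contDiffOn_univ.1 (this.congr fun t _ => ?_)
      simp only [convolution, Function.comp, id, BaseRep.weightTest, zero_sub, neg_neg,
        ContinuousLinearMap.mul_apply']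
      refine setIntegral_congr_fun measurableSet_Ioc fun θ hθ => ?_
      rw [χ.one_of_mem_closedBall, Complex.ofReal_one, one_mul]
      rw [mem_closedBall_zero_iff, Real.norm_of_nonneg hθ.1.le]
      exact hθ.2.trans Real.pi_le_four
    · intro t s _ hs
      rw [χ.zero_of_le_dist, Complex.ofReal_zero, zero_mul]
      rw [dist_zero_right, norm_neg]
      rw [mem_closedBall_zero_iff, not_le] at hs
      exact hs.le
    · refine ContDiff.contDiffOn (ContDiff.mul ?_ ?_)
      · exact Complex.ofRealCLM.contDiff.comp (χ.contDiff.comp contDiff_snd.neg)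
      · exact h.contDiff.comp (contDiff_lmul.comp ((contDiff_entries_kMat.comp contDiff_snd).prodMk
          contDiff_fst))
  · refine HasCompactSupport.intro h.isCompact_rotatedSupport fun t ht => ?_
    rw [BaseRep.weightTest]
    refine setIntegral_eq_zero_of_forall_eq_zero fun θ hθ => ?_
    rw [eq_zero_of_notMem_rotatedSupport ht ⟨hθ.1.le, hθ.2⟩, mul_zero]

variable {Γ : Subgroup G} {f : LeftQuotient Γ → ℂ}

/-- Fubini turns averaging of the test function over rotations into averaging of the Gårding vector.
Angles run over $(0,\pi]$ because $k_\pi=1$ in $\mathrm{PSL}_2(\mathbb R)$. -/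
lemma garding_weightTest {κ : MatSpace → ℂ} (h : IsTest κ) (hf : HasIntegrableLifts f) (m : ℤ)
    (g : G) : garding (weightTest m κ) f g = ∫ θ in Set.Ioc 0 Real.pi,
      Complex.exp (-(2 * m * Complex.I * θ)) * garding κ f (g * kElt θ) := by
  have hl : LocallyIntegrable (fun B : SL(2, ℝ) => f (proj Γ (g * toG B))) haarSL := hf g
  set H : SL(2, ℝ) → ℂ := fun B => f (proj Γ (g * toG B)) with hH
  obtain ⟨C, hC⟩ := h.hasCompactSupport.exists_bound_of_continuous h.contDiff.continuous
  set K : Set SL(2, ℝ) := entries ⁻¹' rotatedSupport κ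
  have hK : IsCompact K := isClosedEmbedding_entries.isCompact_preimage h.isCompact_rotatedSupport
  have hexp : Continuous fun θ : ℝ => Complex.exp (-(2 * m * Complex.I * θ)) := by fun_prop
  have hnorm : ∀ θ : ℝ, ‖Complex.exp (-(2 * m * Complex.I * θ))‖ = 1 := fun θ => by
    have : -(2 * m * Complex.I * θ : ℂ) = ((-(2 * m * θ) : ℝ) : ℂ) * Complex.I := by
      push_cast; ring
    rw [this, Complex.norm_exp_ofReal_mul_I]
  have hint : Integrable (Function.uncurry fun (B : SL(2, ℝ)) (θ : ℝ) =>
      Complex.exp (-(2 * m * Complex.I * θ)) * κ (lmul (entries (kMat (-θ))) (entries B)) * H B)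
      (haarSL.prod (volume.restrict (Set.Ioc 0 Real.pi))) := by
    have hI : Integrable (fun q : SL(2, ℝ) × ℝ => C * K.indicator (fun B => ‖H B‖) q.1)
        (haarSL.prod (volume.restrict (Set.Ioc 0 Real.pi))) := by
      refine Integrable.comp_fst (f := fun B => C * K.indicator (fun B => ‖H B‖) B) ?_ _
      refine Integrable.const_mul ?_ C
      rw [integrable_indicator_iff hK.measurableSet]
      exact (hl.integrableOn_isCompact hK).norm
    have hc : Continuous fun q : SL(2, ℝ) × ℝ => Complex.exp (-(2 * m * Complex.I * q.2)) *
        κ (lmul (entries (kMat (-q.2))) (entries q.1)) := by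
      refine (hexp.comp continuous_snd).mul (h.contDiff.continuous.comp (continuous_lmul.comp
        (Continuous.prodMk ?_ ?_)))
      · exact continuous_entries_kMat.comp continuous_snd.neg
      · exact isClosedEmbedding_entries.continuous.comp continuous_fst
    refine hI.mono' (hc.aestronglyMeasurable.mul hl.aestronglyMeasurable.comp_fst) ?_
    have hs : ∀ᵐ q ∂(haarSL.prod (volume.restrict (Set.Ioc 0 Real.pi))), q.2 ∈ Set.Ioc 0 Real.pi :=
      Measure.quasiMeasurePreserving_snd.ae (ae_restrict_mem measurableSet_Ioc)
    filter_upwards [hs] with q hq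
    rw [Function.uncurry, norm_mul, norm_mul, hnorm, one_mul]
    by_cases hB : q.1 ∈ K
    · rw [Set.indicator_of_mem hB]
      gcongr
      exact hC _
    · rw [Set.indicator_of_notMem hB, eq_zero_of_notMem_rotatedSupport hB ⟨hq.1.le, hq.2⟩,
        norm_zero, zero_mul, mul_zero]
  have h1 : garding (weightTest m κ) f g = ∫ B, (∫ θ in Set.Ioc 0 Real.pi,
      Complex.exp (-(2 * m * Complex.I * θ)) * κ (lmul (entries (kMat (-θ))) (entries B)) * H B)
      ∂haarSL := by
    rw [garding]
    refine integral_congr_ae (Eventually.of_forall fun B => ?_)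
    simp only [weightTest]
    rw [integral_mul_const]
  rw [h1, integral_integral_swap hint]
  refine integral_congr_ae (Eventually.of_forall fun θ => ?_)
  simp only [mul_assoc]
  rw [integral_const_mul, garding_mul_kElt, kMat_inv, garding]

lemma exp_two_pi_periodic (m : ℤ) (θ : ℝ) :
    Complex.exp (-(2 * m * Complex.I * ((θ + Real.pi : ℝ) : ℂ))) =
      Complex.exp (-(2 * m * Complex.I * θ)) := by
  rw [Complex.exp_eq_exp_iff_exists_int]
  exact ⟨-m, by push_cast; ring⟩

lemma hasWeight_garding_weightTest {κ : MatSpace → ℂ} (h : IsTest κ) (hf : HasIntegrableLifts f)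
    (m : ℤ) : HasWeight m (garding (weightTest m κ) f) := by
  intro g η
  rw [garding_weightTest h hf, garding_weightTest h hf,
    ← intervalIntegral.integral_of_le Real.pi_pos.le, ← intervalIntegral.integral_of_le Real.pi_pos.le]
  set F : ℝ → ℂ := fun θ => Complex.exp (-(2 * m * Complex.I * θ)) * garding κ f (g * kElt θ) with hF
  have hp : Function.Periodic F Real.pi := fun θ => by
    simp only [hF]
    rw [exp_two_pi_periodic, kElt_add, kElt_pi, mul_one]
  have e : ∀ θ : ℝ, Complex.exp (-(2 * m * Complex.I * θ)) * garding κ f (g * kElt η * kElt θ) =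
      Complex.exp (2 * m * Complex.I * η) * F (θ + η) := fun θ => by
    simp only [hF]
    rw [mul_assoc g, ← kElt_add, ← mul_assoc, ← Complex.exp_add, add_comm η]
    congr 2
    push_cast
    ring
  simp only [e]
  rw [intervalIntegral.integral_const_mul, intervalIntegral.integral_comp_add_right F, zero_add,
    add_comm Real.pi, hp.intervalIntegral_add_eq η 0, zero_add]

end WeightTest

/-! ### Nonzero vectors have nonzero Gårding vectors of some weight -/

/-- Zero coefficients are summable, so the Fourier series converges pointwise to the function, and
its sum is zero. -/
lemma eq_zero_of_fourier {h : ℝ → ℂ} (hc : Continuous h) (hp : Function.Periodic h Real.pi)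
    (h0 : ∀ m : ℤ, ∫ θ in Set.Ioc 0 Real.pi, Complex.exp (-(2 * m * Complex.I * θ)) * h θ = 0)
    (θ : ℝ) : h θ = 0 := by
  have : Fact (0 < Real.pi) := ⟨Real.pi_pos⟩
  have hq : IsQuotientMap (fun x : ℝ => (x : AddCircle Real.pi)) := isQuotientMap_quotient_mk'
  let f : C(AddCircle Real.pi, ℂ) := ⟨hp.lift, hq.continuous_iff.2 hc⟩
  have hf : ∀ x : ℝ, f x = h x := fun x => hp.lift_coe x
  have hcoef : ∀ m, fourierCoeff f m = 0 := by
    intro m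
    rw [fourierCoeff_eq_intervalIntegral f m 0, zero_add,
      intervalIntegral.integral_of_le Real.pi_pos.le]
    refine smul_eq_zero_of_right _ (Eq.trans ?_ (h0 m))
    refine integral_congr_ae (Eventually.of_forall fun x => ?_)
    simp only [hf, smul_eq_mul]
    rw [fourier_coe_apply]
    congr 2
    have : (Real.pi : ℂ) ≠ 0 := by exact_mod_cast Real.pi_ne_zero
    push_cast
    field_simp
  have hs := has_pointwise_sum_fourier_series_of_summable (f := f)
    (by rw [funext hcoef]; exact summable_zero) (θ : AddCircle Real.pi)
  simp only [hcoef, zero_smul] at hs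
  rw [← hf, hs.unique hasSum_zero]

section

variable {Γ : Subgroup G} {f : LeftQuotient Γ → ℂ}

lemma continuous_garding_kElt {κ : MatSpace → ℂ} (h : IsTest κ) (hf : HasIntegrableLifts f)
    (g : G) : Continuous fun θ => garding κ f (g * kElt θ) := by
  obtain ⟨x, y, θ₀, hy, rfl⟩ := exists_eq_iwasawa g
  have e : (fun θ => garding κ f (iwasawa x y θ₀ * kElt θ)) =
      fun θ => garding κ f (iwasawa x y (θ₀ + θ)) := by
    funext θ
    rw [iwasawa, mul_assoc, ← kElt_add]; rfl
  rw [e]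
  exact (isSmooth_garding h hf).continuousOn.comp_continuous
    (f := fun θ : ℝ => (x, y, θ₀ + θ)) (by fun_prop) fun _ => hy

lemma garding_eq_zero_of_weightTest {κ : MatSpace → ℂ} (h : IsTest κ) (hf : HasIntegrableLifts f)
    (g : G) (h0 : ∀ m : ℤ, garding (weightTest m κ) f g = 0) : garding κ f g = 0 := by
  have := eq_zero_of_fourier (continuous_garding_kElt h hf g)
    (fun θ => by simp only; rw [kElt_add, kElt_pi, mul_one])
    (fun m => by rw [← garding_weightTest h hf, h0]) 0
  simpa [kElt_zero] using this

/-- At the identity the Gårding vectors are the pairings of the lift of $f$ with test functions, and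
these determine the lift almost everywhere. -/
lemma ae_eq_zero_of_garding (hf : HasIntegrableLifts f)
    (h0 : ∀ κ, IsTest κ → garding κ f 1 = 0) : ∀ᵐ B ∂haarSL, f (proj Γ (toG B)) = 0 := by
  have h1 := ae_eq_zero_of_integral_contDiff_smul_eq_zero (HasIntegrableLifts.locallyIntegrable_extend hf)
    fun κ hκ hκc => ?_
  · have h2 := ae_of_ae_map isClosedEmbedding_entries.continuous.aemeasurable h1
    filter_upwards [h2] with B hB
    rwa [isClosedEmbedding_entries.injective.extend_apply] at hB
  · have ht : IsTest fun t => ((κ t : ℝ) : ℂ) :=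
      ⟨Complex.ofRealCLM.contDiff.comp hκ, hκc.comp_left Complex.ofReal_zero⟩
    rw [isClosedEmbedding_entries.measurableEmbedding.integral_map, ← h0 _ ht, garding]
    refine integral_congr_ae (Eventually.of_forall fun B => ?_)
    simp only
    rw [isClosedEmbedding_entries.injective.extend_apply, one_mul, Complex.real_smul]

lemma ae_quotient_of_ae [DiscreteTopology Γ] (μ : Measure G)
    (μX : Measure (LeftQuotient Γ)) [QuotientMeasureEqMeasurePreimage μ μX]
    {s : Set (LeftQuotient Γ)} (hs : MeasurableSet s) (h : ∀ᵐ g ∂μ, proj Γ g ∈ s) :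
    ∀ᵐ x ∂μX, x ∈ s := by
  obtain ⟨D, hD, hu⟩ := exists_fundamentalDomain Γ
  have hmp := measurePreserving_proj μ μX (isFundamentalDomain_of_strict μ hD hu)
  rw [← hmp.map_eq]
  exact (ae_map_iff (measurable_proj Γ).aemeasurable hs).2 (ae_restrict_of_ae h)

lemma ae_of_ae_haarSL [DiscreteTopology Γ] (μ : Measure G) [μ.IsHaarMeasure]
    (μX : Measure (LeftQuotient Γ)) [QuotientMeasureEqMeasurePreimage μ μX]
    {s : Set (LeftQuotient Γ)} (hs : MeasurableSet s) (h : ∀ᵐ B ∂haarSL, proj Γ (toG B) ∈ s) :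
    ∀ᵐ x ∂μX, x ∈ s := by
  have hne : Measure.haarScalarFactor (haarSL.map toG) μ ≠ 0 := by
    intro h0
    have h1 := map_toG_eq_smul μ
    rw [h0, zero_smul, Measure.map_eq_zero_iff continuous_toG.aemeasurable] at h1
    exact Measure.IsOpenPosMeasure.open_pos (μ := haarSL) Set.univ isOpen_univ Set.univ_nonempty
      (by rw [h1]; rfl)
  have h1 : ∀ᵐ g ∂(haarSL.map toG), proj Γ g ∈ s :=
    (ae_map_iff continuous_toG.aemeasurable (measurable_proj Γ hs)).2 h
  rw [map_toG_eq_smul μ] at h1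
  have h2 : ∀ᵐ g ∂μ, proj Γ g ∈ s := by
    have h3 : (Measure.haarScalarFactor (haarSL.map toG) μ • μ) {g | ¬ proj Γ g ∈ s} = 0 := h1
    rw [Measure.smul_apply, smul_eq_zero] at h3
    exact h3.resolve_left hne
  exact ae_quotient_of_ae μ μX hs h2

/-- Otherwise all weight components of all Gårding vectors vanish; then all Gårding vectors vanish
at the identity by Fourier uniqueness, and so does $f$. -/
lemma exists_garding_ne_zero [DiscreteTopology Γ] (μ : Measure G) [μ.IsHaarMeasure]
    {μX : Measure (LeftQuotient Γ)} [QuotientMeasureEqMeasurePreimage μ μX] {f : Lp ℂ 2 μX}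
    (hf : f ≠ 0) : ∃ (m : ℤ) (κ : MatSpace → ℂ) (g : G), IsTest κ ∧
      HasWeight m (garding κ f) ∧ garding κ f g ≠ 0 := by
  by_contra! hcon
  have hl := hasIntegrableLifts μ f
  refine hf ((Lp.eq_zero_iff_ae_eq_zero).2 ?_)
  refine ae_of_ae_haarSL μ μX
    (measurableSet_eq_fun (Lp.stronglyMeasurable f).measurable measurable_const) ?_
  exact ae_eq_zero_of_garding hl fun κ hκ => garding_eq_zero_of_weightTest hκ hl 1 fun m =>
    hcon m _ 1 (hκ.weightTest m) (hasWeight_garding_weightTest hκ hl m)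

end

/-! ### Gårding vectors of given weight -/

section Ladder

variable {Γ : Subgroup G}

/-- A Gårding vector of weight `m` obtained from `f`. -/
structure IsGardingVector (f : LeftQuotient Γ → ℂ) (m : ℤ) (φ : G → ℂ) : Prop where
  exists_test : ∃ κ, IsTest κ ∧ φ = garding κ f
  weight : HasWeight m φ

namespace IsGardingVector

variable {f : LeftQuotient Γ → ℂ} {m : ℤ} {φ : G → ℂ}

lemma isLeftInvariant (h : IsGardingVector f m φ) : IsLeftInvariant Γ φ := by
  obtain ⟨κ, -, rfl⟩ := h.exists_test
  exact isLeftInvariant_garding κ f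

lemma isSmooth (h : IsGardingVector f m φ) (hf : HasIntegrableLifts f) : IsSmooth φ := by
  obtain ⟨κ, hκ, rfl⟩ := h.exists_test
  exact isSmooth_garding hκ hf

lemma continuous (h : IsGardingVector f m φ) (hf : HasIntegrableLifts f) : Continuous φ :=
  (h.isSmooth hf).continuous h.weight

lemma const_mul (h : IsGardingVector f m φ) (c : ℂ) : IsGardingVector f m fun g => c * φ g := by
  obtain ⟨κ, hκ, rfl⟩ := h.exists_test
  exact ⟨⟨fun t => c * κ t, hκ.const_mul c, funext fun g => (garding_const_mul c κ f g).symm⟩,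
    h.weight.const_mul c⟩

/-- Differentiating and rotating only change the test function, and the two parts are linear
combinations of the derivative and one rotate of it. The ladder therefore stays among the Gårding
vectors of the same $f$. -/
lemma exists_flowDeriv (h : IsGardingVector f m φ) (hf : HasIntegrableLifts f) :
    ∃ φ', HasFlowDeriv φ φ' ∧ IsGardingVector f (m + 1) (upperPart m φ') ∧
      IsGardingVector f (m - 1) (lowerPart m φ') := by
  have hs := h.isSmooth hf
  obtain ⟨κ, hκ, rfl⟩ := h.exists_test
  have hd := hasFlowDeriv_garding hκ hf
  have hκ' := hκ.flowDerivTest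
  have hr := hκ'.comp_lmul (kMat (Real.pi / 4))⁻¹
  set e : ℂ := Complex.I * Complex.exp (-(m * Complex.I * Real.pi / 2)) with he
  refine ⟨_, hd, ⟨⟨_, (hκ'.const_mul (1 / 2)).add (hr.const_mul (-e / 2)), ?_⟩,
    h.weight.upperPart hs hd⟩, ⟨⟨_, (hκ'.const_mul (1 / 2)).add (hr.const_mul (e / 2)), ?_⟩,
    h.weight.lowerPart hs hd⟩⟩
  · funext g
    rw [garding_add (hκ'.const_mul _) (hr.const_mul _) hf, garding_const_mul, garding_const_mul,
      upperPart, garding_mul_kElt, ← he]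
    ring
  · funext g
    rw [garding_add (hκ'.const_mul _) (hr.const_mul _) hf, garding_const_mul, garding_const_mul,
      lowerPart, garding_mul_kElt, ← he]
    ring

end IsGardingVector

lemma Represents.ae_eq_desc [DiscreteTopology Γ] {μ : Measure G} {μX : Measure (LeftQuotient Γ)}
    [QuotientMeasureEqMeasurePreimage μ μX] {φ : G → ℂ} {F : Lp ℂ 2 μX} (h : Represents μ φ F)
    (hφ : IsLeftInvariant Γ φ) (hc : Continuous φ) : F =ᵐ[μX] desc Γ φ := by
  refine ae_quotient_of_ae μ μX (measurableSet_eq_fun (Lp.stronglyMeasurable F).measurable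
    (continuous_desc hφ hc).measurable) ?_
  filter_upwards [h] with g hg
  change F (proj Γ g) = desc Γ φ (proj Γ g)
  rw [hg, desc_proj hφ]

lemma Represents.integrable_norm_sq [DiscreteTopology Γ] {μ : Measure G}
    {μX : Measure (LeftQuotient Γ)} [QuotientMeasureEqMeasurePreimage μ μX] {φ : G → ℂ}
    {F : Lp ℂ 2 μX} (h : Represents μ φ F) (hφ : IsLeftInvariant Γ φ) (hc : Continuous φ) :
    Integrable (desc Γ fun g => ‖φ g‖ ^ 2) μX := by
  refine ((memLp_two_iff_integrable_sq_norm (Lp.aestronglyMeasurable F)).1 (Lp.memLp F)).congr ?_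
  filter_upwards [h.ae_eq_desc hφ hc] with x hx
  rw [hx]; rfl

end Ladder

/-! ### Multiplicity one -/

section MultiplicityOne

variable {Γ : Subgroup G} [DiscreteTopology Γ] {μ : Measure G} [μ.IsHaarMeasure]
  {μX : Measure (LeftQuotient Γ)} [QuotientMeasureEqMeasurePreimage μ μX]
  [IsRightInvariantMeasure μX] {δ : ℝ} {σ : Measure ℝ} [IsFiniteMeasure σ]
  {V : Submodule ℂ (Lp ℂ 2 μX)} {f : Lp ℂ 2 μX}

lemma IsGardingVector.exists_represents {m : ℤ} {φ : G → ℂ} (h : IsGardingVector f m φ)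
    (hV : IsBaseRepresentation μ δ V) (hf : f ∈ V) : ∃ F ∈ V, Represents μ φ F := by
  obtain ⟨κ, hκ, rfl⟩ := h.exists_test
  exact hV.isSubrepresentation.exists_represents_garding hf hκ

lemma IsGardingVector.casimir_eq {m : ℤ} {φ : G → ℂ} (h : IsGardingVector f m φ)
    (hV : IsBaseRepresentation μ δ V) (hf : f ∈ V) (x y θ : ℝ) (hy : 0 < y) :
    casimir φ x y θ = (δ * (1 - δ) : ℝ) * φ (iwasawa x y θ) := by
  obtain ⟨F, hF, hr⟩ := h.exists_represents hV hf
  exact hV.casimir_eq F hF φ (h.isSmooth (hasIntegrableLifts μ f)) hr x y θ hy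

lemma IsGardingVector.integrable_norm_sq {m : ℤ} {φ : G → ℂ} (h : IsGardingVector f m φ)
    (hV : IsBaseRepresentation μ δ V) (hf : f ∈ V) :
    Integrable (desc Γ fun g => ‖φ g‖ ^ 2) μX := by
  obtain ⟨F, -, hr⟩ := h.exists_represents hV hf
  exact hr.integrable_norm_sq h.isLeftInvariant (h.continuous (hasIntegrableLifts μ f))

/-- For an integer $m$ the product $m(m+1)$ is nonnegative, while $\delta(1-\delta)>0$. Hence
raising followed by lowering never annihilates a nonzero vector. -/
lemma casimir_add_ne_zero (hδ₁ : 1 / 2 < δ) (hδ₂ : δ < 1) (m : ℤ) :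
    (((δ * (1 - δ) : ℝ) : ℂ) + m * (m + 1)) ≠ 0 := by
  have h1 : 0 ≤ m * (m + 1) := by
    rcases le_or_gt 0 m with h | h
    · positivity
    · nlinarith
  have h2 : (0 : ℝ) ≤ m * (m + 1) := by exact_mod_cast h1
  have h3 : 0 < δ * (1 - δ) := mul_pos (by linarith) (by linarith)
  have h4 : (δ * (1 - δ) + m * (m + 1) : ℝ) ≠ 0 := by positivity
  exact_mod_cast h4

variable (μ) in
/-- A Gårding vector of weight zero is a multiple of the base eigenfunction. -/
lemma IsGardingVector.eq_const_mul_zero {φ : G → ℂ} (h : IsGardingVector f 0 φ)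
    (hV : IsBaseRepresentation μ δ V) (hf : f ∈ V) (hb : SquareIntegrableBase δ σ μX) (hσ : σ ≠ 0) :
    ∃ c : ℂ, ∀ g, φ g = c * weightVec δ σ 0 g := by
  have hl := hasIntegrableLifts μ f
  have hw := h.weight
  have hs := h.isSmooth hl
  obtain ⟨φ', hd, hu, hlo⟩ := h.exists_flowDeriv hl
  obtain ⟨p', hdp, hpu, hpl⟩ := hu.exists_flowDeriv hl
  obtain ⟨n', hdn, hnu, hnl⟩ := hlo.exists_flowDeriv hl
  have e1 := lowerPart_upperPart hs hw hd (hu.isSmooth hl) hdp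
    (fun x y θ hy => h.casimir_eq hV hf x y θ hy)
  have e2 := upperPart_lowerPart hs hw hd (hlo.isSmooth hl) hdn
    (fun x y θ hy => h.casimir_eq hV hf x y θ hy)
  have hsum : φ' = fun g => upperPart 0 φ' g + lowerPart 0 φ' g :=
    funext fun g => (upperPart_add_lowerPart 0 φ' g).symm
  have hd' : HasFlowDeriv φ' fun g => p' g + n' g := by
    rw [hsum]
    exact hdp.add hdn
  have hφ'c : Continuous φ' := by
    rw [hsum]
    exact (hu.continuous hl).add (hlo.continuous hl)
  have hφ'i : Integrable (desc Γ fun g => ‖φ' g‖ ^ 2) μX := by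
    have hw : Integrable (desc Γ fun g => ‖upperPart 0 φ' g‖ ^ 2 + ‖lowerPart 0 φ' g‖ ^ 2) μX :=
      (hu.integrable_norm_sq hV hf).add (hlo.integrable_norm_sq hV hf)
    have hφ' := hd.isLeftInvariant h.isLeftInvariant
    refine (hw.const_mul 2).mono' (continuous_desc (φ := fun g => ‖φ' g‖ ^ 2)
      (fun γ hγ g => by simp only [hφ' γ hγ]) (hφ'c.norm.pow 2)).aestronglyMeasurable
      (Eventually.of_forall fun x => ?_)
    simp only [desc]
    rw [Real.norm_of_nonneg (sq_nonneg _), ← upperPart_add_lowerPart 0 φ']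
    have h1 := norm_add_le (upperPart 0 φ' x.out) (lowerPart 0 φ' x.out)
    have h2 := mul_self_le_mul_self (norm_nonneg _) h1
    nlinarith [sq_nonneg (‖upperPart 0 φ' x.out‖ - ‖lowerPart 0 φ' x.out‖)]
  -- The second flow derivative has parts of weight $2$, $0$ and $-2$. Lowering after raising and
  -- raising after lowering each contribute $-\delta(1-\delta)/4$ to the middle one.
  obtain ⟨c, hc⟩ := eq_const_mul_baseVec hb hσ h.isLeftInvariant hpu.isLeftInvariant
    hnl.isLeftInvariant (h.continuous hl) hφ'c (hpu.continuous hl) (hnl.continuous hl) hd hd' hw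
    hpu.weight hnl.weight (fun g => by
      rw [← upperPart_add_lowerPart (0 + 1) p' g, ← upperPart_add_lowerPart (0 - 1) n' g, e1, e2]
      push_cast
      ring)
    ((((h.integrable_norm_sq hV hf).add hφ'i).add (hpu.integrable_norm_sq hV hf)).add
      (hnl.integrable_norm_sq hV hf))
  exact ⟨c, fun g => by rw [hc, weightVec_zero]⟩

variable (μ) in
/-- The Gårding vectors of weight `m` are multiples of `weightVec δ σ m`. -/
lemma IsGardingVector.eq_const_mul (hV : IsBaseRepresentation μ δ V) (hf : f ∈ V)
    (hb : SquareIntegrableBase δ σ μX) (hσ : σ ≠ 0) (m : ℤ) :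
    ∀ {φ : G → ℂ}, IsGardingVector f m φ → ∃ c : ℂ, ∀ g, φ g = c * weightVec δ σ m g := by
  have hl := hasIntegrableLifts μ f
  have hδ := hb.nonneg
  induction m using Int.induction_on with
  | zero => exact fun h => h.eq_const_mul_zero μ hV hf hb hσ
  | succ i ih =>
    intro φ h
    obtain ⟨φ', hd, hu, hlo⟩ := h.exists_flowDeriv hl
    obtain ⟨n', hdn, hnu, hnl⟩ := hlo.exists_flowDeriv hl
    have e2 := upperPart_lowerPart (h.isSmooth hl) h.weight hd (hlo.isSmooth hl) hdn
      (fun x y θ hy => h.casimir_eq hV hf x y θ hy)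
    rw [add_sub_cancel_right] at e2 hlo
    -- The lowered vector is a multiple of $v_i$ by induction. Raising it again yields a multiple of
    -- $v_{i+1}$ on one side and a nonzero multiple of $\varphi$ on the other.
    obtain ⟨c, hc⟩ := ih hlo
    have hd2 := (hasFlowDeriv_weightVec (σ := σ) hδ i).const_mul c
    rw [← funext hc] at hd2
    have e3 := hdn.unique hd2
    have e4 : upperPart i n' = fun g => c * ((δ + i) / 2) * weightVec δ σ (i + 1) g := by
      rw [e3, ← upperPart_add (m := i)
        ((hasWeight_weightVec δ σ (i + 1)).const_mul (c * ((δ + i) / 2)))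
        ((hasWeight_weightVec δ σ (i - 1)).const_mul (c * ((δ - i) / 2)))]
      congr 1
      funext g
      push_cast
      ring
    have hne := casimir_add_ne_zero hb.half_lt hb.lt_one (i : ℤ)
    refine ⟨-4 * (c * ((δ + i) / 2)) / ((δ * (1 - δ) : ℝ) + ((i : ℤ) : ℂ) * ((i : ℤ) + 1)),
      fun g => ?_⟩
    have e5 := e2 g
    rw [e4] at e5
    rw [div_mul_eq_mul_div, eq_div_iff hne]
    push_cast at e5 ⊢
    linear_combination 4 * e5
  | pred i ih =>
    intro φ h
    obtain ⟨φ', hd, hu, hlo⟩ := h.exists_flowDeriv hl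
    obtain ⟨p', hdp, hpu, hpl⟩ := hu.exists_flowDeriv hl
    have e2 := lowerPart_upperPart (h.isSmooth hl) h.weight hd (hu.isSmooth hl) hdp
      (fun x y θ hy => h.casimir_eq hV hf x y θ hy)
    rw [sub_add_cancel] at e2 hu
    obtain ⟨c, hc⟩ := ih hu
    have hd2 := (hasFlowDeriv_weightVec (σ := σ) hδ (-i)).const_mul c
    rw [← funext hc] at hd2
    have e3 := hdp.unique hd2
    have e4 : lowerPart (-i) p' = fun g => c * ((δ + i) / 2) * weightVec δ σ (-i - 1) g := by
      rw [e3, ← lowerPart_add (m := -i)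
        ((hasWeight_weightVec δ σ (-i + 1)).const_mul (c * ((δ - i) / 2)))
        ((hasWeight_weightVec δ σ (-i - 1)).const_mul (c * ((δ + i) / 2)))]
      congr 1
      funext g
      push_cast
      ring
    have hne := casimir_add_ne_zero hb.half_lt hb.lt_one (i : ℤ)
    refine ⟨-4 * (c * ((δ + i) / 2)) / ((δ * (1 - δ) : ℝ) + ((i : ℤ) : ℂ) * ((i : ℤ) + 1)),
      fun g => ?_⟩
    have e5 := e2 g
    rw [e4] at e5
    rw [div_mul_eq_mul_div, eq_div_iff hne]
    push_cast at e5 ⊢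
    linear_combination 4 * e5

lemma IsGardingVector.weightVec_succ {m : ℤ} (h : IsGardingVector f m (weightVec δ σ m))
    (hl : HasIntegrableLifts f) (hδ₁ : 1 / 2 < δ) (hδ₂ : δ < 1) :
    IsGardingVector f (m + 1) (weightVec δ σ (m + 1)) := by
  obtain ⟨φ', hd, hu, -⟩ := h.exists_flowDeriv hl
  rw [hd.unique (hasFlowDeriv_weightVec (σ := σ) (by linarith) m),
    upperPart_add ((hasWeight_weightVec δ σ (m + 1)).const_mul _)
      ((hasWeight_weightVec δ σ (m - 1)).const_mul _)] at hu
  have h0 : ((δ + m) / 2 : ℂ) ≠ 0 := div_ne_zero (add_int_ne_zero hδ₁ hδ₂ m) two_ne_zero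
  have := hu.const_mul ((δ + m) / 2 : ℂ)⁻¹
  simpa only [inv_mul_cancel_left₀ h0] using this

lemma IsGardingVector.weightVec_pred {m : ℤ} (h : IsGardingVector f m (weightVec δ σ m))
    (hl : HasIntegrableLifts f) (hδ₁ : 1 / 2 < δ) (hδ₂ : δ < 1) :
    IsGardingVector f (m - 1) (weightVec δ σ (m - 1)) := by
  obtain ⟨φ', hd, -, hu⟩ := h.exists_flowDeriv hl
  rw [hd.unique (hasFlowDeriv_weightVec (σ := σ) (by linarith) m),
    lowerPart_add ((hasWeight_weightVec δ σ (m + 1)).const_mul _)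
      ((hasWeight_weightVec δ σ (m - 1)).const_mul _)] at hu
  have h0 : ((δ - m) / 2 : ℂ) ≠ 0 := by
    have := add_int_ne_zero hδ₁ hδ₂ (-m)
    push_cast at this
    exact div_ne_zero (by rwa [sub_eq_add_neg]) two_ne_zero
  have := hu.const_mul ((δ - m) / 2 : ℂ)⁻¹
  simpa only [inv_mul_cancel_left₀ h0] using this

/-- One nonzero Gårding vector of some weight $m_0$ is a nonzero multiple of $v_{m_0}$. Raising and
lowering from there reaches every weight, since $\delta\pm m$ never vanishes. -/
lemma exists_isGardingVector_weightVec (hV : IsBaseRepresentation μ δ V)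
    (hb : SquareIntegrableBase δ σ μX) (hσ : σ ≠ 0) :
    ∃ f ∈ V, ∀ m : ℤ, IsGardingVector f m (weightVec δ σ m) := by
  have hne : V ≠ ⊥ := by
    rintro rfl
    exact hV.infinite_dimensional inferInstance
  obtain ⟨f, hf, hf0⟩ := Submodule.exists_mem_ne_zero_of_ne_bot hne
  refine ⟨f, hf, ?_⟩
  have hl := hasIntegrableLifts μ f
  obtain ⟨m₀, κ, g, hκ, hw, hg⟩ := exists_garding_ne_zero μ hf0
  have h0 : IsGardingVector f m₀ (garding κ f) := ⟨⟨κ, hκ, rfl⟩, hw⟩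
  obtain ⟨c, hc⟩ := IsGardingVector.eq_const_mul μ hV hf hb hσ m₀ h0
  have hc0 : c ≠ 0 := by
    rintro rfl
    exact hg (by rw [hc, zero_mul])
  have h1 : IsGardingVector f m₀ (weightVec δ σ m₀) := by
    have := h0.const_mul c⁻¹
    simpa only [hc, inv_mul_cancel_left₀ hc0] using this
  intro m
  induction m using Int.inductionOn' (b := m₀) with
  | zero => exact h1
  | succ k _ ih => exact ih.weightVec_succ hl hb.half_lt hb.lt_one
  | pred k _ ih => exact ih.weightVec_pred hl hb.half_lt hb.lt_one

end MultiplicityOne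

/-! ### Smooth vectors of given weight -/

section Uniqueness

variable {Γ : Subgroup G} [DiscreteTopology Γ] {μ : Measure G} [μ.IsHaarMeasure]
  {μX : Measure (LeftQuotient Γ)} [QuotientMeasureEqMeasurePreimage μ μX]

lemma norm_exp_weight (m : ℤ) (θ : ℝ) : ‖Complex.exp (-(2 * m * Complex.I * θ))‖ = 1 := by
  have : -(2 * m * Complex.I * θ : ℂ) = ((-(2 * m * θ) : ℝ) : ℂ) * Complex.I := by
    push_cast; ring
  rw [this, Complex.norm_exp_ofReal_mul_I]

lemma Represents.garding_eq {φ : G → ℂ} {f : Lp ℂ 2 μX} (h : Represents μ φ f) (κ : MatSpace → ℂ)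
    (g : G) : garding κ f g = ∫ B : SL(2, ℝ), κ (entries B) * φ (g * toG B) ∂haarSL := by
  refine integral_congr_ae ?_
  filter_upwards [ae_haarSL_of_ae μ h g] with B hB
  rw [hB]

/-- Smoothing by a bump function approximates a continuous vector of given weight. -/
lemma exists_test_approx {m : ℤ} {φ : G → ℂ} {f : Lp ℂ 2 μX} (h : Represents μ φ f)
    (hc : Continuous φ) (hw : HasWeight m φ) (g₁ g₂ : G) {ε : ℝ} (hε : 0 < ε) :
    ∃ κ, IsTest κ ∧ ∃ I : ℝ, 0 < I ∧
      ‖garding (weightTest m κ) f g₁ - Real.pi * I * φ g₁‖ ≤ ε * I * Real.pi ∧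
      ‖garding (weightTest m κ) f g₂ - Real.pi * I * φ g₂‖ ≤ ε * I * Real.pi := by
  have hl := hasIntegrableLifts μ f
  -- The error made by a small right translation, measured along the whole rotation orbit. By
  -- compactness of $[0,\pi]$ it is small for $B$ near $1$, uniformly in the angle.
  let Δ : G → ℝ × SL(2, ℝ) → ℂ := fun g q => φ (g * kElt q.1 * toG q.2) - φ (g * kElt q.1)
  have hΔ : ∀ g, Continuous (Δ g) := fun g => by
    have h1 : Continuous fun q : ℝ × SL(2, ℝ) => g * kElt q.1 :=
      continuous_const.mul (continuous_kElt.comp continuous_fst)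
    exact (hc.comp (h1.mul (continuous_toG.comp continuous_snd))).sub (hc.comp h1)
  have hO : IsOpen {q | ‖Δ g₁ q‖ < ε ∧ ‖Δ g₂ q‖ < ε} :=
    (isOpen_lt (hΔ g₁).norm continuous_const).inter (isOpen_lt (hΔ g₂).norm continuous_const)
  obtain ⟨u, v, -, hv, hu, h1v, huv⟩ := generalized_tube_lemma (s := Set.Icc 0 Real.pi) isCompact_Icc
    (t := {(1 : SL(2, ℝ))}) isCompact_singleton hO (by
      rintro ⟨θ, B⟩ ⟨-, hB⟩
      obtain rfl : B = 1 := hB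
      simp [Δ, toG_one, hε])
  have hv1 : v ∈ 𝓝 (1 : SL(2, ℝ)) := hv.mem_nhds (h1v rfl)
  rw [isClosedEmbedding_entries.isInducing.nhds_eq_comap, mem_comap] at hv1
  obtain ⟨W, hW, hWv⟩ := hv1
  obtain ⟨r, hr, hrW⟩ := Metric.mem_nhds_iff.1 hW
  let χ : ContDiffBump (entries 1) := ⟨r / 2, r, by positivity, by linarith⟩
  have ht : IsTest fun t => ((χ t : ℝ) : ℂ) :=
    ⟨Complex.ofRealCLM.contDiff.comp χ.contDiff, χ.hasCompactSupport.comp_left Complex.ofReal_zero⟩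
  have hχc : Continuous fun B => χ (entries B) :=
    χ.continuous.comp isClosedEmbedding_entries.continuous
  have hχs : HasCompactSupport fun B => χ (entries B) :=
    χ.hasCompactSupport.comp_isClosedEmbedding isClosedEmbedding_entries
  have hχi : Integrable (fun B => χ (entries B)) haarSL := hχc.integrable_of_hasCompactSupport hχs
  set I : ℝ := ∫ B, χ (entries B) ∂haarSL with hI
  have hIpos : 0 < I := hχc.integral_pos_of_hasCompactSupport_nonneg_nonzero (x := 1) hχs
    (fun B => χ.nonneg) (by rw [χ.one_of_mem_closedBall (Metric.mem_closedBall_self χ.rIn_pos.le)]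
                            exact one_ne_zero)
  have key : ∀ g, (∀ q ∈ u ×ˢ v, ‖Δ g q‖ < ε) →
      ‖garding (weightTest m fun t => ((χ t : ℝ) : ℂ)) f g - Real.pi * I * φ g‖ ≤ ε * I * Real.pi := by
    intro g hg
    have h1 : ∀ θ ∈ Set.Ioc 0 Real.pi,
        ‖garding (fun t => ((χ t : ℝ) : ℂ)) f (g * kElt θ) - I * φ (g * kElt θ)‖ ≤ ε * I := by
      intro θ hθ
      have e : garding (fun t => ((χ t : ℝ) : ℂ)) f (g * kElt θ) - I * φ (g * kElt θ) =
          ∫ B, ((χ (entries B) : ℝ) : ℂ) * Δ g (θ, B) ∂haarSL := by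
        have hi : Integrable (fun B : SL(2, ℝ) => ((χ (entries B) : ℝ) : ℂ) *
            φ (g * kElt θ * toG B)) haarSL := by
          refine (integrable_garding ht hl (g * kElt θ)).congr ?_
          filter_upwards [ae_haarSL_of_ae μ h (g * kElt θ)] with B hB
          rw [hB]
        have hi' : Integrable (fun B : SL(2, ℝ) => ((χ (entries B) : ℝ) : ℂ) * φ (g * kElt θ))
            haarSL := (hχi.ofReal (𝕜 := ℂ)).mul_const _
        rw [h.garding_eq, hI, ← integral_complex_ofReal, ← integral_mul_const, ← integral_sub hi hi']
        refine integral_congr_ae (Eventually.of_forall fun B => ?_)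
        simp only [Δ, mul_sub]
      rw [e, hI, ← integral_const_mul]
      refine norm_integral_le_of_norm_le (hχi.const_mul ε) (Eventually.of_forall fun B => ?_)
      rw [norm_mul, Complex.norm_real, Real.norm_of_nonneg χ.nonneg, mul_comm]
      by_cases hB : entries B ∈ Metric.ball (entries 1) r
      · exact mul_le_mul_of_nonneg_right (hg (θ, B) ⟨hu ⟨hθ.1.le, hθ.2⟩, hWv (hrW hB)⟩).le χ.nonneg
      · rw [χ.zero_of_le_dist (not_lt.1 hB), mul_zero, mul_zero]
    have hexp : Continuous fun θ : ℝ => Complex.exp (-(2 * m * Complex.I * θ)) := by fun_prop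
    -- Since $\varphi$ already has weight $m$, projecting it to that weight only multiplies it by
    -- the length $\pi$ of the interval.
    have e2 : (Real.pi * I * φ g : ℂ) = ∫ θ in Set.Ioc 0 Real.pi,
        Complex.exp (-(2 * m * Complex.I * θ)) * (I * φ (g * kElt θ)) := by
      have : ∀ θ : ℝ, Complex.exp (-(2 * m * Complex.I * θ)) * (I * φ (g * kElt θ)) = I * φ g := by
        intro θ
        rw [hw, Complex.exp_neg]
        field_simp
      simp only [this]
      rw [setIntegral_const]
      simp [Real.pi_pos.le, mul_assoc]
    rw [garding_weightTest ht hl, e2, ← integral_sub]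
    · have h3 := norm_setIntegral_le_of_norm_le_const (μ := volume) (s := Set.Ioc 0 Real.pi)
        (f := fun θ : ℝ => Complex.exp (-(2 * m * Complex.I * θ)) *
          garding (fun t => ((χ t : ℝ) : ℂ)) f (g * kElt θ) -
          Complex.exp (-(2 * m * Complex.I * θ)) * (I * φ (g * kElt θ))) (C := ε * I)
        (by simp) (fun θ hθ => by
          rw [← mul_sub, norm_mul, norm_exp_weight, one_mul]
          exact h1 θ hθ)
      refine h3.trans (le_of_eq ?_)
      simp [Measure.real, Real.pi_pos.le]
    · exact (hexp.mul (continuous_garding_kElt ht hl g)).integrableOn_Ioc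
    · exact (hexp.mul (continuous_const.mul (hc.comp (continuous_const.mul
        continuous_kElt)))).integrableOn_Ioc
  exact ⟨_, ht, I, hIpos, key g₁ fun q hq => (huv hq).1, key g₂ fun q hq => (huv hq).2⟩

variable [IsRightInvariantMeasure μX] {δ : ℝ} {σ : Measure ℝ} [IsFiniteMeasure σ]
  {V : Submodule ℂ (Lp ℂ 2 μX)}

/-- The smooth vectors of weight `m` in `V` are multiples of `weightVec δ σ m`. -/
lemma eq_const_mul_weightVec (hV : IsBaseRepresentation μ δ V) (hb : SquareIntegrableBase δ σ μX)
    (hσ : σ ≠ 0) {m : ℤ} {φ : G → ℂ} (hs : IsSmooth φ) (hw : HasWeight m φ) {f : Lp ℂ 2 μX}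
    (hf : f ∈ V) (h : Represents μ φ f) {g₀ : G} (hg₀ : weightVec δ σ m g₀ ≠ 0) :
    ∃ c : ℂ, ∀ g, φ g = c * weightVec δ σ m g := by
  have hl := hasIntegrableLifts μ f
  set W := weightVec δ σ m with hW
  refine ⟨φ g₀ / W g₀, fun g => ?_⟩
  -- Both $\varphi(g)$ and $\varphi(g_0)$ are approximated, up to a common factor, by values of one
  -- Gårding vector, which is proportional to $W$. So this determinant is arbitrarily small, hence
  -- zero.
  have hT : φ g * W g₀ - φ g₀ * W g = 0 := by
    rw [← norm_le_zero_iff]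
    refine le_of_forall_pos_le_add fun η hη => ?_
    set M := ‖W g₀‖ + ‖W g‖ with hM
    have hMpos : 0 < M := add_pos_of_pos_of_nonneg (norm_pos_iff.2 hg₀) (norm_nonneg _)
    obtain ⟨κ, hκ, I, hI, h1, h2⟩ := exists_test_approx h (hs.continuous hw) hw g g₀
      (div_pos hη hMpos)
    obtain ⟨c, hc⟩ := IsGardingVector.eq_const_mul μ hV hf hb hσ m
      ⟨⟨_, hκ.weightTest m, rfl⟩, hasWeight_garding_weightTest hκ hl m⟩
    rw [hc, ← hW] at h1 h2
    have hπI : 0 < Real.pi * I := mul_pos Real.pi_pos hI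
    have e : (Real.pi * I : ℂ) * (φ g * W g₀ - φ g₀ * W g) =
        (c * W g₀ - Real.pi * I * φ g₀) * W g - (c * W g - Real.pi * I * φ g) * W g₀ := by ring
    have h3 : Real.pi * I * ‖φ g * W g₀ - φ g₀ * W g‖ ≤ Real.pi * I * η := by
      have : ‖(Real.pi * I : ℂ)‖ = Real.pi * I := by
        rw [← Complex.ofReal_mul, Complex.norm_real, Real.norm_of_nonneg hπI.le]
      rw [← this, ← norm_mul, e, this]
      refine (norm_sub_le _ _).trans ?_
      rw [norm_mul, norm_mul]
      calc _ ≤ η / M * I * Real.pi * ‖W g‖ + η / M * I * Real.pi * ‖W g₀‖ := by gcongr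
        _ = Real.pi * I * η := by
          have := hMpos.ne'
          rw [← mul_add, add_comm ‖W g‖, ← hM]
          field_simp
    rw [zero_add]
    exact le_of_mul_le_mul_left h3 hπI
  rw [div_mul_eq_mul_div, eq_div_iff hg₀]
  exact sub_eq_zero.1 hT

end Uniqueness

/-! ### The measure on the boundary and the base eigenfunction -/

section Boundary

variable {Γ : Subgroup G}

/-- A Patterson measure is a finite multiple of a probability measure, and so is finite on the real
line. -/
lemma isFiniteMeasure_onReal {ν : Measure (OnePoint ℂ)} (hν : IsPattersonMeasure Γ ν) :
    IsFiniteMeasure (onReal ν) := by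
  obtain ⟨c, ν₀, s, -, hc, hp, rfl, -, -⟩ := hν
  have he : MeasurableEmbedding fun u : ℝ => ((u : ℂ) : OnePoint ℂ) :=
    OnePoint.isOpenEmbedding_coe.measurableEmbedding.comp
      Complex.isometry_ofReal.isClosedEmbedding.measurableEmbedding
  refine ⟨?_⟩
  rw [onReal, he.comap_apply, Measure.smul_apply, smul_eq_mul]
  exact ENNReal.mul_lt_top hc.lt_top (measure_lt_top ν₀ _)

variable [DiscreteTopology Γ] {μ : Measure G} [μ.IsHaarMeasure] {μX : Measure (LeftQuotient Γ)}
  [QuotientMeasureEqMeasurePreimage μ μX] {δ : ℝ} {ν : Measure (OnePoint ℂ)}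

/-- A zero boundary measure would give norm zero instead of one. -/
lemma onReal_ne_zero
    (hnorm : HasUnitNorm Γ μ fun g => baseEigenfunction δ ν (g • UpperHalfPlane.I)) :
    onReal ν ≠ 0 := by
  intro h0
  obtain ⟨D, hD, hu⟩ := exists_fundamentalDomain Γ
  have h := hnorm D (isFundamentalDomain_of_strict μ hD hu)
  simp [baseEigenfunction, h0] at h

lemma continuous_baseVec {σ : Measure ℝ} [IsFiniteMeasure σ] (hδ : 0 ≤ δ) :
    Continuous (baseVec δ σ) := by
  have h : baseVec δ σ = fun g => (weightVec δ σ 0 g).re := by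
    funext g
    rw [weightVec_zero, Complex.ofReal_re]
  rw [h]
  exact Complex.continuous_re.comp (continuous_weightVec hδ 0)

lemma lintegral_desc_baseVec [IsFiniteMeasure (onReal ν)] (hδ : 0 ≤ δ)
    (hi : IsLeftInvariant Γ (baseVec δ (onReal ν)))
    (hnorm : HasUnitNorm Γ μ fun g => baseEigenfunction δ ν (g • UpperHalfPlane.I)) :
    ∫⁻ x, ‖desc Γ (baseVec δ (onReal ν)) x‖ₑ ^ 2 ∂μX = 1 := by
  obtain ⟨D, hD, hu⟩ := exists_fundamentalDomain Γ
  have hf := isFundamentalDomain_of_strict μ hD hu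
  have hm : Measurable fun x => ‖desc Γ (baseVec δ (onReal ν)) x‖ₑ ^ 2 :=
    (continuous_desc hi (continuous_baseVec hδ)).measurable.enorm.pow_const 2
  rw [← hnorm D hf, ← (measurePreserving_proj μ μX hf).lintegral_comp hm]
  simp only [desc_proj hi, baseVec_eq_baseEigenfunction]

/-- Both invariance and square integrability come from the normalisation over all fundamental
domains. -/
lemma squareIntegrableBase [IsFiniteMeasure (onReal ν)] (hδ₁ : 1 / 2 < δ) (hδ₂ : δ < 1)
    (hnorm : HasUnitNorm Γ μ fun g => baseEigenfunction δ ν (g • UpperHalfPlane.I)) :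
    SquareIntegrableBase δ (onReal ν) μX := by
  have hδ : 0 ≤ δ := by linarith
  have hc := continuous_baseVec (σ := onReal ν) hδ
  have hi : IsLeftInvariant Γ (baseVec δ (onReal ν)) := by
    refine isLeftInvariant_of_hasUnitNorm μ hc (baseVec_pos hδ (onReal_ne_zero hnorm)) ?_
    simpa only [← baseVec_eq_baseEigenfunction] using hnorm
  refine ⟨hδ₁, hδ₂, hi, ?_⟩
  have hd := continuous_desc hi hc
  refine (memLp_two_iff_integrable_sq (f := desc Γ (baseVec δ (onReal ν)))
    hd.aestronglyMeasurable).1 ⟨hd.aestronglyMeasurable, ?_⟩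
  rw [eLpNorm_lt_top_iff_lintegral_rpow_enorm_lt_top two_ne_zero ENNReal.ofNat_ne_top]
  have h1 := lintegral_desc_baseVec (μX := μX) hδ hi hnorm
  simp only [ENNReal.toReal_ofNat, ENNReal.rpow_ofNat]
  rw [h1]
  exact ENNReal.one_lt_top

lemma integral_norm_sq_weightVec_zero [IsFiniteMeasure (onReal ν)] (hδ : 0 ≤ δ)
    (hi : IsLeftInvariant Γ (baseVec δ (onReal ν)))
    (hnorm : HasUnitNorm Γ μ fun g => baseEigenfunction δ ν (g • UpperHalfPlane.I)) :
    ∫ x, ‖desc Γ (weightVec δ (onReal ν) 0) x‖ ^ 2 ∂μX = 1 := by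
  have hd := continuous_desc hi (continuous_baseVec (σ := onReal ν) hδ)
  have hi0 : IsLeftInvariant Γ (weightVec δ (onReal ν) 0) := fun γ hγ g => by
    rw [weightVec_zero, weightVec_zero, hi γ hγ]
  rw [integral_eq_lintegral_of_nonneg_ae (Eventually.of_forall fun x => sq_nonneg _)
    ((continuous_desc hi0 (continuous_weightVec hδ 0)).norm.pow 2).aestronglyMeasurable,
    ← ENNReal.toReal_one, ← lintegral_desc_baseVec (μX := μX) hδ hi hnorm]
  congr 1
  refine lintegral_congr fun x => ?_
  simp only [desc, weightVec_zero]
  rw [Complex.norm_real, ← ofReal_norm, ENNReal.ofReal_pow (norm_nonneg _)]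

lemma integral_norm_sq_conj (σ : Measure ℝ) (m : ℤ) :
    ∫ x, ‖desc Γ (weightVec δ σ (-m)) x‖ ^ 2 ∂μX = ∫ x, ‖desc Γ (weightVec δ σ m) x‖ ^ 2 ∂μX := by
  refine integral_congr_ae (Eventually.of_forall fun x => ?_)
  simp only [desc]
  rw [← conj_weightVec, RCLike.norm_conj]

lemma gammaFactor_pos (hδ₁ : 1 / 2 < δ) (hδ₂ : δ < 1) (ℓ : ℕ) : 0 < gammaFactor δ ℓ := by
  have h : (0 : ℝ) ≤ ℓ := Nat.cast_nonneg ℓ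
  have h1 := Real.Gamma_pos_of_pos (s := δ) (by linarith)
  have h2 := Real.Gamma_pos_of_pos (s := δ + ℓ) (by linarith)
  have h3 := Real.Gamma_pos_of_pos (s := 1 - δ) (by linarith)
  have h4 := Real.Gamma_pos_of_pos (s := 1 - δ + ℓ) (by linarith)
  rw [gammaFactor]
  positivity

lemma Represents.norm_sq_eq {φ : G → ℂ} {F : Lp ℂ 2 μX} (h : Represents μ φ F)
    (hφ : IsLeftInvariant Γ φ) (hc : Continuous φ) :
    ‖F‖ ^ 2 = ∫ x, ‖desc Γ φ x‖ ^ 2 ∂μX := by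
  have h1 : ((‖F‖ ^ 2 : ℝ) : ℂ) = ((∫ x, ‖F x‖ ^ 2 ∂μX : ℝ) : ℂ) := by
    rw [← integral_complex_ofReal]
    have h2 := inner_self_eq_norm_sq_to_K (𝕜 := ℂ) F
    rw [L2.inner_def] at h2
    push_cast
    rw [← Complex.coe_algebraMap]
    refine h2.symm.trans (integral_congr_ae (Eventually.of_forall fun x => ?_))
    exact inner_self_eq_norm_sq_to_K (𝕜 := ℂ) (F x)
  rw [Complex.ofReal_inj.1 h1]
  refine integral_congr_ae ?_
  filter_upwards [h.ae_eq_desc hφ hc] with x hx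
  rw [hx]

end Boundary

end BaseRep

end

theorem theorem2p2
    (Γ : Subgroup BaseRep.G)
    (hdiscrete : DiscreteTopology Γ)
    (htorsion : ∀ γ ∈ Γ, γ ≠ 1 → ∀ n : ℕ, 0 < n → γ ^ n ≠ 1)
    (hfg : Γ.FG)
    (δ : ℝ) (hδ : δ = BaseRep.criticalExponent Γ) (hδ₁ : 1 / 2 < δ) (hδ₂ : δ < 1)
    (μ : Measure BaseRep.G) [μ.IsHaarMeasure]
    (μX : Measure (BaseRep.LeftQuotient Γ)) [QuotientMeasureEqMeasurePreimage μ μX]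
    (V : Submodule ℂ (Lp ℂ 2 μX)) (hV : BaseRep.IsBaseRepresentation μ δ V)
    (ν : Measure (OnePoint ℂ)) (hν : BaseRep.IsPattersonMeasure Γ ν)
    (hnorm : BaseRep.HasUnitNorm Γ μ fun g =>
      BaseRep.baseEigenfunction δ ν (g • UpperHalfPlane.I))
    (ℓ : ℕ) (ε : ℤˣ) :
    (∃ φ : BaseRep.G → ℂ, BaseRep.IsUnitKTypeVector μ V ((ε : ℤ) * ℓ) φ) ∧
    ∀ φ : BaseRep.G → ℂ, BaseRep.IsUnitKTypeVector μ V ((ε : ℤ) * ℓ) φ →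
      (∃ c : ℂ, ‖c‖ = 1 ∧ ∀ x y θ : ℝ, 0 < y →
        φ (BaseRep.iwasawa x y θ) = c * BaseRep.explicitVector δ ν ε ℓ x y θ) ∧
      ∀ (x y : ℝ) (hy : 0 < y),
        ‖φ (BaseRep.nElt x * BaseRep.aElt y)‖ ≤
          BaseRep.gammaFactor δ ℓ * BaseRep.baseEigenfunction δ ν ⟨⟨x, y⟩, hy⟩ := by
  open BaseRep in
  have hfin := isFiniteMeasure_onReal hν
  have hX := isRightInvariantMeasure μ μX
  have hb : SquareIntegrableBase δ (onReal ν) μX := squareIntegrableBase hδ₁ hδ₂ hnorm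
  have hσ : onReal ν ≠ 0 := onReal_ne_zero hnorm
  have hδ0 := hb.nonneg
  set W := weightVec δ (onReal ν) ((ε : ℤ) * ℓ) with hW
  set r := gammaFactor δ ℓ with hr
  have hrpos : 0 < r := gammaFactor_pos hδ₁ hδ₂ ℓ
  have hWn : r ^ 2 * ∫ x, ‖desc Γ W x‖ ^ 2 ∂μX = 1 := by
    have h1 := gammaFactor_sq_mul_integral (μX := μX) hb ℓ
    rw [integral_norm_sq_weightVec_zero hδ0 hb.invariant hnorm] at h1
    -- The negative sign reduces to the positive one by conjugation, which preserves the norm.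
    rcases Int.units_eq_one_or ε with rfl | rfl
    · simpa [hW, hr] using h1
    · rw [hW, hr, ← h1]
      congr 1
      simp only [Units.val_neg, Units.val_one, neg_mul, one_mul]
      exact integral_norm_sq_conj _ _
  obtain ⟨f, hf, hg⟩ := exists_isGardingVector_weightVec hV hb hσ
  have hl := hasIntegrableLifts μ f
  have hW0 : ∃ g₀, W g₀ ≠ 0 := by
    by_contra! hcon
    simp [desc, hcon] at hWn
  refine ⟨⟨fun g => r * W g, ?_⟩, fun φ hφ => ?_⟩
  · have hrW := (hg ((ε : ℤ) * ℓ)).const_mul (r : ℂ)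
    obtain ⟨F, hF, hrep⟩ := hrW.exists_represents hV hf
    refine ⟨hrW.isLeftInvariant, hrW.isSmooth hl, hrW.weight, F, hF, ?_, hrep⟩
    have h1 := hrep.norm_sq_eq hrW.isLeftInvariant (hrW.continuous hl)
    have h2 : ∫ x, ‖desc Γ (fun g => (r : ℂ) * W g) x‖ ^ 2 ∂μX = 1 := by
      rw [← hWn, ← integral_const_mul]
      refine integral_congr_ae (Filter.Eventually.of_forall fun x => ?_)
      simp [desc, mul_pow]
    rw [h2] at h1
    exact (pow_eq_one_iff_of_nonneg (norm_nonneg _) two_ne_zero).1 h1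
  · obtain ⟨F, hF, hF1, hrep⟩ := hφ.mem
    have hw : HasWeight ((ε : ℤ) * ℓ) φ := hφ.ktype
    obtain ⟨g₀, hg₀⟩ := hW0
    obtain ⟨c, hc⟩ := eq_const_mul_weightVec hV hb hσ hφ.smooth hw hF hrep hg₀
    rw [← hW] at hc
    have hcn : ‖c / r‖ = 1 := by
      have h1 := hrep.norm_sq_eq hφ.left_invariant (hφ.smooth.continuous hw)
      have h2 : ∫ x, ‖desc Γ φ x‖ ^ 2 ∂μX = ‖c‖ ^ 2 * ∫ x, ‖desc Γ W x‖ ^ 2 ∂μX := by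
        rw [← integral_const_mul]
        refine integral_congr_ae (Filter.Eventually.of_forall fun x => ?_)
        simp [desc, hc, mul_pow]
      rw [hF1, h2, one_pow] at h1
      -- Both $\varphi=cW$ and $rW$ have norm one, so $|c|=r$ and $c/r$ is the required unimodular
      -- factor.
      have h3 : ‖c‖ ^ 2 = r ^ 2 := by
        have : ∫ x, ‖desc Γ W x‖ ^ 2 ∂μX ≠ 0 := fun h0 => by simp [h0] at hWn
        exact mul_right_cancel₀ this (h1.symm.trans hWn.symm)
      have h4 : ‖c‖ = r := (pow_left_inj₀ (norm_nonneg _) hrpos.le two_ne_zero).1 h3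
      rw [norm_div, h4, Complex.norm_real, Real.norm_of_nonneg hrpos.le, div_self hrpos.ne']
    have hrc : (r : ℂ) ≠ 0 := by exact_mod_cast hrpos.ne'
    have hφW : ∀ g, φ g = c / r * (r * W g) := fun g => by
      rw [hc]
      field_simp
    refine ⟨⟨c / r, hcn, fun x y θ hy => ?_⟩, fun x y hy => ?_⟩
    · rw [hφW, weightVec_iwasawa δ ν ε ℓ hy]
    · have e : nElt x * aElt y = iwasawa x y 0 := by rw [iwasawa, kElt_zero, mul_one]
      -- The unimodular factor drops out, and the bound reduces to $|v_m|\le v_0$.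
      rw [hφW, norm_mul, hcn, one_mul, norm_mul, Complex.norm_real, Real.norm_of_nonneg hrpos.le, e]
      refine mul_le_mul_of_nonneg_left ?_ hrpos.le
      refine (norm_weightVec_le _ _ _ _).trans_eq ?_
      rw [baseVec_eq_baseEigenfunction, iwasawa_smul_I hy]
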